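/- Setting. Let $d\in\{2,3\}$ and let $\Omega\subset\mathbb{R}^d$ be a bounded polytopal domain with Lipschitz boundary. Let $\mathscr{T}_0$ be a conforming partition of $\bar\Omega$ into finitely many simplices, and let $\mathbb{T}$ be a family of conforming simplicial partitions of $\bar\Omega$ that refine $\mathscr{T}_0$ and are shape regular with a common constant $\sigma$: $h_T\le\sigma\rho_T$ for every simplex $T$ of every mesh of $\mathbb{T}$, where $h_T=\operatorname{diam}(T)$ and $\rho_T$ is the diameter of the largest ball contained in $T$. Let $y_\Omega\in L^2(\Omega)$, $\nu>0$ and $\mathtt{a}<\mathtt{b}$ be real numbers, and $\mathbb{U}_{ad}=\{u\in L^2(\Omega):\mathtt{a}\le u\le \mathtt{b}\text{ a.e. in }\Omega\}$. Let $a:\Omega\times\mathbb{R}\to\mathbb{R}$, $a=a(x,y)$, be such that * (A.1) $a$ is a Carathéodory function of class $C^2$ with respect to $y$, and $a(\cdot,0)\in L^2(\Omega)$; * (A.2) $\frac{\partial a}{\partial y}(x,y)\ge 0$ for a.e. $x\in\Omega$ and all $y\in\mathbb{R}$; * (A.3) for every $M>0$ there is $C_M>0$ such that $\left|\frac{\partial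 a}{\partial y}(x,y)\right|+\left|\frac{\partial^2 a}{\partial y^2}(x,y)\right|\le C_M$ for a.e. $x\in\Omega$ and all $|y|\le M$. Put $J(y,u)=\frac12\|y-y_\Omega\|_{L^2(\Omega)}^2+\frac\nu2\|u\|_{L^2(\Omega)}^2$. The continuous control problem is to minimize $J(y,u)$ over $u\in\mathbb{U}_{ad}$, where $y\in H_0^1(\Omega)\cap L^\infty(\Omega)$ solves $$(\nabla y,\nabla v)_{L^2(\Omega)}+(a(\cdot,y),v)_{L^2(\Omega)}=(u,v)_{L^2(\Omega)}\qquad\forall\, v\in H_0^1(\Omega).$$ For $\mathscr{T}\in\mathbb{T}$ let $\mathbb{V}(\mathscr{T})$ be the space of the functions in $C(\bar\Omega)\cap H_0^1(\Omega)$ that are affine on each $T\in\mathscr{T}$, and let $\mathbb{U}_{ad}(\mathscr{T})$ be the set of the functions in $\mathbb{U}_{ad}$ that are constant on each $T\in\mathscr{T}$. The discrete control problem is to minimize $J(y_{\mathscr{T}},u_{\mathscr{T}})$ over $u_{\mathscr{T}}\in\mathbb{U}_{ad}(\mathscr{T})$, where $y_{\mathscr{T}}\in\mathbb{V}(\mathscr{T})$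 solves the same equation with all test functions $v\in\mathbb{V}(\mathscr{T})$. Local solutions and local minima are understood with respect to the $L^2(\Omega)$-distance of the controls. For $\mathscr{T}\in\mathbb{T}$, a local minimum $\bar u_{\mathscr{T}}$ of the discrete problem and its state $\bar y_{\mathscr{T}}$, the discrete adjoint state $\bar p_{\mathscr{T}}\in\mathbb{V}(\mathscr{T})$ is defined by $$(\nabla w,\nabla \bar p_{\mathscr{T}})_{L^2(\Omega)}+\left(\tfrac{\partial a}{\partial y}(\cdot,\bar y_{\mathscr{T}})\bar p_{\mathscr{T}},w\right)_{L^2(\Omega)}=(\bar y_{\mathscr{T}}-y_\Omega,w)_{L^2(\Omega)}\qquad\forall\, w\in\mathbb{V}(\mathscr{T}),$$ and $\hat p\in H_0^1(\Omega)$ is defined by $$(\nabla w,\nabla \hat p)_{L^2(\Omega)}+\left(\tfrac{\partial a}{\partial y}(\cdot,\bar y_{\mathscr{T}})\hat p,w\right)_{L^2(\Omega)}=(\bar y_{\mathscr{T}}-y_\Omega,w)_{L^2(\Omega)}\qquad\forall\, w\in H_0^1(\Omega).$$ Finally, let $$\mathcal{E}_{ad}^2=\sum_{T\in\mathscr{T}}\left(h_T^2\left\|\bar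 y_{\mathscr{T}}-y_\Omega-\tfrac{\partial a}{\partial y}(\cdot,\bar y_{\mathscr{T}})\bar p_{\mathscr{T}}\right\|_{L^2(T)}^2+h_T\left\|[\![\nabla\bar p_{\mathscr{T}}\cdot\boldsymbol{\nu}]\!]\right\|_{L^2(\partial T\setminus\partial\Omega)}^2\right),$$ where, on the common side $S$ of two simplices $T^+$ and $T^-$, $[\![\nabla\bar p_{\mathscr{T}}\cdot\boldsymbol{\nu}]\!]=\boldsymbol{\nu}^+\cdot\nabla \bar p_{\mathscr{T}}|_{T^+}+\boldsymbol{\nu}^-\cdot\nabla \bar p_{\mathscr{T}}|_{T^-}$ and $\boldsymbol{\nu}^\pm$ is the unit normal to $S$ that points towards $T^\pm$. Lemma. There is a constant $C>0$, depending only on $d$, $\Omega$, $\mathscr{T}_0$ and $\sigma$, such that the following holds for all data $a,y_\Omega,\nu,\mathtt{a},\mathtt{b}$ as above. Let $\bar u\in\mathbb{U}_{ad}$ be a local solution of the continuous control problem, let $\mathscr{T}\in\mathbb{T}$, and let $\bar u_{\mathscr{T}}$ be a local minimum of the discrete control problem with associated state $\bar y_{\mathscr{T}}$ and adjoint state $\bar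 p_{\mathscr{T}}$. Then $$\|\nabla(\hat p-\bar p_{\mathscr{T}})\|_{L^2(\Omega)}\le C\,\mathcal{E}_{ad}.$$ In particular, $C$ is independent of the solution of the continuous problem, of its finite element approximation, of the sizes of the simplices of $\mathscr{T}$ and of $\#\mathscr{T}$. -/

import Mathlib

open MeasureTheory Filter Topology

noncomputable section

namespace SemilinearOCP

/-- The Euclidean space `ℝᵈ`. -/
abbrev E (d : ℕ) := EuclideanSpace ℝ (Fin d)

/-- Bounded domain with Lipschitz boundary: `Ω` is open, connected and bounded and, near each of its
boundary points, it is the strict epigraph of a Lipschitz function over the hyperplane orthogonal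
to some unit vector `e`. (That `Ω` is polytopal is expressed by the existence of a `Mesh` of it.) -/
structure IsLipschitzDomain {d : ℕ} (Ω : Set (E d)) : Prop where
  isOpen : IsOpen Ω
  isConnected : IsConnected Ω
  isBounded : Bornology.IsBounded Ω
  lipschitz_boundary : ∀ x₀ ∈ frontier Ω, ∃ (e : E d) (K : NNReal) (φ : (ℝ ∙ e)ᗮ → ℝ) (r : ℝ),
    ‖e‖ = 1 ∧ LipschitzWith K φ ∧ 0 < r ∧
      ∀ x ∈ Metric.ball x₀ r, x ∈ Ω ↔ φ ((ℝ ∙ e)ᗮ.orthogonalProjectionOnto x) < inner ℝ e x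

/-- The norm of `L²(A)` (scalar or vector valued functions). -/
def l2norm {d : ℕ} {F : Type*} [NormedAddCommGroup F] (A : Set (E d)) (f : E d → F) : ℝ :=
  (eLpNorm f 2 (volume.restrict A)).toReal

/-- An element of `H₀¹(Ω)`, the closure of `C_c^∞(Ω)` in `H¹(Ω)`, with (a representative of) its weak
gradient: for some `φₙ ∈ C_c^∞(Ω)` one has `φₙ → v` and `∇φₙ → ∇v` in `L²(Ω)`. -/
structure H01 {d : ℕ} (Ω : Set (E d)) where
  toFun : E d → ℝ
  grad : E d → E d
  memLp : MemLp toFun 2 (volume.restrict Ω)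
  grad_memLp : MemLp grad 2 (volume.restrict Ω)
  approx : ∃ φ : ℕ → E d → ℝ,
    (∀ n, ContDiff ℝ ((⊤ : ℕ∞) : WithTop ℕ∞) (φ n) ∧ HasCompactSupport (φ n) ∧
      tsupport (φ n) ⊆ Ω) ∧
    Tendsto (fun n => eLpNorm (fun x => φ n x - toFun x) 2 (volume.restrict Ω)) atTop (𝓝 0) ∧
    Tendsto (fun n => eLpNorm (fun x => gradient (φ n) x - grad x) 2 (volume.restrict Ω))
      atTop (𝓝 0)

/-- The assumptions on the nonlinearity `a : Ω × ℝ → ℝ`. -/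
structure IsAdmissibleNonlinearity {d : ℕ} (Ω : Set (E d)) (a : E d → ℝ → ℝ) : Prop where
  measurable : ∀ y : ℝ, AEStronglyMeasurable (fun x => a x y) (volume.restrict Ω)
  contDiff : ∀ᵐ x ∂(volume.restrict Ω), ContDiff ℝ 2 (a x)
  zero_memLp : MemLp (fun x => a x 0) 2 (volume.restrict Ω)
  deriv_nonneg : ∀ᵐ x ∂(volume.restrict Ω), ∀ y : ℝ, 0 ≤ deriv (a x) y
  deriv_bound : ∀ M > 0, ∃ C > 0, ∀ᵐ x ∂(volume.restrict Ω), ∀ y : ℝ, |y| ≤ M →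
    |deriv (a x) y| + |iteratedDeriv 2 (a x) y| ≤ C

/-- The set of admissible controls, `𝕌_ad`. -/
def controls {d : ℕ} (Ω : Set (E d)) (lo hi : ℝ) : Set (E d → ℝ) :=
  {u | MemLp u 2 (volume.restrict Ω) ∧ ∀ᵐ x ∂(volume.restrict Ω), lo ≤ u x ∧ u x ≤ hi}

/-- The cost functional `J(y,u)`. -/
def cost {d : ℕ} (Ω : Set (E d)) (ν : ℝ) (yΩ y u : E d → ℝ) : ℝ :=
  1 / 2 * l2norm Ω (fun x => y x - yΩ x) ^ 2 + ν / 2 * l2norm Ω u ^ 2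

/-- `y ∈ H₀¹(Ω) ∩ L^∞(Ω)` is the state with control `u`: it solves the weak semilinear equation. -/
def IsState {d : ℕ} (Ω : Set (E d)) (a : E d → ℝ → ℝ) (u : E d → ℝ) (y : H01 Ω) : Prop :=
  MemLp y.toFun ⊤ (volume.restrict Ω) ∧
  ∀ v : H01 Ω, (∫ x in Ω, inner ℝ (y.grad x) (v.grad x)) + (∫ x in Ω, a x (y.toFun x) * v.toFun x)
    = ∫ x in Ω, u x * v.toFun x

/-- `u`, with state `y`, is a local solution (in the sense of `L²(Ω)`) of the optimal control
problem. -/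
def IsLocalSolution {d : ℕ} (Ω : Set (E d)) (a : E d → ℝ → ℝ) (yΩ : E d → ℝ) (ν lo hi : ℝ)
    (u : E d → ℝ) (y : H01 Ω) : Prop :=
  u ∈ controls Ω lo hi ∧ IsState Ω a u y ∧
  ∃ ε > 0, ∀ u' ∈ controls Ω lo hi, ∀ y' : H01 Ω, IsState Ω a u' y' →
    l2norm Ω (fun x => u' x - u x) ≤ ε → cost Ω ν yΩ y.toFun u ≤ cost Ω ν yΩ y'.toFun u'

/-- The closed simplex with the given vertices. -/
def simplex {d : ℕ} (T : Finset (E d)) : Set (E d) := convexHull ℝ (T : Set (E d))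

/-- A conforming partition of `closure Ω` into finitely many `d`-simplices, which are given by
their sets of vertices. Conformity: any two closed simplices meet in the (possibly empty) face that
their common vertices span. -/
structure Mesh {d : ℕ} (Ω : Set (E d)) where
  cells : Finset (Finset (E d))
  card_eq : ∀ T ∈ cells, T.card = d + 1
  indep : ∀ T ∈ cells, AffineIndependent ℝ ((↑) : T → E d)
  conforming : ∀ T ∈ cells, ∀ T' ∈ cells,
    simplex T ∩ simplex T' = convexHull ℝ ((T : Set (E d)) ∩ (T' : Set (E d)))
  cover : ⋃ T ∈ cells, simplex T = closure Ω

/-- The size `h_T` of a simplex. -/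
def size {d : ℕ} (T : Finset (E d)) : ℝ := Metric.diam (simplex T)

/-- `𝒯` is a refinement of `𝒯₀`: each simplex of `𝒯` is contained in a simplex of `𝒯₀`. -/
def IsRefinement {d : ℕ} {Ω : Set (E d)} (𝒯₀ 𝒯 : Mesh Ω) : Prop :=
  ∀ T ∈ 𝒯.cells, ∃ T₀ ∈ 𝒯₀.cells, simplex T ⊆ simplex T₀

/-- Shape regularity with constant `σ`: each simplex `T` contains a ball whose diameter `2r`
satisfies `h_T ≤ σ (2r)`, i.e. the ratio of `h_T` to the diameter of the largest ball contained
in `T` is at most `σ`. -/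
def IsShapeRegular {d : ℕ} {Ω : Set (E d)} (σ : ℝ) (𝒯 : Mesh Ω) : Prop :=
  ∀ T ∈ 𝒯.cells, ∃ (c : E d) (r : ℝ), 0 < r ∧ Metric.closedBall c r ⊆ simplex T ∧
    size T ≤ σ * (2 * r)

/-- The collection `𝕋` of the conforming meshes that refine `𝒯₀` and are shape regular with the
common constant `σ`. -/
def meshFamily {d : ℕ} {Ω : Set (E d)} (𝒯₀ : Mesh Ω) (σ : ℝ) : Set (Mesh Ω) :=
  {𝒯 | IsRefinement 𝒯₀ 𝒯 ∧ IsShapeRegular σ 𝒯}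

/-- The finite element space `𝕍(𝒯)` of the continuous piecewise affine functions in `H₀¹(Ω)`. -/
def feSpace {d : ℕ} {Ω : Set (E d)} (𝒯 : Mesh Ω) : Set (H01 Ω) :=
  {v | ContinuousOn v.toFun (closure Ω) ∧
    ∀ T ∈ 𝒯.cells, ∃ ℓ : E d →ᵃ[ℝ] ℝ, Set.EqOn v.toFun ℓ (simplex T)}

/-- The set `𝕌_ad(𝒯)` of the admissible piecewise constant controls. -/
def discreteControls {d : ℕ} {Ω : Set (E d)} (𝒯 : Mesh Ω) (lo hi : ℝ) : Set (E d → ℝ) :=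
  {u | u ∈ controls Ω lo hi ∧
    ∀ T ∈ 𝒯.cells, ∃ c : ℝ, ∀ᵐ x ∂(volume.restrict (simplex T)), u x = c}

/-- `y ∈ 𝕍(𝒯)` solves the discrete state equation with control `u`. -/
def IsDiscreteState {d : ℕ} {Ω : Set (E d)} (𝒯 : Mesh Ω) (a : E d → ℝ → ℝ) (u : E d → ℝ)
    (y : H01 Ω) : Prop :=
  y ∈ feSpace 𝒯 ∧
  ∀ v ∈ feSpace 𝒯,
    (∫ x in Ω, inner ℝ (y.grad x) (v.grad x)) + (∫ x in Ω, a x (y.toFun x) * v.toFun x)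
      = ∫ x in Ω, u x * v.toFun x

/-- `u`, with discrete state `y`, is a local minimum of the discrete optimal control problem. -/
def IsDiscreteLocalMin {d : ℕ} {Ω : Set (E d)} (𝒯 : Mesh Ω) (a : E d → ℝ → ℝ) (yΩ : E d → ℝ)
    (ν lo hi : ℝ) (u : E d → ℝ) (y : H01 Ω) : Prop :=
  u ∈ discreteControls 𝒯 lo hi ∧ IsDiscreteState 𝒯 a u y ∧
  ∃ ε > 0, ∀ u' ∈ discreteControls 𝒯 lo hi, ∀ y' : H01 Ω, IsDiscreteState 𝒯 a u' y' →
    l2norm Ω (fun x => u' x - u x) ≤ ε → cost Ω ν yΩ y.toFun u ≤ cost Ω ν yΩ y'.toFun u'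

/-- The equation of the adjoint problem linearized at `y`, for `p` and the test function `w`. -/
def AdjointEq {d : ℕ} {Ω : Set (E d)} (a : E d → ℝ → ℝ) (yΩ : E d → ℝ) (y p w : H01 Ω) : Prop :=
  (∫ x in Ω, inner ℝ (w.grad x) (p.grad x))
      + (∫ x in Ω, deriv (a x) (y.toFun x) * p.toFun x * w.toFun x)
    = ∫ x in Ω, (y.toFun x - yΩ x) * w.toFun x

/-- `p ∈ 𝕍(𝒯)` is the discrete adjoint state associated with the discrete state `y`. -/
def IsDiscreteAdjoint {d : ℕ} {Ω : Set (E d)} (𝒯 : Mesh Ω) (a : E d → ℝ → ℝ) (yΩ : E d → ℝ)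
    (y p : H01 Ω) : Prop :=
  p ∈ feSpace 𝒯 ∧ ∀ w ∈ feSpace 𝒯, AdjointEq a yΩ y p w

/-- `p ∈ H₀¹(Ω)` solves the continuous adjoint equation linearized at `y`. -/
def IsAdjoint {d : ℕ} {Ω : Set (E d)} (a : E d → ℝ → ℝ) (yΩ : E d → ℝ) (y p : H01 Ω) : Prop :=
  ∀ w : H01 Ω, AdjointEq a yΩ y p w

/-- The barycentre of a finite set of points. -/
def barycentre {d : ℕ} (T : Finset (E d)) : E d := (T.card : ℝ)⁻¹ • ∑ v ∈ T, v

/-- The unit vector that is normal to the side `S` of the simplex `T` and points towards `T`: the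
normalized component, orthogonal to `S`, of the vector from the barycentre of `S` to that of `T`. -/
def unitNormal {d : ℕ} (S T : Finset (E d)) : E d :=
  let n : E d := (vectorSpan ℝ (S : Set (E d)))ᗮ.starProjection (barycentre T - barycentre S)
  ‖n‖⁻¹ • n

/-- The constant value of `∇v` on a simplex `T` on which `v` is affine. -/
def gradOn {d : ℕ} (v : E d → ℝ) (T : Finset (E d)) : E d := gradient v (barycentre T)

open Classical in
/-- The jump of `∇v · ν` (a constant) across the common side `S = T ∩ T'` of `T` and `T'`. -/
def jump {d : ℕ} (v : E d → ℝ) (T T' : Finset (E d)) : ℝ :=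
  inner ℝ (unitNormal (T ∩ T') T) (gradOn v T) + inner ℝ (unitNormal (T ∩ T') T') (gradOn v T')

open Classical in
/-- The simplices of the mesh that share a side, i.e. `d` vertices, with `T`. The internal sides
of `T` are its intersections with them, and they make up `∂T ∖ ∂Ω`. -/
def sideNeighbours {d : ℕ} {Ω : Set (E d)} (𝒯 : Mesh Ω) (T : Finset (E d)) :
    Finset (Finset (E d)) :=
  {T' ∈ 𝒯.cells | (T ∩ T').card = d}

open Classical in
/-- The square of the norm in `L²(∂T ∖ ∂Ω)` of the jump of `∇v · ν`; the surface measure is the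
`(d-1)`-dimensional Hausdorff measure, normalized as in Euclidean geometry. -/
def jumpNormSq {d : ℕ} {Ω : Set (E d)} (𝒯 : Mesh Ω) (v : E d → ℝ) (T : Finset (E d)) : ℝ :=
  ∑ T' ∈ sideNeighbours 𝒯 T, ∫ _x in simplex (T ∩ T'), jump v T T' ^ 2 ∂(μHE[d - 1])

/-- The square of the local error indicator `ℰ_{ad,T}`. -/
def indicatorSq {d : ℕ} {Ω : Set (E d)} (𝒯 : Mesh Ω) (a : E d → ℝ → ℝ) (yΩ : E d → ℝ)
    (y p : H01 Ω) (T : Finset (E d)) : ℝ :=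
  size T ^ 2 *
      l2norm (simplex T)
        (fun x => y.toFun x - yΩ x - deriv (a x) (y.toFun x) * p.toFun x) ^ 2
    + size T * jumpNormSq 𝒯 p.toFun T

/-- The error estimator `ℰ_ad`. -/
def estimator {d : ℕ} {Ω : Set (E d)} (𝒯 : Mesh Ω) (a : E d → ℝ → ℝ) (yΩ : E d → ℝ)
    (y p : H01 Ω) : ℝ :=
  Real.sqrt (∑ T ∈ 𝒯.cells, indicatorSq 𝒯 a yΩ y p T)

end SemilinearOCP

end

open SemilinearOCP

/-! Put e = p̂ − p_𝒯, b = ∂a/∂y(·, ȳ_𝒯) and g = ȳ_𝒯 − y_Ω − b p_𝒯. Testing the continuous adjoint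
equation with e gives ‖∇e‖² + ∫ b e² = ∫ g e − ∫ ∇e·∇p_𝒯, and b ≥ 0 lets the second term on the left
be dropped. The right-hand side is the residual of the Poisson problem −Δq = g at its Galerkin
solution q = p_𝒯, so the nonlinearity and the controls cannot enter the constant. It remains to
bound this residual by C ℰ_ad ‖∇e‖, which is `IsLipschitzDomain.exists_residual_bound`.

By density e may be replaced by a test function φ, and by Galerkin orthogonality φ by φ − Iφ with a
quasi-interpolant Iφ in 𝕍(𝒯). Integration by parts on each cell leaves ∫ g (φ − Iφ) and, on the
interior sides, the jumps of ∇q·ν against φ − Iφ. Two ingredients then suffice.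

(1) Quasi-interpolation (`IsLipschitzDomain.exists_quasi_interpolant`). The nodal value at z is an
average over a set near z whose size is that of the cells around z. At a boundary vertex this set
lies in an exterior cone, away from the cells around z, and the function averaged is φ cut off to
these cells. So the nodal value is exactly zero, and the Poincaré inequality on a ball still
controls its distance to φ. Shape regularity bounds the number of cells around a vertex
(`Mesh.card_star_le`). Since these cells are linked through edges, their sizes are comparable
(`Mesh.size_le_of_star`); the Lipschitz boundary excludes parts that touch only at the vertex. That
the nodal values define an element of H₀¹ is seen by approximating the hat functions by truncation
and mollification (`approximable_of_nonneg`).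

(2) Side terms without traces. The integral of w over the face opposite to z, times the distance of
z to that face, is the volume integral `vertexFlux` of div((x − z) w), because (x − z)·n vanishes on
the other faces. The divergence theorem becomes an algebraic identity (`IsCell.integral_fderiv_eq`),
and the trace inequality becomes Cauchy–Schwarz (`IsCell.abs_vertexFlux_le`). Two facts must be
proved: the flux sees only the values on the face (`IsCell.vertexFlux_eq_zero`), and the two cells
at a side measure the same flux (`IsCell.vertexFlux_mul_eq`). With them the cell contributions pair
up into jumps (`Mesh.sum_flux_eq`). -/

noncomputable section

namespace SemilinearOCP

/-! ### Barycentric coordinates of a simplex -/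

section

variable {d : ℕ}

/-- A nondegenerate `d`-simplex, given by its vertices. -/
structure IsCell (T : Finset (E d)) : Prop where
  card_eq : T.card = d + 1
  indep : AffineIndependent ℝ ((↑) : T → E d)

lemma Mesh.isCell {Ω : Set (E d)} (𝒯 : Mesh Ω) {T : Finset (E d)} (hT : T ∈ 𝒯.cells) : IsCell T :=
  ⟨𝒯.card_eq T hT, 𝒯.indep T hT⟩

/-- The vertices of a cell as an affine basis. -/
def IsCell.basis {T : Finset (E d)} (hT : IsCell T) : AffineBasis T ℝ (E d) where
  toFun := (↑)
  ind' := hT.indep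
  tot' := by
    rw [hT.indep.affineSpan_eq_top_iff_card_eq_finrank_add_one]
    simp [hT.card_eq]

open Classical in
/-- The barycentric coordinate of the cell `T` associated with the vertex `z`. -/
def lam (T : Finset (E d)) (z : E d) : E d →ᵃ[ℝ] ℝ :=
  if h : IsCell T ∧ z ∈ T then h.1.basis.coord ⟨z, h.2⟩ else 0

variable {T : Finset (E d)} {z v : E d}

lemma IsCell.lam_eq (hT : IsCell T) (hz : z ∈ T) : lam T z = hT.basis.coord ⟨z, hz⟩ := by
  rw [lam, dif_pos ⟨hT, hz⟩]

lemma IsCell.lam_self (hT : IsCell T) (hz : z ∈ T) : lam T z z = 1 := by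
  rw [hT.lam_eq hz]
  exact hT.basis.coord_apply_eq ⟨z, hz⟩

lemma IsCell.lam_ne (hT : IsCell T) (hz : z ∈ T) (hv : v ∈ T) (h : v ≠ z) : lam T z v = 0 := by
  rw [hT.lam_eq hz]
  exact hT.basis.coord_apply_ne (i := ⟨z, hz⟩) (j := ⟨v, hv⟩) (by simpa using h.symm)

lemma IsCell.sum_lam (hT : IsCell T) (x : E d) : ∑ z ∈ T, lam T z x = 1 := by
  rw [← hT.basis.sum_coord_apply_eq_one x, ← Finset.sum_coe_sort]
  exact Finset.sum_congr rfl fun i _ => by rw [hT.lam_eq i.2]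

lemma IsCell.sum_lam_smul (hT : IsCell T) (x : E d) : ∑ z ∈ T, lam T z x • z = x := by
  conv_rhs => rw [← hT.basis.linear_combination_coord_eq_self x]
  rw [← Finset.sum_coe_sort]
  exact Finset.sum_congr rfl fun i _ => by rw [hT.lam_eq i.2]; rfl

lemma IsCell.range_basis (hT : IsCell T) : Set.range hT.basis = (T : Set (E d)) := by
  ext x; constructor
  · rintro ⟨i, rfl⟩; exact i.2
  · intro hx; exact ⟨⟨x, hx⟩, rfl⟩

lemma IsCell.mem_simplex (hT : IsCell T) {x : E d} : x ∈ simplex T ↔ ∀ z ∈ T, 0 ≤ lam T z x := by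
  have := hT.basis.convexHull_eq_nonneg_coord
  rw [simplex, ← hT.range_basis, this]
  constructor
  · intro h z hz; rw [hT.lam_eq hz]; exact h _
  · intro h i; have := h i i.2; rwa [hT.lam_eq i.2] at this

lemma IsCell.mem_interior (hT : IsCell T) {x : E d} :
    x ∈ interior (simplex T) ↔ ∀ z ∈ T, 0 < lam T z x := by
  have := hT.basis.interior_convexHull
  rw [simplex, ← hT.range_basis, this]
  constructor
  · intro h z hz; rw [hT.lam_eq hz]; exact h _
  · intro h i; have := h i i.2; rwa [hT.lam_eq i.2] at this

lemma mem_simplex_of_mem (hz : z ∈ T) : z ∈ simplex T :=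
  subset_convexHull ℝ (T : Set (E d)) hz

lemma convex_simplex : Convex ℝ (simplex T) := convex_convexHull ℝ _

lemma isCompact_simplex : IsCompact (simplex T) :=
  T.finite_toSet.isCompact_convexHull ℝ

lemma isClosed_simplex : IsClosed (simplex T) := isCompact_simplex.isClosed

lemma measurableSet_simplex : MeasurableSet (simplex T) := isClosed_simplex.measurableSet

/-- The gradient of an affine function. -/
def agrad (l : E d →ᵃ[ℝ] ℝ) : E d :=
  (InnerProductSpace.toDual ℝ (E d)).symm (LinearMap.toContinuousLinearMap l.linear)

lemma inner_agrad (l : E d →ᵃ[ℝ] ℝ) (v : E d) : inner ℝ (agrad l) v = l.linear v := by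
  simp [agrad]

lemma affine_eq (l : E d →ᵃ[ℝ] ℝ) (x y : E d) : l x = l y + inner ℝ (agrad l) (x - y) := by
  rw [inner_agrad]
  have := l.linearMap_vsub x y
  simp only [vsub_eq_sub] at this
  rw [this]; ring

lemma hasGradientAt_affine (l : E d →ᵃ[ℝ] ℝ) (x : E d) : HasGradientAt l (agrad l) x := by
  rw [hasGradientAt_iff_hasFDerivAt]
  have h : ⇑l = fun y => inner ℝ (agrad l) y + l 0 := by
    ext y; rw [affine_eq l y 0, sub_zero]; ring
  rw [h]
  exact ((InnerProductSpace.toDual ℝ (E d) (agrad l)).hasFDerivAt).add_const _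

lemma contDiff_affine (l : E d →ᵃ[ℝ] ℝ) {n : WithTop ℕ∞} : ContDiff ℝ n l := by
  have h : ⇑l = fun y => inner ℝ (agrad l) y + l 0 := by
    ext y; rw [affine_eq l y 0, sub_zero]; ring
  rw [h]; exact ((InnerProductSpace.toDual ℝ (E d) (agrad l)).contDiff).add contDiff_const

lemma continuous_affine (l : E d →ᵃ[ℝ] ℝ) : Continuous l := (contDiff_affine (n := 0) l).continuous

lemma agrad_eq_of_forall {l : E d →ᵃ[ℝ] ℝ} {g : E d} (h : ∀ x y, l x - l y = inner ℝ g (x - y)) :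
    agrad l = g := by
  apply ext_inner_right ℝ
  intro v
  have := h v 0
  rw [affine_eq l v 0] at this
  simpa using this

lemma IsCell.sum_agrad (hT : IsCell T) : ∑ z ∈ T, agrad (lam T z) = 0 := by
  apply ext_inner_right ℝ
  intro v
  rw [sum_inner, inner_zero_left]
  have h1 := hT.sum_lam v
  have h0 := hT.sum_lam 0
  have : ∀ z ∈ T, inner ℝ (agrad (lam T z)) v = lam T z v - lam T z 0 := fun z _ => by
    rw [affine_eq (lam T z) v 0]; simp
  rw [Finset.sum_congr rfl this, Finset.sum_sub_distrib, h1, h0, sub_self]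

lemma IsCell.sum_inner_agrad_smul (hT : IsCell T) (v : E d) :
    ∑ z ∈ T, inner ℝ (agrad (lam T z)) v • z = v := by
  have h1 := hT.sum_lam_smul v
  have h0 := hT.sum_lam_smul 0
  have : ∀ z ∈ T, inner ℝ (agrad (lam T z)) v • z = lam T z v • z - lam T z 0 • z := fun z _ => by
    rw [affine_eq (lam T z) v 0, ← sub_smul]; simp
  rw [Finset.sum_congr rfl this, Finset.sum_sub_distrib, h1, h0, sub_zero]

/-- An affine function is determined by its values at the vertices. -/
lemma IsCell.affine_eq_sum (hT : IsCell T) (l : E d →ᵃ[ℝ] ℝ) (x : E d) :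
    l x = ∑ z ∈ T, lam T z x * l z := by
  have h1 := hT.sum_lam_smul x
  have h2 := hT.sum_lam x
  have : ∀ z ∈ T, lam T z x * l z
      = lam T z x * l 0 + inner ℝ (agrad l) (lam T z x • z) := fun z _ => by
    rw [affine_eq l z 0, inner_smul_right, sub_zero]; ring
  rw [Finset.sum_congr rfl this, Finset.sum_add_distrib, ← Finset.sum_mul, h2, ← inner_sum, h1,
    affine_eq l x 0]
  simp

lemma IsCell.affine_ext (hT : IsCell T) {l m : E d →ᵃ[ℝ] ℝ} (h : ∀ z ∈ T, l z = m z) : l = m := by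
  ext x
  rw [hT.affine_eq_sum l, hT.affine_eq_sum m]
  exact Finset.sum_congr rfl fun z hz => by rw [h z hz]

/-- Faces of a cell in barycentric coordinates. -/
lemma IsCell.mem_convexHull_face (hT : IsCell T) {F : Set (E d)} (hF : F ⊆ T) {x : E d} :
    x ∈ convexHull ℝ F ↔ x ∈ simplex T ∧ ∀ z ∈ T, z ∉ F → lam T z x = 0 := by
  classical
  constructor
  · intro hx
    refine ⟨convexHull_mono hF hx, fun z hz hzF => ?_⟩
    have : convexHull ℝ F ⊆ {x | lam T z x = 0} := by
      apply convexHull_min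
      · intro v hv
        exact hT.lam_ne hz (hF hv) (by rintro rfl; exact hzF hv)
      · intro a ha b hb s t hs ht hst
        have : lam T z (s • a + t • b) = s • lam T z a + t • lam T z b :=
          Convex.combo_affine_apply hst
        simp only [Set.mem_ofPred_eq] at *
        rw [this, ha, hb]; simp
    exact this hx
  · rintro ⟨hx, h0⟩
    rw [hT.mem_simplex] at hx
    have hs : ∑ z ∈ T with z ∈ F, lam T z x = 1 := by
      rw [Finset.sum_filter, ← hT.sum_lam x]
      exact Finset.sum_congr rfl fun z hz => by split_ifs with h; · rfl
                                                · exact (h0 z hz h).symm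
    have hs' : ∑ z ∈ T with z ∈ F, lam T z x • z = x := by
      rw [Finset.sum_filter]
      conv_rhs => rw [← hT.sum_lam_smul x]
      exact Finset.sum_congr rfl fun z hz => by split_ifs with h; · rfl
                                                · simp [h0 z hz h]
    rw [← hs']
    apply (convex_convexHull ℝ F).sum_mem
    · intro i hi; exact hx i (Finset.mem_filter.1 hi).1
    · exact hs
    · intro i hi; exact subset_convexHull ℝ F (Finset.mem_filter.1 hi).2

lemma IsCell.lam_le_one (hT : IsCell T) (hz : z ∈ T) {x : E d} (hx : x ∈ simplex T) :
    lam T z x ≤ 1 := by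
  rw [hT.mem_simplex] at hx
  rw [← hT.sum_lam x]
  exact Finset.single_le_sum (f := fun z => lam T z x) (fun i hi => hx i hi) hz

lemma lam_lineMap (T : Finset (E d)) (w z x : E d) (s : ℝ) :
    lam T w (z + s • (x - z)) = lam T w z + s * (lam T w x - lam T w z) := by
  rw [affine_eq (lam T w) (z + s • (x - z)) z, affine_eq (lam T w) x z]
  simp [inner_smul_right]

/-- The action of a dilation at a vertex on the other barycentric coordinates. -/
lemma IsCell.lam_dilate (hT : IsCell T) (hz : z ∈ T) {w : E d} (hw : w ∈ T) (hwz : w ≠ z)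
    (x : E d) (s : ℝ) : lam T w (z + s • (x - z)) = s * lam T w x := by
  rw [lam_lineMap, hT.lam_ne hw hz hwz.symm]; ring

lemma IsCell.lam_dilate_self (hT : IsCell T) (hz : z ∈ T) (x : E d) (s : ℝ) :
    lam T z (z + s • (x - z)) = 1 + s * (lam T z x - 1) := by
  rw [lam_lineMap, hT.lam_self hz]

lemma IsCell.barycentre_lam (hT : IsCell T) (hz : z ∈ T) :
    lam T z (barycentre T) = (T.card : ℝ)⁻¹ := by
  have hc : (T.card : ℝ) ≠ 0 := by rw [hT.card_eq]; positivity
  have h2 : ∀ v ∈ T, lam T z v = if v = z then 1 else 0 := fun v hv => by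
    split_ifs with h
    · rw [h, hT.lam_self hz]
    · exact hT.lam_ne hz hv h
  have h3 : lam T z (barycentre T) - lam T z 0 = (T.card : ℝ)⁻¹ * ∑ v ∈ T,
      (lam T z v - lam T z 0) := by
    rw [affine_eq (lam T z) (barycentre T) 0, barycentre, sub_zero, inner_smul_right, inner_sum,
      add_sub_cancel_left]
    congr 1
    exact Finset.sum_congr rfl fun v _ => by rw [affine_eq (lam T z) v 0]; simp
  rw [Finset.sum_sub_distrib, Finset.sum_congr rfl h2] at h3
  simp only [Finset.sum_ite_eq', hz, if_true, Finset.sum_const, nsmul_eq_mul] at h3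
  field_simp at h3
  field_simp
  linarith

lemma IsCell.barycentre_mem (hT : IsCell T) : barycentre T ∈ interior (simplex T) := by
  rw [hT.mem_interior]
  intro z hz
  rw [hT.barycentre_lam hz, hT.card_eq]; positivity

lemma IsCell.closure_interior (hT : IsCell T) : closure (interior (simplex T)) = simplex T := by
  rw [convex_simplex.closure_interior_eq_closure_of_nonempty_interior ⟨_, hT.barycentre_mem⟩,
    isClosed_simplex.closure_eq]

lemma ae_restrict_interior_simplex :
    volume.restrict (interior (simplex T)) = volume.restrict (simplex T) := by
  apply Measure.restrict_congr_set
  exact interior_ae_eq_of_null_frontier (convex_simplex.addHaar_frontier volume)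

/-! ### Sizes of cells and shape regularity. -/

lemma isBounded_simplex : Bornology.IsBounded (simplex T) := isCompact_simplex.isBounded

lemma dist_le_size {x y : E d} (hx : x ∈ simplex T) (hy : y ∈ simplex T) : dist x y ≤ size T :=
  Metric.dist_le_diam_of_mem isBounded_simplex hx hy

lemma norm_sub_le_size {x y : E d} (hx : x ∈ simplex T) (hy : y ∈ simplex T) :
    ‖x - y‖ ≤ size T := by
  rw [← dist_eq_norm]; exact dist_le_size hx hy

lemma size_nonneg : 0 ≤ size T := Metric.diam_nonneg

/-- `T` contains a ball of diameter at least `size T / σ`. -/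
def CellRegular (σ : ℝ) (T : Finset (E d)) : Prop :=
  ∃ (c : E d) (r : ℝ), 0 < r ∧ Metric.closedBall c r ⊆ simplex T ∧ size T ≤ σ * (2 * r)

/-- The coordinate stays between 0 and 1 on the cell, yet it grows by `‖agrad (lam T z)‖ * (2 * r)`
along the diameter of the ball that is parallel to its gradient. -/
lemma IsCell.agrad_le_of_ball (hT : IsCell T) (hz : z ∈ T) {c : E d} {r : ℝ} (hr : 0 < r)
    (hc : Metric.closedBall c r ⊆ simplex T) : ‖agrad (lam T z)‖ * (2 * r) ≤ 1 := by
  by_cases h0 : agrad (lam T z) = 0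
  · simp [h0]
  set g := agrad (lam T z)
  have hg : 0 < ‖g‖ := norm_pos_iff.2 h0
  set u : E d := (r / ‖g‖) • g
  have hu : ‖u‖ = r := by
    rw [norm_smul, Real.norm_eq_abs, abs_of_pos (by positivity)]; field_simp
  have h1 : c + u ∈ simplex T := hc (by simp [hu])
  have h2 : c - u ∈ simplex T := hc (by simp [hu])
  have h3 := hT.lam_le_one hz h1
  have h4 := hT.mem_simplex.1 h2 z hz
  have h5 := affine_eq (lam T z) (c + u) (c - u)
  have h6 : inner ℝ g ((c + u) - (c - u)) = ‖g‖ * (2 * r) := by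
    have : (c + u) - (c - u) = (2 * (r / ‖g‖)) • g := by
      simp only [u]; module
    rw [this, inner_smul_right, real_inner_self_eq_norm_sq]; field_simp
  rw [show agrad (lam T z) = g from rfl, h6] at h5
  linarith

lemma IsCell.size_pos (hd : 1 ≤ d) (hT : IsCell T) : 0 < size T := by
  have : 1 < T.card := by rw [hT.card_eq]; omega
  obtain ⟨a, ha, b, hb, hab⟩ := Finset.one_lt_card.1 this
  exact (dist_pos.2 hab).trans_le (dist_le_size (mem_simplex_of_mem ha) (mem_simplex_of_mem hb))

lemma IsCell.agrad_pos (hd : 1 ≤ d) (hT : IsCell T) (hz : z ∈ T) : 0 < ‖agrad (lam T z)‖ := by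
  rw [norm_pos_iff]
  intro h
  have : 1 < T.card := by rw [hT.card_eq]; omega
  obtain ⟨v, hv, hvz⟩ := Finset.exists_mem_ne this z
  have h1 := affine_eq (lam T z) z v
  rw [h, hT.lam_self hz, hT.lam_ne hz hv hvz] at h1
  simp at h1

/-- The inverse estimate for barycentric coordinates. It does the work of a scaling to a reference
simplex. -/
lemma IsCell.agrad_mul_size_le (hT : IsCell T) (hz : z ∈ T) {σ : ℝ} (hσ : 0 < σ)
    (hr : CellRegular σ T) : ‖agrad (lam T z)‖ * size T ≤ σ := by
  obtain ⟨c, r, hr, hc, hs⟩ := hr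
  calc ‖agrad (lam T z)‖ * size T ≤ ‖agrad (lam T z)‖ * (σ * (2 * r)) := by gcongr
    _ = σ * (‖agrad (lam T z)‖ * (2 * r)) := by ring
    _ ≤ σ * 1 := by gcongr; exact hT.agrad_le_of_ball hz hr hc
    _ = σ := mul_one σ

/-- The edges of a shape regular cell have a length comparable to its size. -/
lemma IsCell.size_le_edge (hT : IsCell T) (hz : z ∈ T) (hv : v ∈ T) (hne : v ≠ z) {σ : ℝ}
    (hσ : 0 < σ)
    (hr : CellRegular σ T) : size T ≤ σ * ‖z - v‖ := by
  have h1 := affine_eq (lam T z) z v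
  rw [hT.lam_self hz, hT.lam_ne hz hv hne, zero_add] at h1
  -- The coordinate rises from 0 to 1 along the edge, so the edge cannot be shorter than the inverse
  -- of its gradient.
  have h2 : 1 ≤ ‖agrad (lam T z)‖ * ‖z - v‖ := h1 ▸ real_inner_le_norm _ _
  calc size T ≤ size T * (‖agrad (lam T z)‖ * ‖z - v‖) := le_mul_of_one_le_right size_nonneg h2
    _ = (‖agrad (lam T z)‖ * size T) * ‖z - v‖ := by ring
    _ ≤ σ * ‖z - v‖ := by gcongr; exact hT.agrad_mul_size_le hz hσ hr

end

/-! ### Vertex fluxes and the divergence theorem on a simplex -/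

section

variable {d : ℕ} {T T' : Finset (E d)} {z z' : E d} {w w' : E d → ℝ}

lemma integrableOn_simplex_of_continuous {F : Type*} [NormedAddCommGroup F] {f : E d → F}
    (hf : Continuous f) : IntegrableOn f (simplex T) :=
  hf.continuousOn.integrableOn_compact isCompact_simplex

/-- Affine change of variables. -/
lemma setIntegral_image_affine (A : E d →ᵃ[ℝ] E d) (hA : Function.Injective A) {S : Set (E d)}
    (hS : MeasurableSet S) (g : E d → ℝ) :
    ∫ x in A '' S, g x = |LinearMap.det A.linear| * ∫ x in S, g (A x) := by
  have h := integral_image_eq_integral_abs_det_fderiv_smul volume hS (f := A)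
    (f' := fun _ => LinearMap.toContinuousLinearMap A.linear) (fun x _ => ?_) hA.injOn g
  · rw [h, ← integral_const_mul]
    simp [ContinuousLinearMap.det]
  · have : ⇑A = fun y => A.linear y + A 0 := by
      ext1 y
      have := A.linearMap_vsub y 0
      simp only [vsub_eq_sub, sub_zero] at this
      rw [this]; abel
    rw [this]
    exact ((LinearMap.toContinuousLinearMap A.linear).hasFDerivAt.add_const _).hasFDerivWithinAt

/-- The integral over `T` of the divergence of `(x - z) w`, i.e. the integral of `w` over the face
opposite to `z`, multiplied by the distance of `z` to this face. -/
def vertexFlux (T : Finset (E d)) (z : E d) (w : E d → ℝ) : ℝ :=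
  ∫ x in simplex T, (d * w x + fderiv ℝ w x (x - z))

lemma continuous_vertexFlux_integrand (hw : ContDiff ℝ 1 w) :
    Continuous fun x => d * w x + fderiv ℝ w x (x - z) := by
  have := hw.continuous
  have := hw.continuous_fderiv one_ne_zero
  fun_prop

lemma vertexFlux_sub (hw : ContDiff ℝ 1 w) (hw' : ContDiff ℝ 1 w') :
    vertexFlux T z (fun x => w x - w' x) = vertexFlux T z w - vertexFlux T z w' := by
  rw [vertexFlux, vertexFlux, vertexFlux, ← integral_sub]
  · congr 1; ext x
    rw [fderiv_fun_sub (hw.differentiable one_ne_zero x) (hw'.differentiable one_ne_zero x)]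
    simp only [sub_apply]; ring
  · exact integrableOn_simplex_of_continuous (continuous_vertexFlux_integrand hw)
  · exact integrableOn_simplex_of_continuous (continuous_vertexFlux_integrand hw')

/-- The divergence theorem on a simplex, for a constant vector field times a function. -/
lemma IsCell.integral_fderiv_eq (hT : IsCell T) (hw : ContDiff ℝ 1 w) (g : E d) :
    ∫ x in simplex T, fderiv ℝ w x g
      = -∑ z ∈ T, inner ℝ g (agrad (lam T z)) * vertexFlux T z w := by
  simp only [vertexFlux, ← integral_const_mul]
  rw [← integral_finsetSum, ← integral_neg]
  · congr 1; ext x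
    -- The identity holds pointwise under the integral: the weights g·∇λ_z sum to zero, which
    -- removes everything independent of z, and they reproduce g as ∑ (g·∇λ_z) z.
    have h1 : ∑ z ∈ T, inner ℝ g (agrad (lam T z)) = 0 := by
      rw [← inner_sum, hT.sum_agrad, inner_zero_right]
    have h2 := hT.sum_inner_agrad_smul g
    have h3 : ∀ z ∈ T, inner ℝ g (agrad (lam T z)) * (d * w x + fderiv ℝ w x (x - z))
        = inner ℝ g (agrad (lam T z)) * (d * w x + fderiv ℝ w x x)
          - fderiv ℝ w x (inner ℝ (agrad (lam T z)) g • z) := fun z _ => by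
      rw [map_sub, map_smul, real_inner_comm, smul_eq_mul]; ring
    rw [Finset.sum_congr rfl h3, Finset.sum_sub_distrib, ← Finset.sum_mul, h1, ← map_sum, h2]
    ring
  · intro z _
    exact (integrableOn_simplex_of_continuous (continuous_vertexFlux_integrand hw)).const_mul _

lemma homothety_eq (z : E d) (s : ℝ) (x : E d) : AffineMap.homothety z s x = z + s • (x - z) := by
  rw [AffineMap.homothety_apply]; simp [add_comm]

lemma setIntegral_homothety (z : E d) {s : ℝ} (hs : 0 < s) (w : E d → ℝ) :
    ∫ x in AffineMap.homothety z s '' simplex T, w x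
      = s ^ d * ∫ x in simplex T, w (z + s • (x - z)) := by
  rw [setIntegral_image_affine]
  · have : LinearMap.det (AffineMap.homothety z s : E d →ᵃ[ℝ] E d).linear = s ^ d := by
      rw [AffineMap.homothety_linear]
      simp
    rw [this, abs_of_pos (by positivity)]
    simp only [homothety_eq]
  · intro x y h
    rw [homothety_eq, homothety_eq] at h
    simpa [hs.ne'] using h
  · exact measurableSet_simplex

lemma volume_real_homothety (z : E d) {s : ℝ} (hs : 0 < s) (S : Set (E d)) :
    volume.real (AffineMap.homothety z s '' S) = s ^ d * volume.real S := by
  rw [Measure.real, Measure.addHaar_image_homothety, ENNReal.toReal_mul, Measure.real]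
  simp [abs_of_pos hs, pow_nonneg hs.le]

lemma IsCell.mem_homothety (hT : IsCell T) (hz : z ∈ T) {s : ℝ} (hs : 0 < s) {x : E d}
    (hx : x ∈ simplex T) :
    x ∈ AffineMap.homothety z s '' simplex T ↔ 1 - lam T z x ≤ s := by
  constructor
  · rintro ⟨y, hy, rfl⟩
    rw [homothety_eq, hT.lam_dilate_self hz]
    have := hT.mem_simplex.1 hy z hz
    nlinarith
  · intro h
    refine ⟨z + s⁻¹ • (x - z), ?_, ?_⟩
    · rw [hT.mem_simplex]
      intro v hv
      by_cases hvz : v = z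
      · subst hvz
        rw [hT.lam_dilate_self hz]
        have : s⁻¹ * (1 - lam T v x) ≤ s⁻¹ * s := by gcongr
        rw [inv_mul_cancel₀ hs.ne'] at this
        linarith
      · rw [hT.lam_dilate hz hv hvz]
        have := hT.mem_simplex.1 hx v hv
        positivity
    · rw [homothety_eq]
      simp [smul_smul, hs.ne']

lemma IsCell.homothety_subset (hz : z ∈ T) {s : ℝ} (hs : 0 ≤ s) (hs1 : s ≤ 1) :
    AffineMap.homothety z s '' simplex T ⊆ simplex T := by
  rintro _ ⟨y, hy, rfl⟩
  rw [homothety_eq]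
  have := convex_simplex (mem_simplex_of_mem hz) hy (sub_nonneg.2 hs1) hs (by ring)
  convert this using 1
  module

/-- The function of s is the integral of w over the copy of the cell dilated from z. Its derivative
at 1 only feels a thin layer at the opposite face, which is why `vertexFlux` is a face functional.
-/
lemma hasDerivAt_dilated_integral (hw : ContDiff ℝ 1 w) (z : E d) :
    HasDerivAt (fun s : ℝ => s ^ d * ∫ x in simplex T, w (z + s • (x - z)))
      (vertexFlux T z w) 1 := by
  have hc := hw.continuous
  have hc' := hw.continuous_fderiv one_ne_zero
  have hK : IsCompact (Set.Icc (0 : ℝ) 2 ×ˢ simplex T) := isCompact_Icc.prod isCompact_simplex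
  obtain ⟨K, hK⟩ := hK.exists_bound_of_continuousOn
    (f := fun p : ℝ × E d => fderiv ℝ w (z + p.1 • (p.2 - z)) (p.2 - z)) (by fun_prop)
  have hd : HasDerivAt (fun s : ℝ => ∫ x in simplex T, w (z + s • (x - z)))
      (∫ x in simplex T, fderiv ℝ w (z + (1 : ℝ) • (x - z)) (x - z)) 1 := by
    refine (hasDerivAt_integral_of_dominated_loc_of_deriv_le (s := Set.Icc 0 2)
        (bound := fun _ => K)
      (F' := fun s x => fderiv ℝ w (z + s • (x - z)) (x - z))
      (Icc_mem_nhds (by norm_num) (by norm_num)) ?_ ?_ ?_ ?_ ?_ ?_).2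
    · exact .of_forall fun s =>
          (by fun_prop : Continuous fun x => w (z + s • (x - z))).aestronglyMeasurable
    · exact integrableOn_simplex_of_continuous (by fun_prop)
    · exact (by fun_prop : Continuous
        fun x => fderiv ℝ w (z + (1 : ℝ) • (x - z)) (x - z)).aestronglyMeasurable
    · filter_upwards [ae_restrict_mem measurableSet_simplex] with x hx s hs
      exact hK (s, x) ⟨hs, hx⟩
    · exact integrableOn_simplex_of_continuous continuous_const
    · refine .of_forall fun x s _ => ?_
      have h1 : HasDerivAt (fun s : ℝ => z + s • (x - z)) (x - z) s := by
        simpa using ((hasDerivAt_id s).smul_const (x - z)).const_add z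
      exact (hw.differentiable one_ne_zero _).hasFDerivAt.comp_hasDerivAt s h1
  refine ((hasDerivAt_pow d (1 : ℝ)).mul hd).congr_deriv ?_
  rw [vertexFlux, integral_add, integral_const_mul]
  · simp
  · exact (integrableOn_simplex_of_continuous hc).const_mul _
  · exact integrableOn_simplex_of_continuous (by fun_prop)

/-- The flux only depends on the values on the face opposite to the vertex. -/
lemma IsCell.vertexFlux_eq_zero (hT : IsCell T) (hz : z ∈ T) (hw : ContDiff ℝ 1 w)
    (h0 : ∀ x ∈ simplex T, lam T z x = 0 → w x = 0) : vertexFlux T z w = 0 := by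
  obtain ⟨L, hL⟩ := (isCompact_simplex (T := T)).exists_bound_of_continuousOn
    (hw.continuous_fderiv one_ne_zero).continuousOn
  have hL0 : 0 ≤ L := (norm_nonneg _).trans (hL z (mem_simplex_of_mem hz))
  have hder := hasDerivAt_dilated_integral (T := T) hw z
  set G := fun s : ℝ => s ^ d * ∫ x in simplex T, w (z + s • (x - z)) with hG
  -- The difference quotient is the integral of w over the layer between the cell and its dilated
  -- copy, divided by 1 − s. In this layer w is of order 1 − s, as it vanishes on the face, and the
  -- volume of the layer tends to 0.
  have hbound : ∀ s ∈ Set.Ioo (0 : ℝ) 1,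
      |slope G 1 s| ≤ L * size T * ((1 - s ^ d) * volume.real (simplex T)) := by
    rintro s ⟨hs0, hs1⟩
    set Ts := AffineMap.homothety z s '' simplex T with hTs
    have hsub : Ts ⊆ simplex T := IsCell.homothety_subset hz hs0.le hs1.le
    have hTsm : MeasurableSet Ts :=
      (isCompact_simplex.image (AffineMap.homothety_continuous z s)).measurableSet
    have h1 : G 1 - G s = ∫ x in simplex T \ Ts, w x := by
      have hi := integrableOn_simplex_of_continuous (T := T) hw.continuous
      have e1 : G s = ∫ x in Ts, w x := (setIntegral_homothety z hs0 w).symm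
      have e2 : G 1 = ∫ x in simplex T, w x := by simp [hG]
      rw [e1, e2, setIntegral_sdiff hTsm hi hsub]
    have hvol : volume.real (simplex T \ Ts) = (1 - s ^ d) * volume.real (simplex T) := by
      rw [measureReal_sdiff hsub hTsm (isCompact_simplex (T := T)).measure_ne_top,
        hTs, volume_real_homothety z hs0]
      ring
    have h2 : ∀ x ∈ simplex T \ Ts, ‖w x‖ ≤ L * ((1 - s) * size T) := by
      rintro x ⟨hx, hxs⟩
      rw [hTs, hT.mem_homothety hz hs0 hx, not_le] at hxs
      set τ := 1 - lam T z x with hτ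
      have hτ0 : 0 < τ := hs0.trans hxs
      have hτ1 : τ ≤ 1 := by have := hT.mem_simplex.1 hx z hz; linarith
      -- y is the projection of x from z onto the opposite face.
      obtain ⟨y, hy, hyx⟩ := (hT.mem_homothety hz hτ0 hx).2 le_rfl
      rw [homothety_eq] at hyx
      have hy0 : lam T z y = 0 := by
        have := hT.lam_dilate_self hz y τ
        rw [hyx] at this
        have h3 : τ * lam T z y = 0 := by linarith
        exact (mul_eq_zero.1 h3).resolve_left hτ0.ne'
      have h4 := convex_simplex.norm_image_sub_le_of_norm_fderiv_le (𝕜 := ℝ) (f := w)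
        (fun x _ => hw.differentiable one_ne_zero x) hL hy hx
      rw [h0 y hy hy0, sub_zero] at h4
      refine h4.trans ?_
      have h5 : x - y = (τ - 1) • (y - z) := by rw [← hyx]; module
      have h6 : ‖x - y‖ ≤ (1 - s) * size T := by
        rw [h5, norm_smul, Real.norm_eq_abs, abs_of_nonpos (by linarith)]
        exact mul_le_mul (by linarith) (norm_sub_le_size hy (mem_simplex_of_mem hz))
          (norm_nonneg _) (by linarith)
      gcongr
    have h3 : |G 1 - G s| ≤ L * ((1 - s) * size T) * ((1 - s ^ d) * volume.real (simplex T)) := by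
      rw [h1, ← hvol, ← Real.norm_eq_abs]
      exact norm_setIntegral_le_of_norm_le_const
        ((measure_mono Set.sdiff_subset).trans_lt isCompact_simplex.measure_lt_top) h2
    rw [slope_def_field, abs_div, abs_sub_comm, abs_sub_comm s 1, abs_of_pos (sub_pos.2 hs1),
      div_le_iff₀ (sub_pos.2 hs1)]
    linarith
  have ht : Tendsto (slope G 1) (𝓝[<] 1) (𝓝 (vertexFlux T z w)) :=
    (hasDerivAt_iff_tendsto_slope.1 hder).mono_left
      (nhdsWithin_mono _ fun x (hx : x < 1) => hx.ne)
  have ht0 : Tendsto (slope G 1) (𝓝[<] 1) (𝓝 0) := by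
    have h1 : Tendsto (fun s : ℝ => L * size T * ((1 - s ^ d) * volume.real (simplex T)))
        (𝓝[<] 1) (𝓝 0) := by
      have : Continuous fun s : ℝ => L * size T * ((1 - s ^ d) * volume.real (simplex T)) := by
        fun_prop
      have h2 := (this.tendsto 1).mono_left (nhdsWithin_le_nhds (s := Set.Iio 1))
      simpa using h2
    apply squeeze_zero_norm' _ h1
    filter_upwards [Ioo_mem_nhdsLT (show (0 : ℝ) < 1 by norm_num)] with s hs
    exact hbound s hs
  exact tendsto_nhds_unique ht ht0

/-- The barycentric coordinates of two cells with a common face, for the opposite vertices. -/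
lemma IsCell.lam_eq_mul (hT : IsCell T) (hT' : IsCell T') (hz : z ∈ T)
    (hz' : z' ∈ T') (hF : T.erase z = T'.erase z') (x : E d) :
    lam T z x = lam T z z' * lam T' z' x := by
  have : lam T z = (lam T z z') • lam T' z' := by
    apply hT'.affine_ext
    intro v hv
    by_cases hvz : v = z'
    · subst hvz; simp [hT'.lam_self hz']
    · have hv1 : v ∈ T.erase z := hF ▸ Finset.mem_erase.2 ⟨hvz, hv⟩
      rw [Finset.mem_erase] at hv1
      simp [hT'.lam_ne hz' hv hvz, hT.lam_ne hz hv1.2 hv1.1]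
  conv_lhs => rw [this]
  simp

lemma IsCell.lam_opposite_ne_zero (hT : IsCell T) (hT' : IsCell T') (hz : z ∈ T)
    (hz' : z' ∈ T') (hF : T.erase z = T'.erase z') : lam T z z' ≠ 0 := by
  intro h0
  have := hT.lam_eq_mul hT' hz hz' hF z
  rw [hT.lam_self hz, h0] at this
  simp at this

lemma IsCell.agrad_eq_smul (hT : IsCell T) (hT' : IsCell T') (hz : z ∈ T)
    (hz' : z' ∈ T') (hF : T.erase z = T'.erase z') :
    agrad (lam T z) = lam T z z' • agrad (lam T' z') := by
  apply agrad_eq_of_forall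
  intro x y
  rw [hT.lam_eq_mul hT' hz hz' hF x, hT.lam_eq_mul hT' hz hz' hF y, affine_eq (lam T' z') x y,
    inner_smul_left]
  simp; ring

/-- Fluxes of two cells with a common face. -/
lemma IsCell.vertexFlux_mul_eq (hT : IsCell T) (hT' : IsCell T') (hz : z ∈ T)
    (hz' : z' ∈ T') (hF : T.erase z = T'.erase z') (hw : ContDiff ℝ 1 w) (hw' : ContDiff ℝ 1 w')
    (h : ∀ x ∈ simplex T, lam T z x = 0 → w x = w' x) :
    ‖agrad (lam T z)‖ * vertexFlux T z w = ‖agrad (lam T' z')‖ * vertexFlux T' z' w' := by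
  -- The shear that fixes the common face pointwise and moves z to z'; it maps T onto T'.
  set A : E d →ᵃ[ℝ] E d := AffineMap.id ℝ (E d) +
    (LinearMap.toSpanSingleton ℝ (E d) (z' - z)).toAffineMap.comp (lam T z) with hA
  have hAx : ∀ x, A x = x + lam T z x • (z' - z) := fun x => by simp [hA]
  have hAz : A z = z' := by rw [hAx, hT.lam_self hz]; simp
  have hAF : ∀ v ∈ T.erase z, A v = v := fun v hv => by
    rw [Finset.mem_erase] at hv
    rw [hAx, hT.lam_ne hz hv.2 hv.1]; simp
  have hκ := hT.lam_opposite_ne_zero hT' hz hz' hF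
  set κ := lam T z z'
  -- The linear part is a transvection, with determinant 1 + ∇λ_z·(z' − z) = λ_z(z'). The same
  -- factor relates ∇λ_z to ∇λ'_{z'}, so the two cancel in the statement.
  have hdet : LinearMap.det A.linear = κ := by
    have : A.linear = LinearMap.transvection (lam T z).linear (z' - z) := by
      ext1 x
      simp [hA, LinearMap.transvection.apply]
    rw [this, LinearMap.transvection.det, ← inner_agrad]
    have := affine_eq (lam T z) z' z
    rw [hT.lam_self hz] at this
    exact this.symm
  have hinj : Function.Injective A := by
    intro x y hxy
    have hl : ∀ x, lam T z (A x) = κ * lam T z x := fun x => by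
      have h1 := affine_eq (lam T z) (A x) x
      have h2 := affine_eq (lam T z) z' z
      rw [hT.lam_self hz] at h2
      rw [h1, hAx, add_sub_cancel_left, inner_smul_right]
      change κ = _ at h2
      rw [h2]; ring
    have h3 : lam T z x = lam T z y := by
      have := hl x
      rw [hxy, hl y] at this
      exact (mul_left_cancel₀ hκ this).symm
    rw [hAx, hAx, h3] at hxy
    simpa using hxy
  have himg : A '' simplex T = simplex T' := by
    rw [simplex, AffineMap.image_convexHull, simplex]
    congr 1
    rw [← Finset.insert_erase hz, ← Finset.insert_erase hz', Finset.coe_insert, Finset.coe_insert,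
      Set.image_insert_eq, hAz, ← hF]
    congr 1
    rw [Set.image_congr (g := id) hAF, Set.image_id]
  have hAd : ∀ x, HasFDerivAt A (LinearMap.toContinuousLinearMap A.linear) x := fun x => by
    have : ⇑A = fun y => A.linear y + A 0 := by
      ext1 y
      have := A.linearMap_vsub y 0
      simp only [vsub_eq_sub, sub_zero] at this
      rw [this]; abel
    rw [this]
    exact (LinearMap.toContinuousLinearMap A.linear).hasFDerivAt.add_const _
  have hAc : ContDiff ℝ 1 A := by
    have : ⇑A = fun x => x + lam T z x • (z' - z) := funext hAx
    rw [this]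
    exact contDiff_id.add ((contDiff_affine _).smul contDiff_const)
  have hflux : vertexFlux T' z' w' = |κ| * vertexFlux T z (fun x => w' (A x)) := by
    rw [vertexFlux, ← himg, setIntegral_image_affine A hinj measurableSet_simplex, hdet, vertexFlux]
    congr 2; ext x
    have h1 : HasFDerivAt (fun x => w' (A x)) _ x :=
      (hw'.differentiable one_ne_zero (A x)).hasFDerivAt.comp x (hAd x)
    rw [h1.fderiv]
    have h2 : A.linear (x - z) = A x - z' := by
      rw [← hAz]; exact A.linearMap_vsub x z
    simp [← h2]
  -- w and w' ∘ A agree on the common face, where A is the identity, and the flux sees nothing else.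
  have hflux2 : vertexFlux T z w = vertexFlux T z (fun x => w' (A x)) := by
    rw [← sub_eq_zero, ← vertexFlux_sub (w' := fun x => w' (A x)) hw (hw'.comp hAc)]
    apply hT.vertexFlux_eq_zero hz (hw.sub (hw'.comp hAc))
    intro x hx hx0
    rw [h x hx hx0, Function.comp_apply, hAx, hx0]; simp
  rw [hflux, hflux2, hT.agrad_eq_smul hT' hz hz' hF, norm_smul, Real.norm_eq_abs]
  ring

end

/-! ### A Poincaré inequality on convex sets -/

section

open scoped ENNReal
variable {d : ℕ}

lemma sq_lintegral_le {α : Type*} [MeasurableSpace α] (μ : Measure α) {g : α → ℝ≥0∞}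
    (hg : AEMeasurable g μ) : (∫⁻ x, g x ∂μ) ^ 2 ≤ μ Set.univ * ∫⁻ x, g x ^ 2 ∂μ := by
  have h := ENNReal.lintegral_mul_le_Lp_mul_Lq μ Real.HolderConjugate.two_two hg
    (aemeasurable_const (b := (1 : ℝ≥0∞)))
  simp only [Pi.mul_apply, mul_one, ENNReal.rpow_two, one_pow, lintegral_one] at h
  calc (∫⁻ x, g x ∂μ) ^ 2
      ≤ ((∫⁻ x, g x ^ 2 ∂μ) ^ (1 / 2 : ℝ) * μ Set.univ ^ (1 / 2 : ℝ)) ^ 2 := by gcongr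
    _ = μ Set.univ * ∫⁻ x, g x ^ 2 ∂μ := by
        rw [mul_pow, ← ENNReal.rpow_two, ← ENNReal.rpow_two, ← ENNReal.rpow_mul, ← ENNReal.rpow_mul]
        norm_num
        rw [mul_comm]

/-- The Jacobian t⁻ᵈ of the dilation is at most 2ᵈ. -/
lemma lintegral_comp_dilate {H : E d → ℝ≥0∞} (hH : Measurable H) (c : E d) {t : ℝ}
    (ht : 1 / 2 ≤ t) :
    ∫⁻ x, H (c + t • x) ≤ 2 ^ d * ∫⁻ x, H x := by
  have h1 : ∫⁻ x, H (c + t • x) = ∫⁻ x, H (c + x) ∂(Measure.map (t • ·) volume) :=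
    (lintegral_map (hH.comp (measurable_const_add c)) (measurable_const_smul t)).symm
  rw [h1, Measure.map_addHaar_smul _ (by positivity), lintegral_smul_measure,
    lintegral_add_left_eq_self, smul_eq_mul]
  gcongr
  rw [show (2 : ℝ≥0∞) ^ d = ENNReal.ofReal (2 ^ d) by
    rw [ENNReal.ofReal_pow (by norm_num)]; norm_num]
  apply ENNReal.ofReal_le_ofReal
  have ht0 : 0 < t := by linarith
  rw [abs_of_pos (by positivity), finrank_euclideanSpace_fin, ← inv_pow]
  gcongr
  rw [inv_le_comm₀ ht0 (by norm_num)]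
  linarith

/-- The fundamental theorem of calculus on the segment from y to x, then Cauchy–Schwarz in t. The
indicator extends the integrand by zero, so that later changes of variables may enlarge the domain
to the whole space. -/
lemma enorm_sub_sq_le_lintegral_segment {D : Set (E d)} (hD : Convex ℝ D) {δ : ℝ}
    (hδ : ∀ x ∈ D, ∀ y ∈ D, ‖x - y‖ ≤ δ) {f : E d → ℝ} (hf : ∀ x ∈ D, ContDiffAt ℝ 1 f x)
    {x y : E d} (hx : x ∈ D) (hy : y ∈ D) :
    ‖f x - f y‖ₑ ^ 2 ≤ ENNReal.ofReal δ ^ 2 *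
      ∫⁻ t in Set.Ioc (0 : ℝ) 1, D.indicator (fun x => ‖fderiv ℝ f x‖ₑ ^ 2) (y + t • (x - y)) := by
  have hseg : ∀ t ∈ Set.Icc (0 : ℝ) 1, y + t • (x - y) ∈ D := fun t ht => by
    have := hD hy hx (sub_nonneg.2 ht.2) ht.1 (by ring)
    convert this using 1; module
  have hcont : ContinuousOn (fun t : ℝ => fderiv ℝ f (y + t • (x - y)) (x - y)) (Set.Icc 0 1) := by
    intro t ht
    have h1 : ContinuousAt (fderiv ℝ f) (y + t • (x - y)) :=
      ((hf _ (hseg t ht)).fderiv_right (m := 0) (by norm_num)).continuousAt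
    have h2 : ContinuousAt (fun t : ℝ => y + t • (x - y)) t := by fun_prop
    exact ((ContinuousAt.comp (f := fun t : ℝ => y + t • (x - y)) h1 h2).clm_apply
      continuousAt_const).continuousWithinAt
  have hFTC : ∫ t in (0 : ℝ)..1, fderiv ℝ f (y + t • (x - y)) (x - y) = f x - f y := by
    rw [intervalIntegral.integral_eq_sub_of_hasDerivAt (f := fun t : ℝ => f (y + t • (x - y)))]
    · simp
    · intro t ht
      rw [Set.uIcc_of_le zero_le_one] at ht
      have h1 : HasDerivAt (fun s : ℝ => y + s • (x - y)) (x - y) t := by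
        simpa using ((hasDerivAt_id t).smul_const (x - y)).const_add y
      exact ((hf _ (hseg t ht)).differentiableAt one_ne_zero).hasFDerivAt.comp_hasDerivAt t h1
    · apply ContinuousOn.intervalIntegrable
      rwa [Set.uIcc_of_le zero_le_one]
  have hm : Measurable fun t : ℝ => ‖fderiv ℝ f (y + t • (x - y))‖ₑ :=
    (measurable_fderiv ℝ f).enorm.comp (by fun_prop)
  rw [intervalIntegral.integral_of_le zero_le_one] at hFTC
  have hxy : ‖x - y‖ₑ ≤ ENNReal.ofReal δ := by
    rw [← ofReal_norm]; exact ENNReal.ofReal_le_ofReal (hδ x hx y hy)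
  calc ‖f x - f y‖ₑ ^ 2
      ≤ (∫⁻ t in Set.Ioc (0 : ℝ) 1, ‖fderiv ℝ f (y + t • (x - y)) (x - y)‖ₑ) ^ 2 := by
        rw [← hFTC]; gcongr; exact enorm_integral_le_lintegral_enorm _
    _ ≤ (∫⁻ t in Set.Ioc (0 : ℝ) 1, ENNReal.ofReal δ * ‖fderiv ℝ f (y + t • (x - y))‖ₑ) ^ 2 := by
        gcongr with t
        rw [mul_comm]
        exact (ContinuousLinearMap.le_opENorm _ _).trans (by gcongr)
    _ = ENNReal.ofReal δ ^ 2 * (∫⁻ t in Set.Ioc (0 : ℝ) 1, ‖fderiv ℝ f (y + t • (x - y))‖ₑ) ^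
        2 := by
        rw [lintegral_const_mul _ hm, mul_pow]
    _ ≤ ENNReal.ofReal δ ^ 2 * ∫⁻ t in Set.Ioc (0 : ℝ) 1, ‖fderiv ℝ f (y + t • (x - y))‖ₑ ^ 2 := by
        gcongr
        refine (sq_lintegral_le _ hm.aemeasurable).trans (le_of_eq ?_)
        simp
    _ = _ := by
        congr 1
        apply setLIntegral_congr_fun measurableSet_Ioc
        intro t ht
        simp only
        rw [Set.indicator_of_mem (hseg t (Set.Ioc_subset_Icc_self ht))]

/-- A Poincaré inequality on convex sets, for the double integral of the differences. -/
lemma lintegral_pairs_le {D : Set (E d)} (hD : Convex ℝ D) (hDm : MeasurableSet D) {δ : ℝ}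
    (hδ : ∀ x ∈ D, ∀ y ∈ D, ‖x - y‖ ≤ δ) {f : E d → ℝ} (hf : ∀ x ∈ D, ContDiffAt ℝ 1 f x) :
    ∫⁻ x in D, ∫⁻ y in D, ‖f x - f y‖ₑ ^ 2
      ≤ ENNReal.ofReal δ ^ 2 * (2 ^ d * volume D * ∫⁻ x in D, ‖fderiv ℝ f x‖ₑ ^ 2) := by
  set H : E d → ℝ≥0∞ := D.indicator fun x => ‖fderiv ℝ f x‖ₑ ^ 2 with hHdef
  have hH : Measurable H := ((measurable_fderiv ℝ f).enorm.pow_const 2).indicator hDm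
  have hHint : ∫⁻ x, H x = ∫⁻ x in D, ‖fderiv ℝ f x‖ₑ ^ 2 := lintegral_indicator hDm _
  have hm3 : Measurable fun p : E d × E d × ℝ => H (p.2.1 + p.2.2 • (p.1 - p.2.1)) :=
    hH.comp (by fun_prop)
  -- The point y + t(x − y) depends on x with factor t and on y with factor 1 − t. The variable with
  -- factor at least 1/2 is integrated first, which keeps the Jacobian bounded.
  have key : ∀ t ∈ Set.Ioc (0 : ℝ) 1, ∫⁻ x in D, ∫⁻ y in D, H (y + t • (x - y))
      ≤ 2 ^ d * volume D * ∫⁻ x, H x := by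
    intro t ht
    rcases le_total (1 / 2) t with h | h
    · rw [lintegral_lintegral_swap]
      · calc ∫⁻ y in D, ∫⁻ x in D, H (y + t • (x - y))
            ≤ ∫⁻ y in D, 2 ^ d * ∫⁻ x, H x := by
              refine lintegral_mono fun y => ?_
              calc ∫⁻ x in D, H (y + t • (x - y)) ≤ ∫⁻ x, H (y + t • (x - y)) :=
                    setLIntegral_le_lintegral _ _
                _ = ∫⁻ x, H ((y - t • y) + t • x) := by
                    congr 1; ext x; congr 1; module
                _ ≤ _ := lintegral_comp_dilate hH _ h
          _ = _ := by rw [setLIntegral_const]; ring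
      · exact (hH.comp (by fun_prop : Measurable fun p : E d × E d =>
            p.2 + t • (p.1 - p.2))).aemeasurable
    · calc ∫⁻ x in D, ∫⁻ y in D, H (y + t • (x - y))
          ≤ ∫⁻ y in D, 2 ^ d * ∫⁻ x, H x := by
            refine lintegral_mono fun x => ?_
            calc ∫⁻ y in D, H (y + t • (x - y)) ≤ ∫⁻ y, H (y + t • (x - y)) :=
                  setLIntegral_le_lintegral _ _
              _ = ∫⁻ y, H (t • x + (1 - t) • y) := by
                  congr 1; ext y; congr 1; module
              _ ≤ _ := lintegral_comp_dilate hH _ (by linarith)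
        _ = _ := by rw [setLIntegral_const]; ring
  calc ∫⁻ x in D, ∫⁻ y in D, ‖f x - f y‖ₑ ^ 2
      ≤ ∫⁻ x in D, ∫⁻ y in D, ENNReal.ofReal δ ^ 2 *
          ∫⁻ t in Set.Ioc (0 : ℝ) 1, H (y + t • (x - y)) := by
        apply setLIntegral_mono' hDm
        intro x hx
        apply setLIntegral_mono' hDm
        intro y hy
        exact enorm_sub_sq_le_lintegral_segment hD hδ hf hx hy
    _ = ENNReal.ofReal δ ^ 2 * ∫⁻ x in D, ∫⁻ y in D,
          ∫⁻ t in Set.Ioc (0 : ℝ) 1, H (y + t • (x - y)) := by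
        rw [← lintegral_const_mul']
        · congr 1; ext x
          rw [lintegral_const_mul']
          exact ENNReal.pow_ne_top ENNReal.ofReal_ne_top
        · exact ENNReal.pow_ne_top ENNReal.ofReal_ne_top
    _ = ENNReal.ofReal δ ^ 2 * ∫⁻ t in Set.Ioc (0 : ℝ) 1, ∫⁻ x in D, ∫⁻ y in D,
          H (y + t • (x - y)) := by
        congr 1
        have h1 : ∀ x, ∫⁻ y in D, ∫⁻ t in Set.Ioc (0 : ℝ) 1, H (y + t • (x - y))
            = ∫⁻ t in Set.Ioc (0 : ℝ) 1, ∫⁻ y in D, H (y + t • (x - y)) := fun x =>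
          lintegral_lintegral_swap
            (hm3.comp (by fun_prop : Measurable fun p : E d × ℝ => (x, p.1, p.2))).aemeasurable
        simp only [h1]
        refine lintegral_lintegral_swap (Measurable.aemeasurable ?_)
        have : Measurable fun q : (E d × ℝ) × E d => H (q.2 + q.1.2 • (q.1.1 - q.2)) :=
          hH.comp (by fun_prop)
        exact this.lintegral_prod_right'
    _ ≤ ENNReal.ofReal δ ^ 2 * ∫⁻ t in Set.Ioc (0 : ℝ) 1, (2 ^ d * volume D * ∫⁻ x, H x) := by
        apply mul_le_mul_right
        exact setLIntegral_mono' measurableSet_Ioc key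
    _ = _ := by
        rw [setLIntegral_const, hHint]; simp

end

/-! ### Lipschitz domains -/

section

variable {d : ℕ} {Ω : Set (E d)}

/-- The component of `x` orthogonal to `e`. -/
abbrev perp (e : E d) : E d →L[ℝ] (ℝ ∙ e)ᗮ := (ℝ ∙ e)ᗮ.orthogonalProjectionOnto

lemma perp_self (e : E d) : perp e e = 0 :=
  Submodule.orthogonalProjectionOnto_orthogonalComplement_singleton_eq_zero e

lemma norm_perp_le (e x : E d) : ‖perp e x‖ ≤ ‖x‖ :=
  Submodule.norm_orthogonalProjectionOnto_apply_le _ x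

/-- Along −(e + u) the height falls at rate at least 1 − ‖u‖, while the graph falls at rate at most
K‖u‖. For ‖u‖ ≤ 1/(1 + K) a point below the graph therefore stays below it. -/
lemma le_of_notMem_epigraph {e : E d} {K : NNReal} {φ : (ℝ ∙ e)ᗮ → ℝ} (he : ‖e‖ = 1)
    (hφ : LipschitzWith K φ) {z u : E d} (hz : inner ℝ e z ≤ φ (perp e z)) {t : ℝ}
    (ht : 0 ≤ t) (hu : ‖u‖ ≤ (1 + (K : ℝ))⁻¹) :
    inner ℝ e (z - t • (e + u)) ≤ φ (perp e (z - t • (e + u))) := by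
  have h1 : |φ (perp e (z - t • (e + u))) - φ (perp e z)| ≤ K * (t * ‖u‖) := by
    have := hφ.dist_le_mul (perp e (z - t • (e + u))) (perp e z)
    rw [Real.dist_eq, dist_eq_norm, ← map_sub] at this
    refine this.trans ?_
    gcongr
    have h2 : z - t • (e + u) - z = -(t • (e + u)) := by abel
    rw [h2, map_neg, map_smul, map_add, perp_self, zero_add, norm_neg, norm_smul, Real.norm_eq_abs,
      abs_of_nonneg ht]
    gcongr
    exact norm_perp_le e u
  have h2 : inner ℝ e (z - t • (e + u)) = inner ℝ e z - t * (1 + inner ℝ e u) := by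
    rw [inner_sub_right, inner_smul_right, inner_add_right, real_inner_self_eq_norm_sq, he]; ring
  have h3 : -‖u‖ ≤ inner ℝ e u := by
    have := abs_real_inner_le_norm e u
    rw [he, one_mul] at this
    exact (abs_le.1 this).1
  have h4 : ‖u‖ * (1 + K) ≤ 1 := by
    have : (0 : ℝ) < 1 + K := by positivity
    calc ‖u‖ * (1 + K) ≤ (1 + (K : ℝ))⁻¹ * (1 + K) := by gcongr
      _ = 1 := inv_mul_cancel₀ this.ne'
  have h5 := (abs_le.1 h1).1
  rw [h2]
  have : t * (‖u‖ * (1 + K)) ≤ t * 1 := by gcongr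
  have : t * (-‖u‖) ≤ t * inner ℝ e u := by gcongr
  nlinarith

/-- The exterior of a Lipschitz domain contains cones with a fixed opening at the boundary
    points. -/
lemma IsLipschitzDomain.exists_exterior_cone (hΩ : IsLipschitzDomain Ω) :
    ∃ c : ℝ, 0 < c ∧ c ≤ 1 ∧ ∀ z ∈ frontier Ω, ∃ e : E d, ‖e‖ = 1 ∧ ∃ t₀ > 0, ∀ t : ℝ, 0 < t →
        t < t₀ →
      ∀ u : E d, ‖u‖ ≤ c → z - t • (e + u) ∉ Ω := by
  have hcomp : IsCompact (frontier Ω) :=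
    hΩ.isBounded.isCompact_closure.of_isClosed_subset isClosed_frontier frontier_subset_closure
  -- Compactness of the boundary makes the opening c uniform; the length t₀ of the cone may still
  -- depend on the point.
  refine hcomp.induction_on (p := fun S => ∃ c : ℝ, 0 < c ∧ c ≤ 1 ∧ ∀ z ∈ S, ∃ e : E d, ‖e‖ = 1 ∧
    ∃ t₀ > 0, ∀ t : ℝ, 0 < t → t < t₀ → ∀ u : E d, ‖u‖ ≤ c → z - t • (e + u) ∉ Ω) ?_ ?_ ?_ ?_
  · exact ⟨1, one_pos, le_rfl, by simp⟩
  · rintro S S' hS ⟨c, hc, hc1, h⟩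
    exact ⟨c, hc, hc1, fun z hz => h z (hS hz)⟩
  · rintro S S' ⟨c, hc, hc1, h⟩ ⟨c', hc', hc1', h'⟩
    refine ⟨min c c', lt_min hc hc', (min_le_left _ _).trans hc1, fun z hz => ?_⟩
    rcases hz with hz | hz
    · obtain ⟨e, he, t₀, ht₀, H⟩ := h z hz
      exact ⟨e, he, t₀, ht₀, fun t ht ht' u hu => H t ht ht' u (hu.trans (min_le_left _ _))⟩
    · obtain ⟨e, he, t₀, ht₀, H⟩ := h' z hz
      exact ⟨e, he, t₀, ht₀, fun t ht ht' u hu => H t ht ht' u (hu.trans (min_le_right _ _))⟩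
  · intro x₀ hx₀
    obtain ⟨e, K, φ, r, he, hφ, hr, hΩr⟩ := hΩ.lipschitz_boundary x₀ hx₀
    have hK : (0 : ℝ) ≤ K := K.2
    refine ⟨frontier Ω ∩ Metric.ball x₀ r,
      inter_mem_nhdsWithin _ (Metric.ball_mem_nhds x₀ hr), (1 + (K : ℝ))⁻¹, by positivity,
      inv_le_one_of_one_le₀ (by linarith), ?_⟩
    rintro z ⟨hz, hzr⟩
    have hznot : z ∉ Ω := fun h => by
      rw [hΩ.isOpen.frontier_eq] at hz; exact hz.2 h
    rw [Metric.mem_ball] at hzr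
    refine ⟨e, he, (r - dist z x₀) / 2, by linarith, fun t ht ht' u hu hmem => ?_⟩
    have hball : z - t • (e + u) ∈ Metric.ball x₀ r := by
      rw [Metric.mem_ball]
      have h1 : dist (z - t • (e + u)) z ≤ 2 * t := by
        rw [dist_eq_norm, show z - t • (e + u) - z = -(t • (e + u)) by abel, norm_neg, norm_smul,
          Real.norm_eq_abs, abs_of_pos ht]
        have : ‖e + u‖ ≤ 2 := (norm_add_le _ _).trans (by
          rw [he]; have := hu.trans (inv_le_one_of_one_le₀ (by linarith : (1 : ℝ) ≤ 1 + K));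
              linarith)
        nlinarith
      linarith [dist_triangle (z - t • (e + u)) z x₀]
    have h1 : inner ℝ e z ≤ φ (perp e z) := by
      rw [hΩr z hzr] at hznot; exact not_lt.1 hznot
    have h2 := le_of_notMem_epigraph he hφ h1 ht.le hu
    exact absurd ((hΩr _ hball).1 hmem) (not_lt.2 h2)

/-- Slits are excluded: if a boundary point were interior to the closure, points of the exterior
cone would be limits of points of Ω, and some of the latter would lie in the cone. This is what
places the interiors of the cells inside Ω. -/
lemma IsLipschitzDomain.interior_closure (hΩ : IsLipschitzDomain Ω) : interior (closure Ω) = Ω := by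
  apply subset_antisymm _ (interior_maximal subset_closure hΩ.isOpen)
  intro z hz
  by_contra hzΩ
  have hzf : z ∈ frontier Ω := by
    rw [hΩ.isOpen.frontier_eq]; exact ⟨interior_subset hz, hzΩ⟩
  obtain ⟨c, hc, -, hcone⟩ := hΩ.exists_exterior_cone
  obtain ⟨e, he, t₀, ht₀, H⟩ := hcone z hzf
  obtain ⟨ε, hε, hball⟩ := Metric.isOpen_iff.1 isOpen_interior z hz
  set t := min (t₀ / 2) (ε / 2) with htdef
  have ht : 0 < t := by positivity
  have ht1 : t < t₀ := (min_le_left _ _).trans_lt (by linarith)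
  have ht2 : t < ε := (min_le_right _ _).trans_lt (by linarith)
  have hx : z - t • e ∈ closure Ω := by
    apply interior_subset
    apply hball
    rw [Metric.mem_ball, dist_eq_norm,
        show z - t • e - z = -(t • e) by abel, norm_neg, norm_smul, he,
      Real.norm_eq_abs, abs_of_pos ht]
    linarith
  obtain ⟨y, hy, hyx⟩ := Metric.mem_closure_iff.1 hx (t * c) (by positivity)
  apply H t ht ht1 (t⁻¹ • (z - t • e - y)) _ _
  · rw [norm_smul, norm_inv, Real.norm_eq_abs, abs_of_pos ht, ← dist_eq_norm]
    rw [inv_mul_le_iff₀ ht]; exact hyx.le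
  · convert hy using 1
    rw [smul_add, smul_smul, mul_inv_cancel₀ ht.ne']
    module

/-- Near a boundary point, any two points of a Lipschitz domain can be joined inside the domain. -/
lemma IsLipschitzDomain.exists_joining (hΩ : IsLipschitzDomain Ω) {z : E d} (hz : z ∈ frontier Ω)
    {r : ℝ} (hr : 0 < r) : ∃ ε > 0, ∀ x ∈ Ω ∩ Metric.ball z ε, ∀ y ∈ Ω ∩ Metric.ball z ε,
      ∃ P : Set (E d), IsPreconnected P ∧ P ⊆ Ω ∩ Metric.ball z r ∧ x ∈ P ∧ y ∈ P := by
  obtain ⟨e, K, φ, r₁, he, hφ, hr₁, hΩr⟩ := hΩ.lipschitz_boundary z hz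
  have hK : (0 : ℝ) ≤ K := K.2
  have hzge : φ (perp e z) ≤ inner ℝ e z := by
    have hmem : z ∈ closure (Ω ∩ Metric.ball z r₁) := by
      rw [mem_closure_iff_nhds]
      intro V hV
      have hzc : z ∈ closure Ω := frontier_subset_closure hz
      obtain ⟨y, hy, hyΩ⟩ := mem_closure_iff_nhds.1 hzc (V ∩ Metric.ball z r₁)
        (inter_mem hV (Metric.ball_mem_nhds z hr₁))
      exact ⟨y, hy.1, hyΩ, hy.2⟩
    have hcl : IsClosed {x : E d | φ (perp e x) ≤ inner ℝ e x} :=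
      isClosed_le (hφ.continuous.comp (perp e).continuous) (by fun_prop)
    exact closure_minimal (fun x hx => ((hΩr x hx.2).1 hx.1).le) hcl hmem
  have hzle : inner ℝ e z ≤ φ (perp e z) := by
    have hznot : z ∉ Ω := fun h => by
      rw [hΩ.isOpen.frontier_eq] at hz; exact hz.2 h
    rw [hΩr z (Metric.mem_ball_self hr₁)] at hznot; exact not_lt.1 hznot
  have hzeq := le_antisymm hzge hzle
  set ρ := min r r₁ with hρ
  have hρ0 : 0 < ρ := lt_min hr hr₁
  -- Lifting `ball z ε` by s = (1 + K)ε along e puts it above the graph. The denominator 3 + K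
  -- leaves room for s + ε = (2 + K)ε < ρ.
  set ε := ρ / (3 + K) with hεdef
  have hε : 0 < ε := by positivity
  set s := (1 + K) * ε with hs
  have hsε : s + ε < ρ := by
    have : (3 + K) * ε = ρ := by rw [hεdef]; field_simp
    nlinarith
  have up : ∀ x ∈ Ω ∩ Metric.ball z ε, ∀ t ∈ Set.Icc 0 s, x + t • e ∈ Ω ∩ Metric.ball z ρ := by
    rintro x ⟨hx, hxz⟩ t ⟨ht0, hts⟩
    rw [Metric.mem_ball] at hxz
    have hb : x + t • e ∈ Metric.ball z ρ := by
      rw [Metric.mem_ball]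
      have : dist (x + t • e) x = t := by
        rw [dist_eq_norm, add_sub_cancel_left, norm_smul, he, Real.norm_eq_abs, abs_of_nonneg ht0,
          mul_one]
      linarith [dist_triangle (x + t • e) x z]
    refine ⟨?_, hb⟩
    have hxb : x ∈ Metric.ball z r₁ := by
      rw [Metric.mem_ball]
      have := min_le_right r r₁
      have : 0 ≤ s := by positivity
      linarith
    have h1 := (hΩr x hxb).1 hx
    rw [hΩr _ (Metric.ball_subset_ball (min_le_right _ _) hb)]
    have h2 : perp e (x + t • e) = perp e x := by simp [perp_self]
    change φ (perp e (x + t • e)) < _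
    rw [h2, inner_add_right, inner_smul_right, real_inner_self_eq_norm_sq, he]
    change φ (perp e x) < _ at h1
    linarith
  have across : ∀ m ∈ Metric.ball z ε, m + s • e ∈ Ω ∩ Metric.ball z ρ := by
    intro m hm
    rw [Metric.mem_ball] at hm
    have hb : m + s • e ∈ Metric.ball z ρ := by
      rw [Metric.mem_ball]
      have : dist (m + s • e) m = s := by
        rw [dist_eq_norm, add_sub_cancel_left, norm_smul, he, Real.norm_eq_abs,
          abs_of_nonneg (by positivity), mul_one]
      linarith [dist_triangle (m + s • e) m z]
    refine ⟨?_, hb⟩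
    rw [hΩr _ (Metric.ball_subset_ball (min_le_right _ _) hb)]
    have h2 : perp e (m + s • e) = perp e m := by simp [perp_self]
    change φ (perp e (m + s • e)) < _
    rw [h2, inner_add_right, inner_smul_right, real_inner_self_eq_norm_sq, he]
    have h3 : |φ (perp e m) - φ (perp e z)| ≤ K * dist m z := by
      have := hφ.dist_le_mul (perp e m) (perp e z)
      rw [Real.dist_eq, dist_eq_norm, ← map_sub] at this
      refine this.trans ?_
      gcongr
      rw [dist_eq_norm]
      exact norm_perp_le e _
    have h4 : |inner ℝ e m - inner ℝ e z| ≤ dist m z := by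
      rw [← inner_sub_right, dist_eq_norm]
      simpa [he] using abs_real_inner_le_norm e (m - z)
    have h5 := (abs_le.1 h3).2
    have h6 := (abs_le.1 h4).1
    have : (1 + K) * dist m z < (1 + K) * ε := by gcongr
    nlinarith
  refine ⟨ε, hε, fun x hx y hy => ?_⟩
  have seg : ∀ x : E d, IsPreconnected ((fun t : ℝ => x + t • e) '' Set.Icc 0 s) := fun x =>
    isPreconnected_Icc.image _ (by fun_prop : Continuous fun t : ℝ => x + t • e).continuousOn
  have hov : IsPreconnected ((fun m : E d => m + s • e) '' Metric.ball z ε) :=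
    (convex_ball z ε).isPreconnected.image _
    (by fun_prop : Continuous fun m : E d => m + s • e).continuousOn
  have hs0 : 0 ≤ s := by positivity
  -- Up from x, across inside the lifted ball, and down to y.
  refine ⟨((fun t : ℝ => x + t • e) '' Set.Icc 0 s ∪ (fun m : E d => m + s • e) '' Metric.ball z
      ε) ∪
    (fun t : ℝ => y + t • e) '' Set.Icc 0 s, ?_, ?_, ?_, ?_⟩
  · refine IsPreconnected.union (y + s • e) ?_ ?_
        (IsPreconnected.union (x + s • e) ?_ ?_ (seg x) hov)
      (seg y)
    · exact Or.inr ⟨y, hy.2, rfl⟩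
    · exact ⟨s, ⟨hs0, le_rfl⟩, rfl⟩
    · exact ⟨s, ⟨hs0, le_rfl⟩, rfl⟩
    · exact ⟨x, hx.2, rfl⟩
  · have hsub : Ω ∩ Metric.ball z ρ ⊆ Ω ∩ Metric.ball z r :=
      Set.inter_subset_inter_right _ (Metric.ball_subset_ball (min_le_left _ _))
    refine Set.Subset.trans ?_ hsub
    rintro p ((⟨t, ht, rfl⟩ | ⟨m, hm, rfl⟩) | ⟨t, ht, rfl⟩)
    · exact up x hx t ht
    · exact across m hm
    · exact up y hy t ht
  · exact Or.inl (Or.inl ⟨0, ⟨le_rfl, hs0⟩, by simp⟩)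
  · exact Or.inr ⟨0, ⟨le_rfl, hs0⟩, by simp⟩

end

/-! ### Geometry of shape regular meshes -/

section

variable {d : ℕ} {Ω : Set (E d)} {T T' : Finset (E d)} {z : E d}

lemma IsCell.exists_mem_notMem (hT : IsCell T) (hT' : IsCell T') (h : T ≠ T') :
    ∃ v ∈ T, v ∉ T' := by
  by_contra! hc
  exact h (Finset.eq_of_subset_of_card_le hc (by rw [hT.card_eq, hT'.card_eq]))

lemma volume_real_closedBall (c : E d) {r : ℝ} (hr : 0 ≤ r) :
    volume.real (Metric.closedBall c r) = r ^ d * volume.real (Metric.ball (0 : E d) 1) := by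
  have := Measure.addHaar_real_closedBall (volume : Measure (E d)) c hr
  rwa [finrank_euclideanSpace_fin] at this

lemma volume_real_unitBall_pos : 0 < volume.real (Metric.ball (0 : E d) 1) :=
  ENNReal.toReal_pos (Metric.measure_ball_pos volume _ one_pos).ne' measure_ball_lt_top.ne

namespace Mesh
variable (𝒯 : Mesh Ω)

lemma simplex_subset (hT : T ∈ 𝒯.cells) : simplex T ⊆ closure Ω := by
  rw [← 𝒯.cover]
  exact Set.subset_biUnion_of_mem (u := fun T => simplex T) hT

lemma exists_cell {x : E d} (hx : x ∈ closure Ω) : ∃ T ∈ 𝒯.cells, x ∈ simplex T := by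
  rw [← 𝒯.cover] at hx
  simpa using hx

lemma interior_subset (hΩ : IsLipschitzDomain Ω) (hT : T ∈ 𝒯.cells) : interior (simplex T) ⊆ Ω := by
  rw [← hΩ.interior_closure]
  exact interior_mono (𝒯.simplex_subset hT)

/-- Points of two cells lie on their common face. -/
lemma lam_eq_zero (hT : T ∈ 𝒯.cells) (hT' : T' ∈ 𝒯.cells) {x : E d} (hx : x ∈ simplex T)
    (hx' : x ∈ simplex T') (hz : z ∈ T) (hz' : z ∉ T') : lam T z x = 0 := by
  have h : x ∈ convexHull ℝ ((T : Set (E d)) ∩ T') := by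
    rw [← 𝒯.conforming T hT T' hT']; exact ⟨hx, hx'⟩
  rw [(𝒯.isCell hT).mem_convexHull_face Set.inter_subset_left] at h
  exact h.2 z hz fun hh => hz' hh.2

lemma affine_eq_of_common (hT : T ∈ 𝒯.cells) (hT' : T' ∈ 𝒯.cells) {x : E d} (hx : x ∈ simplex T)
    (hx' : x ∈ simplex T') {l m : E d →ᵃ[ℝ] ℝ} (h : ∀ v ∈ T, v ∈ T' → l v = m v) : l x = m x := by
  rw [(𝒯.isCell hT).affine_eq_sum l, (𝒯.isCell hT).affine_eq_sum m]
  refine Finset.sum_congr rfl fun v hv => ?_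
  by_cases hv' : v ∈ T'
  · rw [h v hv hv']
  · rw [𝒯.lam_eq_zero hT hT' hx hx' hv hv', zero_mul, zero_mul]

lemma lam_eq_lam (hT : T ∈ 𝒯.cells) (hT' : T' ∈ 𝒯.cells) {x : E d} (hx : x ∈ simplex T)
    (hx' : x ∈ simplex T') (hz : z ∈ T) (hz' : z ∈ T') : lam T z x = lam T' z x := by
  apply 𝒯.affine_eq_of_common hT hT' hx hx'
  intro v hv hv'
  by_cases hvz : v = z
  · subst hvz
    rw [(𝒯.isCell hT).lam_self hz, (𝒯.isCell hT').lam_self hz']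
  · rw [(𝒯.isCell hT).lam_ne hz hv hvz, (𝒯.isCell hT').lam_ne hz' hv' hvz]

lemma eq_of_mem_interior (hT : T ∈ 𝒯.cells) (hT' : T' ∈ 𝒯.cells) {x : E d}
    (hx : x ∈ interior (simplex T)) (hx' : x ∈ simplex T') : T = T' := by
  by_contra h
  obtain ⟨v, hv, hv'⟩ := (𝒯.isCell hT).exists_mem_notMem (𝒯.isCell hT') h
  have h1 := 𝒯.lam_eq_zero hT hT' (_root_.interior_subset hx) hx' hv hv'
  have h2 := (𝒯.isCell hT).mem_interior.1 hx v hv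
  exact h2.ne' h1

lemma aedisjoint : (𝒯.cells : Set (Finset (E d))).Pairwise
    (Function.onFun (AEDisjoint volume) simplex) := by
  intro T hT T' hT' hne
  apply measure_mono_null (t := frontier (simplex T)) _ (convex_simplex.addHaar_frontier volume)
  rintro x ⟨hx, hx'⟩
  rw [isClosed_simplex.frontier_eq]
  exact ⟨hx, fun h => hne (𝒯.eq_of_mem_interior hT hT' h hx')⟩

/-- A point of the closure outside Ω lies in some cell, but not in its interior, so the boundary of
Ω is covered by finitely many null frontiers. Integrals over Ω can then be split over cells,
although these only cover the closure. -/
lemma volume_closure_sdiff (𝒯 : Mesh Ω) (hΩ : IsLipschitzDomain Ω) :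
    volume (closure Ω \ Ω) = 0 := by
  apply measure_mono_null (t := ⋃ T ∈ 𝒯.cells, frontier (simplex T))
  · rintro x ⟨hx, hxΩ⟩
    obtain ⟨T, hT, hxT⟩ := 𝒯.exists_cell hx
    simp only [Set.mem_iUnion]
    refine ⟨T, hT, ?_⟩
    rw [isClosed_simplex.frontier_eq]
    exact ⟨hxT, fun h => hxΩ (𝒯.interior_subset hΩ hT h)⟩
  · exact (measure_biUnion_null_iff 𝒯.cells.countable_toSet).2
      fun T _ => convex_simplex.addHaar_frontier volume

lemma restrict_closure (𝒯 : Mesh Ω) (hΩ : IsLipschitzDomain Ω) :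
    volume.restrict (closure Ω) = volume.restrict Ω := by
  apply Measure.restrict_congr_set
  refine (ae_eq_set).2 ⟨𝒯.volume_closure_sdiff hΩ, ?_⟩
  rw [Set.sdiff_eq_empty.2 subset_closure, measure_empty]

/-- The Lebesgue measure on the domain is the sum of those on the cells. -/
lemma restrict_eq_sum (hΩ : IsLipschitzDomain Ω) :
    volume.restrict Ω = ∑ T ∈ 𝒯.cells, volume.restrict (simplex T) := by
  rw [← 𝒯.restrict_closure hΩ]
  ext s hs
  rw [Measure.restrict_apply hs, ← 𝒯.cover, Set.inter_iUnion₂, Measure.finsetSum_apply,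
    measure_biUnion_finset₀]
  · exact Finset.sum_congr rfl fun T _ => (Measure.restrict_apply hs).symm
  · intro T hT T' hT' hne
    exact (𝒯.aedisjoint hT hT' hne).mono Set.inter_subset_right Set.inter_subset_right
  · exact fun T _ => (hs.inter measurableSet_simplex).nullMeasurableSet

lemma restrict_le (hΩ : IsLipschitzDomain Ω) (hT : T ∈ 𝒯.cells) :
    volume.restrict (simplex T) ≤ volume.restrict Ω := by
  rw [← 𝒯.restrict_closure hΩ]
  exact Measure.restrict_mono (𝒯.simplex_subset hT) le_rfl

lemma setIntegral_eq_sum (hΩ : IsLipschitzDomain Ω) {f : E d → ℝ} (hf : IntegrableOn f Ω) :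
    ∫ x in Ω, f x = ∑ T ∈ 𝒯.cells, ∫ x in simplex T, f x := by
  rw [𝒯.restrict_eq_sum hΩ, integral_finsetSum_measure]
  intro T hT
  exact Integrable.mono_measure hf (𝒯.restrict_le hΩ hT)

/-- A point has a neighbourhood that only meets the cells containing the point. -/
lemma exists_ball_disjoint (x : E d) :
    ∃ r > 0, ∀ T ∈ 𝒯.cells, x ∉ simplex T → ∀ y ∈ Metric.ball x r, y ∉ simplex T := by
  have : ∀ᶠ y in 𝓝 x, ∀ T ∈ 𝒯.cells, x ∉ simplex T → y ∉ simplex T := by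
    rw [Filter.eventually_all_finset]
    intro T _
    by_cases hx : x ∈ simplex T
    · exact .of_forall fun y h => absurd hx h
    · filter_upwards [isClosed_simplex.isOpen_compl.mem_nhds hx] with y hy _ using hy
  obtain ⟨r, hr, h⟩ := Metric.eventually_nhds_iff_ball.1 this
  exact ⟨r, hr, fun T hT hx y hy => h y hy T hT hx⟩

/-- The vertices of the mesh. -/
def vertices : Finset (E d) := open Classical in 𝒯.cells.biUnion id

lemma mem_vertices : z ∈ 𝒯.vertices ↔ ∃ T ∈ 𝒯.cells, z ∈ T := by simp [vertices]

/-- The cells with the vertex `z`. -/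
def star (z : E d) : Finset (Finset (E d)) := open Classical in {T ∈ 𝒯.cells | z ∈ T}

lemma mem_star : T ∈ 𝒯.star z ↔ T ∈ 𝒯.cells ∧ z ∈ T := by simp [star]

/-- Conformity excludes hanging nodes. -/
lemma mem_of_vertex_mem_simplex (hz : z ∈ 𝒯.vertices) (hT : T ∈ 𝒯.cells) (h : z ∈ simplex T) :
    z ∈ T := by
  obtain ⟨T₀, hT₀, hz₀⟩ := 𝒯.mem_vertices.1 hz
  by_contra hn
  have := 𝒯.lam_eq_zero hT₀ hT (mem_simplex_of_mem hz₀) h hz₀ hn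
  rw [(𝒯.isCell hT₀).lam_self hz₀] at this
  exact one_ne_zero this

lemma vertex_mem_closure (hz : z ∈ 𝒯.vertices) : z ∈ closure Ω := by
  obtain ⟨T, hT, hzT⟩ := 𝒯.mem_vertices.1 hz
  exact 𝒯.simplex_subset hT (mem_simplex_of_mem hzT)

lemma exists_ball_star (hz : z ∈ 𝒯.vertices) :
    ∃ r > 0, ∀ T ∈ 𝒯.cells, ∀ y ∈ Metric.ball z r, y ∈ simplex T → T ∈ 𝒯.star z := by
  obtain ⟨r, hr, h⟩ := 𝒯.exists_ball_disjoint z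
  refine ⟨r, hr, fun T hT y hy hyT => 𝒯.mem_star.2 ⟨hT, ?_⟩⟩
  by_contra hn
  exact h T hT (fun hz' => hn (𝒯.mem_of_vertex_mem_simplex hz hT hz')) y hy hyT

/-- The cells around a vertex are connected outside this vertex. -/
lemma exists_preconnected (hd : 2 ≤ d) (hΩ : IsLipschitzDomain Ω) (hT : T ∈ 𝒯.star z)
    (hT' : T' ∈ 𝒯.star z) {r : ℝ} (hr : 0 < r) :
    ∃ P : Set (E d), IsPreconnected P ∧ P ⊆ closure Ω ∩ Metric.ball z r ∧ z ∉ P ∧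
      (P ∩ simplex T).Nonempty ∧ (P ∩ simplex T').Nonempty := by
  rw [mem_star] at hT hT'
  have hzv : z ∈ 𝒯.vertices := 𝒯.mem_vertices.2 ⟨T, hT⟩
  by_cases hzΩ : z ∈ Ω
  · obtain ⟨ε₁, hε₁, hb⟩ := Metric.isOpen_iff.1 hΩ.isOpen z hzΩ
    have hv : ∀ {T}, T ∈ 𝒯.cells ∧ z ∈ T → ∃ v ∈ T, v ≠ z := fun {T} h => by
      have : 1 < T.card := by rw [𝒯.card_eq T h.1]; omega
      exact Finset.exists_mem_ne this z
    obtain ⟨v, hv1, hvz⟩ := hv hT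
    obtain ⟨v', hv1', hvz'⟩ := hv hT'
    have p1 : 0 < ‖v - z‖ := norm_pos_iff.2 (sub_ne_zero.2 hvz)
    have p2 : 0 < ‖v' - z‖ := norm_pos_iff.2 (sub_ne_zero.2 hvz')
    set ε := min (min (r / 2) (ε₁ / 2)) (min ‖v - z‖ ‖v' - z‖) with hε
    have hε0 : 0 < ε := by positivity
    have hεr : ε < r := by
      have := (min_le_left _ _ : ε ≤ _).trans (min_le_left (r / 2) (ε₁ / 2)); linarith
    have hεe : ε < ε₁ := by
      have := (min_le_left _ _ : ε ≤ _).trans (min_le_right (r / 2) (ε₁ / 2)); linarith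
    have hεv : ε ≤ ‖v - z‖ := (min_le_right _ _ : ε ≤ _).trans (min_le_left _ _)
    have hεv' : ε ≤ ‖v' - z‖ := (min_le_right _ _ : ε ≤ _).trans (min_le_right _ _)
    have key : ∀ {T v}, z ∈ T → v ∈ T → 0 < ‖v - z‖ → ε ≤ ‖v - z‖ →
        (Metric.sphere z ε ∩ simplex T).Nonempty := by
      intro T v hzT hvT hp he
      refine ⟨z + (ε / ‖v - z‖) • (v - z), ?_, ?_⟩
      · rw [mem_sphere_iff_norm, add_sub_cancel_left, norm_smul, Real.norm_eq_abs,
          abs_of_pos (by positivity)]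
        field_simp
      · have := convex_simplex (mem_simplex_of_mem hzT) (mem_simplex_of_mem hvT)
          (sub_nonneg.2 ((div_le_one hp).2 he)) (by positivity : 0 ≤ ε / ‖v - z‖) (by ring)
        convert this using 1; module
    -- At an interior vertex a small sphere serves, being connected for d ≥ 2. It meets each of the
    -- two cells because its radius does not exceed the chosen edges at z.
    refine ⟨Metric.sphere z ε, isPreconnected_sphere ?_ z ε, ?_, ?_, key hT.2 hv1 p1 hεv,
      key hT'.2 hv1' p2 hεv'⟩
    · rw [← Module.finrank_eq_rank, finrank_euclideanSpace_fin]; exact_mod_cast hd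
    · intro x hx
      rw [mem_sphere_iff_norm] at hx
      refine ⟨subset_closure (hb ?_), ?_⟩ <;> rw [Metric.mem_ball, dist_eq_norm, hx] <;> assumption
    · intro h
      rw [mem_sphere_iff_norm, sub_self, norm_zero] at h
      exact hε0.ne h
  · have hzf : z ∈ frontier Ω := by
      rw [hΩ.isOpen.frontier_eq]; exact ⟨𝒯.vertex_mem_closure hzv, hzΩ⟩
    obtain ⟨ε, hε, H⟩ := hΩ.exists_joining hzf hr
    have key : ∀ {T}, T ∈ 𝒯.cells ∧ z ∈ T → ∃ x ∈ Ω ∩ Metric.ball z ε, x ∈ simplex T := by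
      intro T h
      have h1 : z ∈ closure (interior (simplex T)) := by
        rw [(𝒯.isCell h.1).closure_interior]; exact mem_simplex_of_mem h.2
      obtain ⟨x, hx, hxi⟩ := mem_closure_iff_nhds.1 h1 _ (Metric.ball_mem_nhds z hε)
      exact ⟨x, ⟨𝒯.interior_subset hΩ h.1 hxi, hx⟩, _root_.interior_subset hxi⟩
    obtain ⟨x, hx, hxT⟩ := key hT
    obtain ⟨y, hy, hyT⟩ := key hT'
    obtain ⟨P, hP, hPs, hxP, hyP⟩ := H x hx y hy
    -- At a boundary vertex the joining set lies in Ω and hence misses z.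
    refine ⟨P, hP, fun p hp => ⟨subset_closure (hPs hp).1, (hPs hp).2⟩, fun h => hzΩ (hPs h).1,
      ⟨x, hxP, hxT⟩, ⟨y, hyP, hyT⟩⟩

/-- A nontrivial subset of the cells around a vertex shares an edge with its complement. -/
lemma exists_common_edge (hd : 2 ≤ d) (hΩ : IsLipschitzDomain Ω) {A : Finset (Finset (E d))}
    (hA : A ⊆ 𝒯.star z) (hAn : A.Nonempty) (hne : A ≠ 𝒯.star z) :
    ∃ T ∈ A, ∃ T' ∈ 𝒯.star z, T' ∉ A ∧ ∃ v ∈ T, v ∈ T' ∧ v ≠ z := by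
  classical
  obtain ⟨T₁, hT₁⟩ := hAn
  obtain ⟨T₂, hT₂, hT₂A⟩ : ∃ T₂ ∈ 𝒯.star z, T₂ ∉ A := by
    by_contra! h
    exact hne (subset_antisymm hA h)
  have hzv : z ∈ 𝒯.vertices := 𝒯.mem_vertices.2 ⟨T₁, 𝒯.mem_star.1 (hA hT₁)⟩
  obtain ⟨r, hr, hstar⟩ := 𝒯.exists_ball_star hzv
  obtain ⟨P, hP, hPs, hzP, hP1, hP2⟩ := 𝒯.exists_preconnected hd hΩ (hA hT₁) hT₂ hr
  have hc : ∀ B : Finset (Finset (E d)), IsClosed (⋃ T ∈ B, simplex T) := fun B =>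
    B.finite_toSet.isClosed_biUnion fun T _ => isClosed_simplex
  have hcov : P ⊆ (⋃ T ∈ A, simplex T) ∪ ⋃ T ∈ 𝒯.star z \ A, simplex T := by
    intro p hp
    obtain ⟨T, hT, hpT⟩ := 𝒯.exists_cell (hPs hp).1
    have hTs := hstar T hT p (hPs hp).2 hpT
    by_cases hTA : T ∈ A
    · left; exact Set.mem_biUnion hTA hpT
    · right; exact Set.mem_biUnion (Finset.mem_sdiff.2 ⟨hTs, hTA⟩) hpT
  -- The connected set P is covered by two closed unions of cells and meets both, so they share a
  -- point p ≠ z. This point lies in the hull of the common vertices of two cells, which cannot be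
  -- reduced to z.
  obtain ⟨p, hpP, hpA, hpB⟩ := isPreconnected_closed_iff.1 hP _ _ (hc A) (hc _) hcov
    (hP1.mono (Set.inter_subset_inter_right _ (Set.subset_biUnion_of_mem (u := simplex) hT₁)))
    (hP2.mono (Set.inter_subset_inter_right _ (Set.subset_biUnion_of_mem (u := simplex)
      (Finset.mem_sdiff.2 ⟨hT₂, hT₂A⟩))))
  simp only [Set.mem_iUnion] at hpA hpB
  obtain ⟨T, hT, hpT⟩ := hpA
  obtain ⟨T', hT', hpT'⟩ := hpB
  rw [Finset.mem_sdiff] at hT'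
  refine ⟨T, hT, T', hT'.1, hT'.2, ?_⟩
  by_contra! hcon
  have hTc := 𝒯.mem_star.1 (hA hT)
  have hTc' := 𝒯.mem_star.1 hT'.1
  apply hzP
  have : p = z := by
    have h1 : p ∈ convexHull ℝ ((T : Set (E d)) ∩ T') := by
      rw [← 𝒯.conforming T hTc.1 T' hTc'.1]; exact ⟨hpT, hpT'⟩
    have h2 : (T : Set (E d)) ∩ T' ⊆ {z} := fun v hv => hcon v hv.1 hv.2
    have h3 := convexHull_mono h2 h1
    rwa [convexHull_singleton] at h3
  rwa [← this]

/-- The sizes of the cells around a vertex are comparable. -/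
lemma size_le_of_star (hd : 2 ≤ d) (hΩ : IsLipschitzDomain Ω) {σ : ℝ} (hσ : 1 ≤ σ)
    (hreg : ∀ T ∈ 𝒯.cells, CellRegular σ T) (hT : T ∈ 𝒯.star z) (hT' : T' ∈ 𝒯.star z) :
    size T' ≤ σ ^ (𝒯.star z).card * size T := by
  classical
  -- The cells reached with loss σᵏ form an increasing family that gains at least one cell at each k
  -- until it exhausts the star.
  have key : ∀ k : ℕ, (𝒯.star z).filter (fun S => size S ≤ σ ^ k * size T) = 𝒯.star z ∨
      k + 1 ≤ ((𝒯.star z).filter (fun S => size S ≤ σ ^ k * size T)).card := by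
    intro k
    induction k with
    | zero =>
      right
      rw [zero_add, Nat.succ_le_iff, Finset.card_pos]
      exact ⟨T, by simp [hT]⟩
    | succ k ih =>
      have hmono : (𝒯.star z).filter (fun S => size S ≤ σ ^ k * size T)
          ⊆ (𝒯.star z).filter (fun S => size S ≤ σ ^ (k + 1) * size T) := by
        intro S hS
        rw [Finset.mem_filter] at hS ⊢
        refine ⟨hS.1, hS.2.trans ?_⟩
        have := size_nonneg (T := T)
        gcongr ?_ * _
        exact pow_le_pow_right₀ hσ k.le_succ
      by_cases hfull : (𝒯.star z).filter (fun S => size S ≤ σ ^ k * size T) = 𝒯.star z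
      · left
        apply subset_antisymm (Finset.filter_subset _ _)
        exact hfull.symm.subset.trans hmono
      · right
        have hk := ih.resolve_left hfull
        obtain ⟨S, hS, S', hS', hS'n, v, hv, hv', hvz⟩ := 𝒯.exists_common_edge hd hΩ
          (Finset.filter_subset _ _) (Finset.card_pos.1 (by omega)) hfull
        rw [Finset.mem_filter] at hS
        have hSc := 𝒯.mem_star.1 hS.1
        have hSc' := 𝒯.mem_star.1 hS'
        -- The shared edge from z to v has length at least `size S' / σ` and at most `size S`.
        have h1 : size S' ≤ σ * size S := by
          refine ((𝒯.isCell hSc'.1).size_le_edge hSc'.2 hv' hvz (by linarith)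
            (hreg S' hSc'.1)).trans ?_
          gcongr
          exact norm_sub_le_size (mem_simplex_of_mem hSc.2) (mem_simplex_of_mem hv)
        have hlt : (𝒯.star z).filter (fun S => size S ≤ σ ^ k * size T)
            ⊂ (𝒯.star z).filter (fun S => size S ≤ σ ^ (k + 1) * size T) := by
          refine Finset.ssubset_iff_subset_ne.2 ⟨hmono, fun heq => hS'n ?_⟩
          rw [heq, Finset.mem_filter]
          refine ⟨hS', h1.trans ?_⟩
          calc σ * size S ≤ σ * (σ ^ k * size T) := by gcongr; exact hS.2
            _ = σ ^ (k + 1) * size T := by ring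
        have := Finset.card_lt_card hlt
        omega
  rcases key (𝒯.star z).card with h | h
  · rw [← h, Finset.mem_filter] at hT'
    exact hT'.2
  · have := Finset.card_filter_le (𝒯.star z) (fun S => size S ≤ σ ^ (𝒯.star z).card * size T)
    omega

/-- The number of the cells around a vertex is bounded. -/
lemma card_star_le (hd : 1 ≤ d) {σ : ℝ} (hσ : 1 ≤ σ)
    (hreg : ∀ T ∈ 𝒯.cells, CellRegular σ T) (z : E d) : ((𝒯.star z).card : ℝ) ≤ (2 * σ) ^ d := by
  classical
  rcases (𝒯.star z).eq_empty_or_nonempty with h0 | hne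
  · rw [h0]; simp; positivity
  have hcell : ∀ T ∈ 𝒯.star z, IsCell T ∧ z ∈ T ∧ 0 < size T ∧ CellRegular σ T := fun T hT => by
    have := 𝒯.mem_star.1 hT
    exact ⟨𝒯.isCell this.1, this.2, (𝒯.isCell this.1).size_pos hd, hreg T this.1⟩
  obtain ⟨T₀, hT₀, hmin⟩ := Finset.exists_min_image _ size hne
  set ε := size T₀ with hε
  have hε0 : 0 < ε := (hcell T₀ hT₀).2.2.1
  set V := volume.real (Metric.ball (0 : E d) 1)
  have hV : 0 < V := volume_real_unitBall_pos
  -- Each cell is shrunk towards z until its size is that of the smallest one. The copies are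
  -- essentially disjoint and lie in a ball of radius ε, and each has volume at least that of a ball
  -- of radius ε/(2σ). Comparability of the sizes is not needed for this count.
  set S : Finset (E d) → Set (E d) := fun T => AffineMap.homothety z (ε / size T) '' simplex T
  have hs : ∀ T ∈ 𝒯.star z, 0 < ε / size T ∧ ε / size T ≤ 1 := fun T hT => by
    have := (hcell T hT).2.2.1
    exact ⟨by positivity, (div_le_one this).2 (hmin T hT)⟩
  have hsub : ∀ T ∈ 𝒯.star z, S T ⊆ simplex T := fun T hT =>
    IsCell.homothety_subset (hcell T hT).2.1 (hs T hT).1.le (hs T hT).2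
  have hmeas : ∀ T, MeasurableSet (S T) := fun T =>
    (isCompact_simplex.image (AffineMap.homothety_continuous z _)).measurableSet
  have hball : (⋃ T ∈ 𝒯.star z, S T) ⊆ Metric.closedBall z ε := by
    intro x hx
    simp only [Set.mem_iUnion] at hx
    obtain ⟨T, hT, y, hy, rfl⟩ := hx
    obtain ⟨h1, h2, h3, -⟩ := hcell T hT
    rw [homothety_eq, mem_closedBall_iff_norm, add_sub_cancel_left, norm_smul, Real.norm_eq_abs,
      abs_of_pos (hs T hT).1]
    calc ε / size T * ‖y - z‖ ≤ ε / size T * size T := by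
          have := (hs T hT).1
          gcongr
          exact norm_sub_le_size hy (mem_simplex_of_mem h2)
      _ = ε := by field_simp
  have hvol : ∀ T ∈ 𝒯.star z, (ε / (2 * σ)) ^ d * V ≤ volume.real (S T) := by
    intro T hT
    obtain ⟨h1, h2, h3, c, r, hr, hcr, hsr⟩ := hcell T hT
    rw [volume_real_homothety z (hs T hT).1]
    have h4 : r ^ d * V ≤ volume.real (simplex T) := by
      rw [← volume_real_closedBall c hr.le]
      exact measureReal_mono hcr isCompact_simplex.measure_ne_top
    have h5 : ε / (2 * σ) ≤ ε / size T * r := by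
      rw [div_mul_eq_mul_div, div_le_div_iff₀ (by positivity) h3]
      nlinarith
    calc (ε / (2 * σ)) ^ d * V ≤ (ε / size T * r) ^ d * V := by gcongr
      _ = (ε / size T) ^ d * (r ^ d * V) := by ring
      _ ≤ _ := by have := (hs T hT).1; gcongr
  have hsum : ∑ T ∈ 𝒯.star z, volume.real (S T) ≤ ε ^ d * V := by
    rw [← measureReal_biUnion_finset₀ ?_ ?_ ?_]
    · rw [← volume_real_closedBall z hε0.le]
      exact measureReal_mono hball measure_closedBall_lt_top.ne
    · intro T hT T' hT' hne'
      exact (𝒯.aedisjoint (𝒯.mem_star.1 hT).1 (𝒯.mem_star.1 hT').1 hne').mono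
        (hsub T hT) (hsub T' hT')
    · exact fun T _ => (hmeas T).nullMeasurableSet
    · exact fun T _ => (isCompact_simplex.image (AffineMap.homothety_continuous z _)).measure_ne_top
  have h6 := (Finset.sum_le_sum hvol).trans hsum
  rw [Finset.sum_const, nsmul_eq_mul, div_pow] at h6
  have h7 : ((𝒯.star z).card : ℝ) * (ε ^ d * V) ≤ (2 * σ) ^ d * (ε ^ d * V) := by
    have h8 : (0 : ℝ) < (2 * σ) ^ d := by positivity
    have := mul_le_mul_of_nonneg_left h6 h8.le
    calc _ = (2 * σ) ^ d * ((𝒯.star z).card * (ε ^ d / (2 * σ) ^ d * V)) := by field_simp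
      _ ≤ _ := this
  exact le_of_mul_le_mul_right h7 (by positivity)

end Mesh

end

/-! ### Neighbouring cells -/

section

variable {d : ℕ} {Ω : Set (E d)} {T T' T'' : Finset (E d)} {z z' : E d}

/-- Moving inwards from a point in the relative interior of a face. -/
lemma IsCell.eventually_mem_interior (hT : IsCell T) {q u : E d}
    (hq : ∀ v ∈ T, v ≠ z → 0 < lam T v q) (hqz : lam T z q = 0)
    (hu : 0 < inner ℝ (agrad (lam T z)) u) :
    ∀ᶠ t : ℝ in 𝓝[>] 0, q + t • u ∈ interior (simplex T) := by
  simp only [hT.mem_interior]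
  rw [Filter.eventually_all_finset]
  intro v hv
  by_cases hvz : v = z
  · subst hvz
    filter_upwards [self_mem_nhdsWithin] with t (ht : 0 < t)
    rw [affine_eq _ (q + t • u) q, hqz, add_sub_cancel_left, inner_smul_right]
    positivity
  · have hc : Continuous fun t : ℝ => lam T v (q + t • u) :=
      (continuous_affine _).comp (by fun_prop)
    have h0 : 0 < lam T v (q + (0 : ℝ) • u) := by simpa using hq v hv hvz
    exact nhdsWithin_le_nhds ((hc.tendsto 0).eventually (lt_mem_nhds h0))

namespace Mesh
variable (𝒯 : Mesh Ω)

lemma mem_sideNeighbours : T' ∈ sideNeighbours 𝒯 T ↔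
    T' ∈ 𝒯.cells ∧ open Classical in (T ∩ T').card = d := by
  simp [sideNeighbours]

/-- Opposite vertices of two neighbours. -/
lemma exists_opposite (hT : T ∈ 𝒯.cells) (hT' : T' ∈ 𝒯.cells)
    (h : open Classical in (T ∩ T').card = d) : ∃ z ∈ T, ∃ z' ∈ T', z ∉ T' ∧ z' ∉ T ∧
      (open Classical in T.erase z = T ∩ T') ∧ (open Classical in T'.erase z' = T ∩ T') := by
  classical
  have key : ∀ A B : Finset (E d), A.card = d + 1 → (A ∩ B).card = d →
      ∃ z ∈ A, z ∉ B ∧ A.erase z = A ∩ B := by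
    intro A B hA hAB
    have h1 : (A \ B).card = 1 := by
      have := Finset.card_sdiff_add_card_inter A B
      omega
    obtain ⟨z, hz⟩ := Finset.card_eq_one.1 h1
    have hzm : z ∈ A \ B := by rw [hz]; simp
    rw [Finset.mem_sdiff] at hzm
    refine ⟨z, hzm.1, hzm.2, ?_⟩
    ext x
    simp only [Finset.mem_erase, Finset.mem_inter]
    constructor
    · rintro ⟨hx, hxA⟩
      refine ⟨hxA, ?_⟩
      by_contra hxB
      have : x ∈ A \ B := Finset.mem_sdiff.2 ⟨hxA, hxB⟩
      rw [hz] at this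
      exact hx (by simpa using this)
    · rintro ⟨hxA, hxB⟩
      exact ⟨fun hh => hzm.2 (hh ▸ hxB), hxA⟩
  obtain ⟨z, hz, hzB, he⟩ := key T T' (𝒯.card_eq T hT) (by convert h)
  obtain ⟨z', hz', hzB', he'⟩ := key T' T (𝒯.card_eq T' hT') (by rw [Finset.inter_comm]; convert h)
  refine ⟨z, hz, z', hz', hzB, hzB', ?_, ?_⟩
  · convert he
  · rw [Finset.inter_comm T T']; convert he'

lemma _root_.SemilinearOCP.IsCell.exists_face_point (hd : 1 ≤ d) (hT : IsCell T) (hz : z ∈ T) :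
    ∃ q, lam T z q = 0 ∧ ∀ v ∈ T, v ≠ z → 0 < lam T v q := by
  classical
  have hd' : (0 : ℝ) < d := by exact_mod_cast hd
  have hcard : (T.card : ℝ) = d + 1 := by rw [hT.card_eq]; push_cast; ring
  -- The barycentre of the opposite face: the ray from z through the barycentre of T, where the
  -- coordinate of z is 1/(d + 1), is continued until this coordinate vanishes.
  refine ⟨z + ((d + 1 : ℝ) / d) • (barycentre T - z), ?_, fun v hv hvz => ?_⟩
  · rw [hT.lam_dilate_self hz, hT.barycentre_lam hz, hcard]
    field_simp; ring
  · rw [hT.lam_dilate hz hv hvz, hT.barycentre_lam hv, hcard]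
    positivity

/-- There is at most one cell on the other side of a face. -/
lemma neighbour_unique (hd : 1 ≤ d) (hT : T ∈ 𝒯.cells) (hz : z ∈ T)
    (hT' : T' ∈ sideNeighbours 𝒯 T) (hT'' : T'' ∈ sideNeighbours 𝒯 T) (h' : z ∉ T')
    (h'' : z ∉ T'') :
    T' = T'' := by
  classical
  have hc := 𝒯.isCell hT
  obtain ⟨q, hq0, hq⟩ := hc.exists_face_point hd hz
  set n := agrad (lam T z)
  have hn : 0 < inner ℝ n n := by
    rw [real_inner_self_eq_norm_sq]; have := hc.agrad_pos hd hz; positivity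
  have hT0 := hc.eventually_mem_interior hq hq0 hn
  -- Starting in the relative interior of the face and moving against ∇λ_z, one enters the interior
  -- of any neighbour across it. Two such neighbours then share an interior point.
  have key : ∀ {S}, S ∈ sideNeighbours 𝒯 T → z ∉ S →
      ∀ᶠ t : ℝ in 𝓝[>] 0, q + t • (-n) ∈ interior (simplex S) := by
    intro S hS hzS
    rw [mem_sideNeighbours] at hS
    obtain ⟨y, hy, w, hw, hyS, hwT, he, he'⟩ := 𝒯.exists_opposite hT hS.1 hS.2
    have hyz : z = y := by
      by_contra hne
      have : z ∈ T.erase y := Finset.mem_erase.2 ⟨hne, hz⟩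
      rw [show T.erase y = T ∩ S by convert he] at this
      exact hzS (Finset.mem_inter.1 this).2
    subst hyz
    have hcS := 𝒯.isCell hS.1
    have hF : T.erase z = S.erase w := by
      rw [show T.erase z = T ∩ S by convert he, show S.erase w = T ∩ S by convert he']
    have hlam := hc.lam_eq_mul hcS hz hw hF
    have hκ := hc.lam_opposite_ne_zero hcS hz hw hF
    have hgrad := hc.agrad_eq_smul hcS hz hw hF
    have hqw : lam S w q = 0 := by
      have := hlam q
      rw [hq0] at this
      exact ((mul_eq_zero.1 this.symm).resolve_left hκ)
    have hqS : ∀ v ∈ S, v ≠ w → 0 < lam S v q := by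
      intro v hv hvw
      have hvT : v ∈ T.erase z := hF ▸ Finset.mem_erase.2 ⟨hvw, hv⟩
      rw [Finset.mem_erase] at hvT
      have hqT : q ∈ simplex T := by
        rw [hc.mem_simplex]
        intro y hy
        by_cases hyz : y = z
        · rw [hyz, hq0]
        · exact (hq y hy hyz).le
      have hqS : q ∈ simplex S := by
        have h1 : q ∈ convexHull ℝ ((T : Set (E d)) ∩ S) := by
          rw [hc.mem_convexHull_face Set.inter_subset_left]
          refine ⟨hqT, fun y hy hyn => ?_⟩
          by_cases hyz : y = z
          · rw [hyz, hq0]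
          · exfalso
            have : y ∈ T ∩ S := by
              rw [← show T.erase z = T ∩ S by convert he]; exact Finset.mem_erase.2 ⟨hyz, hy⟩
            rw [Finset.mem_inter] at this
            exact hyn this
        exact convexHull_mono Set.inter_subset_right h1
      rw [← 𝒯.lam_eq_lam hT hS.1 hqT hqS hvT.2 hv]
      exact hq v hvT.2 hvT.1
    rcases lt_or_gt_of_ne hκ with hneg | hpos
    · apply hcS.eventually_mem_interior hqS hqw
      have h2 : n = lam T z w • agrad (lam S w) := hgrad
      have h3 : 0 < ‖agrad (lam S w)‖ := hcS.agrad_pos hd hw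
      rw [h2, ← neg_smul, inner_smul_right, real_inner_self_eq_norm_sq]
      have : 0 < -lam T z w := by linarith
      positivity
    -- A positive coordinate of w would put T and S on the same side of the face, and their
    -- interiors would overlap.
    · exfalso
      have hpos' : 0 < inner ℝ (agrad (lam S w)) n := by
        have h2 : n = lam T z w • agrad (lam S w) := hgrad
        have h3 : 0 < ‖agrad (lam S w)‖ := hcS.agrad_pos hd hw
        rw [h2, inner_smul_right, real_inner_self_eq_norm_sq]
        have : 0 < lam T z w := hpos
        positivity
      have h3 := hcS.eventually_mem_interior hqS hqw hpos'
      obtain ⟨t, h4, h5⟩ := (hT0.and h3).exists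
      exact hzS ((𝒯.eq_of_mem_interior hT hS.1 h4 (_root_.interior_subset h5)) ▸ hz)
  obtain ⟨t, h4, h5⟩ := ((key hT' h').and (key hT'' h'')).exists
  exact 𝒯.eq_of_mem_interior ((𝒯.mem_sideNeighbours).1 hT').1 ((𝒯.mem_sideNeighbours).1 hT'').1 h4
    (_root_.interior_subset h5)

/-- A face without a neighbour lies on the boundary. -/
lemma notMem_of_no_neighbour (hd : 1 ≤ d) (hΩ : IsLipschitzDomain Ω) (hT : T ∈ 𝒯.cells) (hz : z ∈ T)
    (hno : ∀ T' ∈ sideNeighbours 𝒯 T, z ∈ T') {x : E d} (hx : x ∈ simplex T)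
    (hxz : lam T z x = 0) : x ∉ Ω := by
  classical
  intro hxΩ
  have hc := 𝒯.isCell hT
  obtain ⟨q, hq0, hq⟩ := hc.exists_face_point hd hz
  set n := agrad (lam T z)
  have hn : 0 < inner ℝ n n := by
    rw [real_inner_self_eq_norm_sq]; have := hc.agrad_pos hd hz; positivity
  -- Since Ω is open, x may be moved slightly towards the relative interior of the face without
  -- leaving Ω.
  obtain ⟨y, hyΩ, hy0, hy⟩ : ∃ y ∈ Ω, lam T z y = 0 ∧ ∀ v ∈ T, v ≠ z → 0 < lam T v y := by
    have hcont : Continuous fun t : ℝ => x + t • (q - x) := by fun_prop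
    have h1 : ∀ᶠ t : ℝ in 𝓝[>] 0, x + t • (q - x) ∈ Ω := by
      apply nhdsWithin_le_nhds
      have := (hcont.tendsto 0).eventually (hΩ.isOpen.mem_nhds (by simpa using hxΩ))
      exact this
    obtain ⟨t, ht, ht0, ht1⟩ := (h1.and (Ioo_mem_nhdsGT (show (0 : ℝ) < 1 by norm_num))).exists
    refine ⟨_, ht, ?_, fun v hv hvz => ?_⟩
    · rw [lam_lineMap, hxz, hq0]; ring
    · rw [lam_lineMap]
      have h2 := hq v hv hvz
      have h3 := hc.mem_simplex.1 hx v hv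
      have : 0 < t * lam T v q := by positivity
      nlinarith
  have hyT : y ∈ simplex T := by
    rw [hc.mem_simplex]
    intro v hv
    by_cases hvz : v = z
    · rw [hvz, hy0]
    · exact (hy v hv hvz).le
  obtain ⟨r, hr, hball⟩ := 𝒯.exists_ball_disjoint y
  have hcont : Continuous fun t : ℝ => y + t • (-n) := by fun_prop
  have h1 : ∀ᶠ t : ℝ in 𝓝[>] 0, y + t • (-n) ∈ Ω ∩ Metric.ball y r := by
    apply nhdsWithin_le_nhds
    have := (hcont.tendsto 0).eventually
      ((hΩ.isOpen.inter (Metric.isOpen_ball (x := y) (ε := r))).mem_nhds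
        (x := y + (0 : ℝ) • (-n)) (by simpa [hyΩ] using hr))
    exact this
  obtain ⟨t, ⟨htΩ, htb⟩, ht0⟩ := (h1.and self_mem_nhdsWithin).exists
  -- A cell just beyond the face also contains y. As y has positive coordinates at all vertices of
  -- the face, S contains all of these, so S is a neighbour; by assumption it would also contain z
  -- and thus equal T.
  obtain ⟨S, hS, htS⟩ := 𝒯.exists_cell (subset_closure htΩ)
  have hyS : y ∈ simplex S := by
    by_contra hyS
    exact hball S hS hyS _ htb htS
  have htT : y + t • (-n) ∉ simplex T := by
    rw [hc.mem_simplex]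
    intro h
    have h2 := h z hz
    rw [affine_eq _ _ y, hy0, add_sub_cancel_left, inner_smul_right, inner_neg_right] at h2
    have h3 : 0 < t * inner ℝ n n := mul_pos ht0 hn
    change 0 ≤ 0 + t * -(inner ℝ n n) at h2
    linarith
  have hne : T ≠ S := fun h => htT (h ▸ htS)
  have hsub : T.erase z ⊆ T ∩ S := by
    intro v hv
    rw [Finset.mem_erase] at hv
    rw [Finset.mem_inter]
    refine ⟨hv.2, ?_⟩
    by_contra hvS
    exact (hy v hv.2 hv.1).ne' (𝒯.lam_eq_zero hT hS hyT hyS hv.2 hvS)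
  have hcard : (T ∩ S).card = d := by
    have h2 := Finset.card_le_card hsub
    rw [Finset.card_erase_of_mem hz, hc.card_eq] at h2
    obtain ⟨v, hv, hvS⟩ := hc.exists_mem_notMem (𝒯.isCell hS) hne
    have h3 : T ∩ S ⊂ T := by
      refine Finset.ssubset_iff_subset_ne.2 ⟨Finset.inter_subset_left, fun h => hvS ?_⟩
      rw [← h] at hv
      exact (Finset.mem_inter.1 hv).2
    have h4 := Finset.card_lt_card h3
    rw [hc.card_eq] at h4
    omega
  have hzS := hno S ((𝒯.mem_sideNeighbours).2 ⟨hS, by convert hcard⟩)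
  have : T ⊆ T ∩ S := by
    intro v hv
    by_cases hvz : v = z
    · subst hvz; exact Finset.mem_inter.2 ⟨hv, hzS⟩
    · exact hsub (Finset.mem_erase.2 ⟨hvz, hv⟩)
  have := Finset.card_le_card this
  rw [hcard, hc.card_eq] at this
  omega

end Mesh

end

/-! ### Hat functions -/

section

variable {d : ℕ} {Ω : Set (E d)} {T T' : Finset (E d)} {z : E d}

/-- A function that is Lipschitz on each of finitely many closed sets is Lipschitz on the segments
covered by these sets. -/
lemma abs_sub_le_of_closed_cover {ι : Type*} {f : E d → ℝ} {L : ℝ} {C : ι → Set (E d)}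
    (s : Finset ι)
    (hC : ∀ i ∈ s, IsClosed (C i)) (hf : ∀ i ∈ s, ∀ x ∈ C i, ∀ y ∈ C i, |f x - f y| ≤ L * ‖x - y‖)
    (x y : E d) (hcov : ∀ t ∈ Set.Icc (0 : ℝ) 1, ∃ i ∈ s, x + t • (y - x) ∈ C i) :
    |f x - f y| ≤ L * ‖x - y‖ := by
  classical
  induction s using Finset.strongInduction generalizing x with
  | H s ih =>
    obtain ⟨i, hi, hxi⟩ := hcov 0 ⟨le_rfl, zero_le_one⟩
    rw [zero_smul, add_zero] at hxi
    have hcont : Continuous fun t : ℝ => x + t • (y - x) := by fun_prop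
    have hK : IsCompact (Set.Icc (0 : ℝ) 1 ∩ (fun t : ℝ => x + t • (y - x)) ⁻¹' C i) :=
      isCompact_Icc.inter_right ((hC i hi).preimage hcont)
    -- The last parameter at which the segment is in `C i`. Beyond it this set is never met again,
    -- so the induction hypothesis applies with one set less.
    obtain ⟨τ, ⟨hτ01, hτi⟩, hτmax⟩ := hK.exists_isGreatest
      ⟨0, ⟨le_rfl, zero_le_one⟩, by simpa using hxi⟩
    set y' := x + τ • (y - x) with hy'
    have h1 : |f x - f y'| ≤ L * ‖x - y'‖ := hf i hi x hxi y' hτi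
    have e1 : ‖x - y'‖ = τ * ‖x - y‖ := by
      rw [hy', show x - (x + τ • (y - x)) = τ • (x - y) by module, norm_smul, Real.norm_eq_abs,
        abs_of_nonneg hτ01.1]
    have e2 : ‖y' - y‖ = (1 - τ) * ‖x - y‖ := by
      rw [hy', show x + τ • (y - x) - y = (1 - τ) • (x - y) by module, norm_smul, Real.norm_eq_abs,
        abs_of_nonneg (by linarith [hτ01.2])]
    have h2 : |f y' - f y| ≤ L * ‖y' - y‖ := by
      rcases eq_or_lt_of_le hτ01.2 with h | h
      · have : y' = y := by rw [hy', h]; module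
        simp [this]
      · have hcov' : ∀ t ∈ Set.Ioc τ 1, ∃ j ∈ s.erase i, x + t • (y - x) ∈ C j := by
          intro t ht
          obtain ⟨j, hj, hxj⟩ := hcov t ⟨hτ01.1.trans ht.1.le, ht.2⟩
          refine ⟨j, Finset.mem_erase.2 ⟨?_, hj⟩, hxj⟩
          rintro rfl
          exact absurd (hτmax ⟨⟨hτ01.1.trans ht.1.le, ht.2⟩, hxj⟩) (not_le.2 ht.1)
        have hclosed : IsClosed (⋃ j ∈ s.erase i, (fun t : ℝ => x + t • (y - x)) ⁻¹' C j) :=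
          (s.erase i).finite_toSet.isClosed_biUnion fun j hj =>
            (hC j (Finset.mem_of_mem_erase hj)).preimage hcont
        -- The remaining sets cover the half-open segment; being closed and finitely many, they also
        -- cover its end point at τ.
        have hsub : Set.Icc τ 1 ⊆ ⋃ j ∈ s.erase i, (fun t : ℝ => x + t • (y - x)) ⁻¹' C j := by
          rw [← closure_Ioc h.ne]
          apply closure_minimal _ hclosed
          intro t ht
          obtain ⟨j, hj, hxj⟩ := hcov' t ht
          exact Set.mem_biUnion hj hxj
        apply ih (s.erase i) (Finset.erase_ssubset hi)
          (fun j hj => hC j (Finset.mem_of_mem_erase hj))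
              (fun j hj => hf j (Finset.mem_of_mem_erase hj))
        intro t ht
        have hmem : τ + t * (1 - τ) ∈ Set.Icc τ 1 := ⟨by nlinarith [ht.1], by nlinarith [ht.2]⟩
        have := hsub hmem
        simp only [Set.mem_iUnion] at this
        obtain ⟨j, hj, hxj⟩ := this
        refine ⟨j, hj, ?_⟩
        have e : y' + t • (y - y') = x + (τ + t * (1 - τ)) • (y - x) := by rw [hy']; module
        rw [e]; exact hxj
    calc |f x - f y| ≤ |f x - f y'| + |f y' - f y| := abs_sub_le _ _ _
      _ ≤ L * (τ * ‖x - y‖) + L * ((1 - τ) * ‖x - y‖) := by rw [← e1, ← e2]; gcongr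
      _ = L * ‖x - y‖ := by ring

/-- The cone spanned by the cell `T` at its vertex `z`. -/
def vertexCone (T : Finset (E d)) (z : E d) : Set (E d) := {y | ∀ v ∈ T, v ≠ z → 0 ≤ lam T v y}

lemma isClosed_vertexCone : IsClosed (vertexCone T z) := by
  simp only [vertexCone, Set.ofPred_forall]
  refine isClosed_iInter fun v => isClosed_iInter fun _ => isClosed_iInter fun _ => ?_
  exact isClosed_le continuous_const (continuous_affine _)

lemma IsCell.simplex_subset_vertexCone (hT : IsCell T) : simplex T ⊆ vertexCone T z :=
  fun _ hx v hv _ => hT.mem_simplex.1 hx v hv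

lemma IsCell.mem_simplex_of_vertexCone (hT : IsCell T) {y : E d} (hy : y ∈ vertexCone T z)
    (h0 : 0 ≤ lam T z y) : y ∈ simplex T := by
  rw [hT.mem_simplex]
  intro v hv
  by_cases hvz : v = z
  · rwa [hvz]
  · exact hy v hv hvz

namespace Mesh
variable (𝒯 : Mesh Ω)

/-- Near z the cones coincide with the cells, where the coordinates agree by conformity. A dilation
towards z acts on both coordinates in the same affine way, so agreement there carries over to y. -/
lemma lam_eq_of_vertexCone (hT : T ∈ 𝒯.star z) (hT' : T' ∈ 𝒯.star z) {y : E d}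
    (hy : y ∈ vertexCone T z) (hy' : y ∈ vertexCone T' z) : lam T z y = lam T' z y := by
  rw [mem_star] at hT hT'
  set a := lam T z y
  set b := lam T' z y
  -- Small enough that both 1 + t(a − 1) and 1 + t(b − 1) are nonnegative, so the dilated point is
  -- in both cells.
  set t := (1 + |a| + |b|)⁻¹ with ht
  have ht0 : 0 < t := by positivity
  have ht1 : t * (1 + |a| + |b|) = 1 := inv_mul_cancel₀ (by positivity)
  have key : ∀ {T}, T ∈ 𝒯.cells ∧ z ∈ T → y ∈ vertexCone T z → 0 ≤ 1 + t * (lam T z y - 1) →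
      z + t • (y - z) ∈ simplex T := by
    intro T hT hy h0
    rw [(𝒯.isCell hT.1).mem_simplex]
    intro v hv
    by_cases hvz : v = z
    · rw [hvz, (𝒯.isCell hT.1).lam_dilate_self hT.2]; exact h0
    · rw [(𝒯.isCell hT.1).lam_dilate hT.2 hv hvz]
      have := hy v hv hvz
      positivity
  have h1 := key hT hy (by
    change 0 ≤ 1 + t * (a - 1)
    have : t * (-|a|) ≤ t * a := by gcongr; exact neg_abs_le a
    have : 0 ≤ t * |b| := by positivity
    nlinarith)
  have h2 := key hT' hy' (by
    change 0 ≤ 1 + t * (b - 1)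
    have : t * (-|b|) ≤ t * b := by gcongr; exact neg_abs_le b
    have : 0 ≤ t * |a| := by positivity
    nlinarith)
  have h3 := 𝒯.lam_eq_lam hT.1 hT'.1 h1 h2 hT.2 hT'.2
  rw [(𝒯.isCell hT.1).lam_dilate_self hT.2, (𝒯.isCell hT'.1).lam_dilate_self hT'.2] at h3
  have h4 : t * (a - b) = 0 := by
    change 1 + t * (a - 1) = 1 + t * (b - 1) at h3
    linarith
  exact sub_eq_zero.1 ((mul_eq_zero.1 h4).resolve_left ht0.ne')

/-- The cones at an interior vertex cover the space. -/
lemma exists_vertexCone (hΩ : IsLipschitzDomain Ω) (hz : z ∈ 𝒯.vertices) (hzΩ : z ∈ Ω) (y : E d) :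
    ∃ T ∈ 𝒯.star z, y ∈ vertexCone T z := by
  obtain ⟨r, hr, hstar⟩ := 𝒯.exists_ball_star hz
  have hcont : Continuous fun t : ℝ => z + t • (y - z) := by fun_prop
  have h1 : ∀ᶠ t : ℝ in 𝓝[>] 0, z + t • (y - z) ∈ Ω ∩ Metric.ball z r := by
    apply nhdsWithin_le_nhds
    have := (hcont.tendsto 0).eventually
      ((hΩ.isOpen.inter (Metric.isOpen_ball (x := z) (ε := r))).mem_nhds
        (x := z + (0 : ℝ) • (y - z)) (by simpa [hzΩ] using hr))
    exact this
  obtain ⟨t, ⟨htΩ, htb⟩, ht0⟩ := (h1.and self_mem_nhdsWithin).exists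
  obtain ⟨T, hT, htT⟩ := 𝒯.exists_cell (subset_closure htΩ)
  have hTs := hstar T hT _ htb htT
  refine ⟨T, hTs, fun v hv hvz => ?_⟩
  have h2 := (𝒯.isCell hT).mem_simplex.1 htT v hv
  rw [(𝒯.isCell hT).lam_dilate (𝒯.mem_star.1 hTs).2 hv hvz] at h2
  exact nonneg_of_mul_nonneg_right h2 ht0

open Classical in
/-- The piecewise linear function on the cones at `z` that extends the barycentric coordinates. -/
def coneFun (z y : E d) : ℝ :=
  if h : ∃ T ∈ 𝒯.star z, y ∈ vertexCone T z then lam h.choose z y else 0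

lemma coneFun_eq (hT : T ∈ 𝒯.star z) {y : E d} (hy : y ∈ vertexCone T z) :
    𝒯.coneFun z y = lam T z y := by
  have h : ∃ T ∈ 𝒯.star z, y ∈ vertexCone T z := ⟨T, hT, hy⟩
  rw [coneFun, dif_pos h]
  exact 𝒯.lam_eq_of_vertexCone h.choose_spec.1 hT h.choose_spec.2 hy

/-- The nodal basis function of an interior vertex `z`. -/
def hat (z y : E d) : ℝ := max (𝒯.coneFun z y) 0

lemma hat_nonneg (z y : E d) : 0 ≤ 𝒯.hat z y := le_max_right _ _

lemma hat_eq (hT : T ∈ 𝒯.star z) {x : E d} (hx : x ∈ simplex T) : 𝒯.hat z x = lam T z x := by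
  have hc := 𝒯.mem_star.1 hT
  rw [hat, 𝒯.coneFun_eq hT ((𝒯.isCell hc.1).simplex_subset_vertexCone hx)]
  exact max_eq_left ((𝒯.isCell hc.1).mem_simplex.1 hx z hc.2)

variable (hΩ : IsLipschitzDomain Ω) (hz : z ∈ 𝒯.vertices) (hzΩ : z ∈ Ω)
include hΩ hz hzΩ

/-- The cones are unbounded, but a point of a cone where the coordinate of z is positive lies in the
corresponding cell. Taking the positive part therefore confines the function to the cells around z,
and conformity makes it vanish on all others. -/
lemma hat_eq_zero (hT : T ∈ 𝒯.cells) (hzT : z ∉ T) {x : E d} (hx : x ∈ simplex T) :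
    𝒯.hat z x = 0 := by
  obtain ⟨S, hS, hxS⟩ := 𝒯.exists_vertexCone hΩ hz hzΩ x
  rw [hat, 𝒯.coneFun_eq hS hxS]
  apply max_eq_right
  by_contra! h
  have hc := 𝒯.mem_star.1 hS
  have hxS' := (𝒯.isCell hc.1).mem_simplex_of_vertexCone hxS h.le
  exact h.ne' (𝒯.lam_eq_zero hc.1 hT hxS' hx hc.2 hzT)

/-- At an interior vertex the cones cover the space, so every segment is covered by finitely many
closed sets on each of which the function is affine. -/
lemma exists_lipschitz_coneFun : ∃ L, LipschitzWith L (𝒯.coneFun z) := by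
  set L := ∑ T ∈ 𝒯.star z, ‖agrad (lam T z)‖ with hL
  have hL0 : 0 ≤ L := Finset.sum_nonneg fun _ _ => norm_nonneg _
  refine ⟨⟨L, hL0⟩, LipschitzWith.of_dist_le_mul fun x y => ?_⟩
  rw [Real.dist_eq, dist_eq_norm]
  apply abs_sub_le_of_closed_cover (𝒯.star z) (C := fun T => vertexCone T z)
  · exact fun _ _ => isClosed_vertexCone
  · intro T hT x hx y hy
    rw [𝒯.coneFun_eq hT hx, 𝒯.coneFun_eq hT hy, affine_eq (lam T z) x y, add_sub_cancel_left]
    refine (abs_real_inner_le_norm _ _).trans ?_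
    gcongr
    exact Finset.single_le_sum (f := fun T => ‖agrad (lam T z)‖) (fun _ _ => norm_nonneg _) hT
  · exact fun t _ => 𝒯.exists_vertexCone hΩ hz hzΩ _

lemma exists_lipschitz_hat : ∃ L, LipschitzWith L (𝒯.hat z) := by
  obtain ⟨L, hL⟩ := 𝒯.exists_lipschitz_coneFun hΩ hz hzΩ
  exact ⟨L, hL.max_const 0⟩

/-- The set where `coneFun` is positive is open and contained in the closure of Ω, hence in its
interior, which is Ω. -/
lemma hat_eq_zero_of_notMem {x : E d} (hx : x ∉ Ω) : 𝒯.hat z x = 0 := by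
  obtain ⟨L, hL⟩ := 𝒯.exists_lipschitz_coneFun hΩ hz hzΩ
  apply max_eq_right
  by_contra! h
  apply hx
  rw [← hΩ.interior_closure]
  apply interior_maximal _ (isOpen_lt continuous_const hL.continuous) h
  intro y (hy : 0 < 𝒯.coneFun z y)
  obtain ⟨S, hS, hyS⟩ := 𝒯.exists_vertexCone hΩ hz hzΩ y
  rw [𝒯.coneFun_eq hS hyS] at hy
  have hc := 𝒯.mem_star.1 hS
  exact 𝒯.simplex_subset hc.1 ((𝒯.isCell hc.1).mem_simplex_of_vertexCone hyS hy.le)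

end Mesh

end

/-! ### Approximation by test functions -/

section

open scoped ENNReal
variable {d : ℕ} {Ω : Set (E d)}

lemma eLpNorm_two_eq {α F : Type*} [MeasurableSpace α] [NormedAddCommGroup F] (f : α → F)
    (μ : Measure α) : eLpNorm f 2 μ = (∫⁻ x, ‖f x‖ₑ ^ 2 ∂μ) ^ (1 / 2 : ℝ) := by
  rw [eLpNorm_eq_lintegral_rpow_enorm_toReal (by norm_num) (by norm_num)]
  simp

lemma tendsto_eLpNorm_zero_of_bounded {α F : Type*} [MeasurableSpace α] [NormedAddCommGroup F]
    {μ : Measure α} [IsFiniteMeasure μ] {f : ℕ → α → F} (hm : ∀ n, AEStronglyMeasurable (f n) μ)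
    {K : ℝ} (hb : ∀ n, ∀ᵐ x ∂μ, ‖f n x‖ ≤ K) (h : ∀ᵐ x ∂μ, Tendsto (fun n => f n x) atTop (𝓝 0)) :
    Tendsto (fun n => eLpNorm (f n) 2 μ) atTop (𝓝 0) := by
  simp only [eLpNorm_two_eq]
  have h1 : Tendsto (fun n => ∫⁻ x, ‖f n x‖ₑ ^ 2 ∂μ) atTop (𝓝 (∫⁻ _, 0 ∂μ)) := by
    apply tendsto_lintegral_of_dominated_convergence' (fun _ => ENNReal.ofReal K ^ 2)
    · exact fun n => (hm n).enorm.pow_const 2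
    · intro n
      filter_upwards [hb n] with x hx
      gcongr
      rw [← ofReal_norm]
      exact ENNReal.ofReal_le_ofReal hx
    · rw [lintegral_const]
      exact ENNReal.mul_ne_top (by simp) (measure_ne_top μ _)
    · filter_upwards [h] with x hx
      have h2 := ((ENNReal.continuous_pow 2).tendsto _).comp hx.enorm
      simpa [Function.comp_def] using h2
  rw [lintegral_zero] at h1
  have h2 := h1.ennrpow_const (1 / 2 : ℝ)
  simpa using h2

/-- Test functions on `Ω`. -/
structure IsTest (Ω : Set (E d)) (φ : E d → ℝ) : Prop where
  contDiff : ContDiff ℝ ((⊤ : ℕ∞) : WithTop ℕ∞) φ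
  hasCompactSupport : HasCompactSupport φ
  tsupport_subset : tsupport φ ⊆ Ω

/-- Approximability in `H¹(Ω)` of `f`, with gradient `g`, by test functions. -/
def Approximable (Ω : Set (E d)) (f : E d → ℝ) (g : E d → E d) : Prop :=
  ∀ ε > (0 : ℝ≥0∞), ∃ φ, IsTest Ω φ ∧ eLpNorm (fun x => φ x - f x) 2 (volume.restrict Ω) ≤ ε ∧
    eLpNorm (fun x => gradient φ x - g x) 2 (volume.restrict Ω) ≤ ε

lemma gradient_eq_toDual_symm (f : E d → ℝ) :
    gradient f = fun x => (InnerProductSpace.toDual ℝ (E d)).symm (fderiv ℝ f x) := rfl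

lemma inner_gradient (f : E d → ℝ) (x v : E d) : inner ℝ (gradient f x) v = fderiv ℝ f x v := by
  simp [gradient]

lemma norm_gradient (f : E d → ℝ) (x : E d) : ‖gradient f x‖ = ‖fderiv ℝ f x‖ := by
  simp [gradient]

lemma continuous_gradient {f : E d → ℝ} (hf : ContDiff ℝ 1 f) : Continuous (gradient f) := by
  rw [gradient_eq_toDual_symm]
  exact (LinearIsometryEquiv.continuous _).comp (hf.continuous_fderiv one_ne_zero)

lemma measurable_gradient (f : E d → ℝ) : Measurable (gradient f) := by
  rw [gradient_eq_toDual_symm]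
  exact (LinearIsometryEquiv.continuous _).measurable.comp (measurable_fderiv ℝ f)

lemma norm_gradient_le_of_lipschitz {f : E d → ℝ} {L : NNReal} (hf : LipschitzWith L f) (x : E d) :
    ‖gradient f x‖ ≤ L := by
  rw [norm_gradient]; exact norm_fderiv_le_of_lipschitz ℝ hf

namespace IsTest
variable {φ : E d → ℝ}

lemma contDiff_one (h : IsTest Ω φ) : ContDiff ℝ 1 φ := h.contDiff.of_le (by exact_mod_cast le_top)

lemma eq_zero (h : IsTest Ω φ) {x : E d} (hx : x ∉ Ω) : φ x = 0 :=
  image_eq_zero_of_notMem_tsupport fun hh => hx (h.tsupport_subset hh)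

lemma memLp (h : IsTest Ω φ) : MemLp φ 2 (volume.restrict Ω) :=
  (h.contDiff.continuous.memLp_of_hasCompactSupport h.hasCompactSupport).restrict _

lemma hasCompactSupport_gradient (h : IsTest Ω φ) : HasCompactSupport (gradient φ) := by
  rw [gradient_eq_toDual_symm]
  exact (h.hasCompactSupport.fderiv ℝ).comp_left (map_zero _)

lemma memLp_gradient (h : IsTest Ω φ) : MemLp (gradient φ) 2 (volume.restrict Ω) :=
  ((continuous_gradient h.contDiff_one).memLp_of_hasCompactSupport
      h.hasCompactSupport_gradient).restrict _

end IsTest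

/-- The directional derivatives of the mollification of a Lipschitz function. -/
lemma fderiv_mollify {f ψ : E d → ℝ} {L : NNReal} (hf : LipschitzWith L f)
    (hfc : HasCompactSupport f)
    (hψ : Continuous ψ) (hψc : HasCompactSupport ψ) {x : E d}
    (hd : DifferentiableAt ℝ (fun x => ∫ y, ψ (x - y) * f y) x) (v : E d) :
    fderiv ℝ (fun x => ∫ y, ψ (x - y) * f y) x v
      = inner ℝ (∫ y, ψ (x - y) • gradient f y) v := by
  have hψx : Continuous fun y => ψ (x - y) := by fun_prop
  have hψi : Integrable (fun y => ψ (x - y)) volume :=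
    (hψ.integrable_of_hasCompactSupport hψc).comp_sub_left x
  have h1 := hf.integral_inv_smul_sub_mul_tendsto_integral_lineDeriv_mul (μ := volume) hψi v
  have h2 : Tendsto (fun t : ℝ => t⁻¹ • ((∫ y, ψ (x + t • v - y) * f y) - ∫ y, ψ (x - y) * f y))
      (𝓝[>] 0) (𝓝 (fderiv ℝ (fun x => ∫ y, ψ (x - y) * f y) x v)) := by
    have h3 := (hd.hasFDerivAt.hasLineDerivAt v)
    have h4 := (hasDerivAt_iff_tendsto_slope_zero.1 h3).mono_left
      (nhdsWithin_mono (0 : ℝ) (s := Set.Ioi 0) fun t (ht : 0 < t) => ht.ne')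
    simpa using h4
  -- By translation invariance the difference quotient of the mollification becomes one of f, whose
  -- weak limit involves the derivatives of f that exist almost everywhere.
  have h5 : ∀ t : ℝ, ∫ y, (t⁻¹ • (f (y + t • v) - f y)) * ψ (x - y)
      = t⁻¹ • ((∫ y, ψ (x + t • v - y) * f y) - ∫ y, ψ (x - y) * f y) := by
    intro t
    have e1 : ∫ y, ψ (x + t • v - y) * f y = ∫ y, ψ (x - y) * f (y + t • v) := by
      rw [← integral_add_right_eq_self (fun y => ψ (x + t • v - y) * f y) (t • v)]
      congr 1; ext y; congr 2; abel
    have i1 : Integrable (fun y => ψ (x - y) * f (y + t • v)) := by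
      apply Continuous.integrable_of_hasCompactSupport
      · have := hf.continuous; fun_prop
      · exact HasCompactSupport.mul_left (hfc.comp_homeomorph (Homeomorph.addRight (t • v)))
    have i2 : Integrable (fun y => ψ (x - y) * f y) := by
      apply Continuous.integrable_of_hasCompactSupport
      · have := hf.continuous; fun_prop
      · exact HasCompactSupport.mul_left hfc
    rw [e1, ← integral_sub i1 i2, ← integral_smul]
    congr 1; ext y
    simp only [smul_eq_mul]; ring
  simp only [h5] at h1
  rw [tendsto_nhds_unique h2 h1]
  have hgi : Integrable (fun y => ψ (x - y) • gradient f y) := by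
    refine (hψi.norm.mul_const L).mono'
      (hψx.aestronglyMeasurable.smul (measurable_gradient f).aestronglyMeasurable)
          (.of_forall fun y => ?_)
    rw [norm_smul]
    gcongr
    exact norm_gradient_le_of_lipschitz hf y
  rw [real_inner_comm, ← integral_inner hgi]
  apply integral_congr_ae
  filter_upwards [hf.ae_differentiableAt] with y hy
  rw [hy.lineDeriv_eq_fderiv, inner_smul_right, real_inner_comm, inner_gradient, mul_comm]

/-- Lipschitz functions with compact support in `Ω` are in `H₀¹(Ω)`. -/
lemma approximable_of_hasCompactSupport (hΩo : IsOpen Ω) (hΩb : Bornology.IsBounded Ω) {f : E d → ℝ}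
    {L : NNReal} (hf : LipschitzWith L f) (hfc : HasCompactSupport f) (hfΩ : tsupport f ⊆ Ω) :
    Approximable Ω f (gradient f) := by
  have : IsFiniteMeasure (volume.restrict Ω) := ⟨by
    rw [Measure.restrict_apply_univ]; exact hΩb.measure_lt_top⟩
  -- The room between the support and the boundary; the mollification radii stay below δ.
  obtain ⟨δ, hδ, hδΩ⟩ := hfc.isCompact.exists_cthickening_subset_open hΩo hfΩ
  set r : ℕ → ℝ := fun n => δ / (n + 1) with hr
  have hr0 : ∀ n, 0 < r n := fun n => by positivity
  have hrδ : ∀ n, r n ≤ δ := fun n =>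
      div_le_self hδ.le (by linarith [(Nat.cast_nonneg n : (0 : ℝ) ≤ n)])
  have hrt : Tendsto r atTop (𝓝 0) := by
    have := (tendsto_one_div_add_atTop_nhds_zero_nat (𝕜 := ℝ)).const_mul δ
    simpa [hr, div_eq_mul_inv] using this
  let ψ : ℕ → ContDiffBump (0 : E d) := fun n =>
    { rIn := r n / 2, rOut := r n, rIn_pos := half_pos (hr0 n),
        rIn_lt_rOut := half_lt_self (hr0 n) }
  let φ : ℕ → E d → ℝ := fun n x => ∫ y, (ψ n).normed volume (x - y) * f y
  have hconv : ∀ n, φ n = MeasureTheory.convolution ((ψ n).normed volume) f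
      (ContinuousLinearMap.lsmul ℝ ℝ) volume := fun n => by
    ext x; rw [convolution_eq_swap]; rfl
  have hψcont : ∀ n, Continuous ((ψ n).normed volume) := fun n => (ψ n).continuous_normed
  have hψc : ∀ n, HasCompactSupport ((ψ n).normed volume) := fun n => (ψ n).hasCompactSupport_normed
  have hsmooth : ∀ n, ContDiff ℝ ((⊤ : ℕ∞) : WithTop ℕ∞) (φ n) := fun n => by
    rw [hconv]
    exact (hψc n).contDiff_convolution_left _ (ψ n).contDiff_normed hf.continuous.locallyIntegrable
  have hsupp : ∀ n, tsupport (φ n) ⊆ Metric.cthickening δ (tsupport f) := fun n => by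
    apply closure_minimal _ Metric.isClosed_cthickening
    rw [hconv]
    refine (support_convolution_subset _).trans ?_
    rw [(ψ n).support_normed_eq]
    rintro _ ⟨a, ha, b, hb, rfl⟩
    apply Metric.mem_cthickening_of_dist_le _ b _ _ (subset_tsupport f hb)
    rw [Metric.mem_ball, dist_zero_right] at ha
    rw [dist_eq_norm]
    simp only [add_sub_cancel_right]
    exact ha.le.trans (hrδ n)
  have htest : ∀ n, IsTest Ω (φ n) := fun n =>
    ⟨hsmooth n, hfc.isCompact.cthickening.of_isClosed_subset (isClosed_tsupport _) (hsupp n),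
      (hsupp n).trans hδΩ⟩
  have hgrad : ∀ n x, gradient (φ n) x = ∫ y, (ψ n).normed volume (x - y) • gradient f y := by
    intro n x
    apply ext_inner_right ℝ
    intro v
    rw [inner_gradient]
    exact fderiv_mollify hf hfc (hψcont n) (hψc n)
      ((hsmooth n).differentiable (by simp) x) v
  have hli : LocallyIntegrable (gradient f) volume := by
    have : MemLp (gradient f) ∞ volume := memLp_top_of_bound
      (measurable_gradient f).aestronglyMeasurable L (.of_forall (norm_gradient_le_of_lipschitz hf))
    exact this.locallyIntegrable le_top
  have hae : ∀ᵐ x ∂(volume.restrict Ω), Tendsto (fun n => gradient (φ n) x - gradient f x) atTop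
      (𝓝 0) := by
    apply ae_restrict_of_ae
    -- The gradient is merely bounded and measurable, so it converges only almost everywhere, by
    -- Lebesgue differentiation; the bound L then gives convergence in L². The value 2 is the ratio
    -- of the radii of the bumps.
    have h1 := ContDiffBump.ae_convolution_tendsto_right_of_locallyIntegrable (φ := ψ) (l := atTop)
      (K := 2) hrt (.of_forall fun n => by
        change r n ≤ 2 * (r n / 2); linarith) hli
    filter_upwards [h1] with x hx
    have h2 : ∀ n, gradient (φ n) x = MeasureTheory.convolution ((ψ n).normed volume) (gradient f)
      (ContinuousLinearMap.lsmul ℝ ℝ) volume x := fun n => by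
        rw [hgrad, convolution_eq_swap]; rfl
    simp only [h2]
    simpa using hx.sub_const (gradient f x)
  have hgb : ∀ n x, ‖gradient (φ n) x‖ ≤ L := by
    intro n x
    have hi : Integrable (fun y => (ψ n).normed volume (x - y)) :=
      ((hψcont n).integrable_of_hasCompactSupport (hψc n)).comp_sub_left x
    rw [hgrad]
    refine (norm_integral_le_of_norm_le (hi.mul_const L) (.of_forall fun y => ?_)).trans
        (le_of_eq ?_)
    · rw [norm_smul, Real.norm_eq_abs, abs_of_nonneg ((ψ n).nonneg_normed _)]
      gcongr
      · exact (ψ n).nonneg_normed _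
      · exact norm_gradient_le_of_lipschitz hf y
    · rw [integral_mul_const, integral_sub_left_eq_self (fun y => (ψ n).normed volume y) volume x,
        (ψ n).integral_normed, one_mul]
  have hd : ∀ n x, ‖φ n x - f x‖ ≤ L * r n := by
    intro n x
    rw [hconv, ← dist_eq_norm]
    apply ContDiffBump.dist_normed_convolution_le hf.continuous.aestronglyMeasurable
    intro y hy
    rw [Metric.mem_ball] at hy
    exact (hf.dist_le_mul y x).trans (by gcongr)
  have t1 : Tendsto (fun n => eLpNorm (fun x => φ n x - f x) 2 (volume.restrict Ω)) atTop
      (𝓝 0) := by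
    apply tendsto_eLpNorm_zero_of_bounded (K := L * δ)
    · exact fun n => ((hsmooth n).continuous.sub hf.continuous).aestronglyMeasurable
    · exact fun n => .of_forall fun x => (hd n x).trans (by gcongr; exact hrδ n)
    · refine .of_forall fun x => squeeze_zero_norm (hd · x) ?_
      simpa using hrt.const_mul (L : ℝ)
  have t2 : Tendsto (fun n => eLpNorm (fun x => gradient (φ n) x - gradient f x) 2
      (volume.restrict Ω)) atTop (𝓝 0) := by
    apply tendsto_eLpNorm_zero_of_bounded (K := L + L)
    · exact fun n => ((measurable_gradient _).sub (measurable_gradient f)).aestronglyMeasurable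
    · exact fun n => .of_forall fun x => (norm_sub_le _ _).trans
        (add_le_add (hgb n x) (norm_gradient_le_of_lipschitz hf x))
    · exact hae
  intro ε hε
  obtain ⟨n, h1, h2⟩ := ((t1.eventually_le_const hε).and (t2.eventually_le_const hε)).exists
  exact ⟨φ n, htest n, h1, h2⟩

lemma Approximable.trans {f : E d → ℝ} {g : E d → E d} {F : ℕ → E d → ℝ} {G : ℕ → E d → E d}
    (h : ∀ n, Approximable Ω (F n) (G n))
    (hF : ∀ n, AEStronglyMeasurable (F n) (volume.restrict Ω))
    (hG : ∀ n, AEStronglyMeasurable (G n) (volume.restrict Ω))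
    (hf : AEStronglyMeasurable f (volume.restrict Ω))
    (hg : AEStronglyMeasurable g (volume.restrict Ω))
    (t1 : Tendsto (fun n => eLpNorm (fun x => F n x - f x) 2 (volume.restrict Ω)) atTop (𝓝 0))
    (t2 : Tendsto (fun n => eLpNorm (fun x => G n x - g x) 2 (volume.restrict Ω)) atTop (𝓝 0)) :
    Approximable Ω f g := by
  intro ε hε
  have hε2 : 0 < ε / 2 := ENNReal.half_pos hε.ne'
  obtain ⟨n, h1, h2⟩ := ((t1.eventually_le_const hε2).and (t2.eventually_le_const hε2)).exists
  obtain ⟨φ, hφ, h3, h4⟩ := h n (ε / 2) hε2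
  refine ⟨φ, hφ, ?_, ?_⟩
  · have : (fun x => φ x - f x) = (fun x => φ x - F n x) + fun x => F n x - f x := by
      ext x; simp
    rw [this, ← ENNReal.add_halves ε]
    exact (eLpNorm_add_le (hφ.memLp.1.sub (hF n)) ((hF n).sub hf) (by norm_num)).trans
      (add_le_add h3 h1)
  · have : (fun x => gradient φ x - g x) = (fun x => gradient φ x - G n x) + fun x =>
        G n x - g x := by
      ext1 x; simp
    rw [this, ← ENNReal.add_halves ε]
    exact (eLpNorm_add_le (hφ.memLp_gradient.1.sub (hG n)) ((hG n).sub hg) (by norm_num)).trans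
      (add_le_add h4 h2)

/-- Nonnegative Lipschitz functions that vanish outside of `Ω` are in `H₀¹(Ω)`. -/
lemma approximable_of_nonneg (hΩo : IsOpen Ω) (hΩb : Bornology.IsBounded Ω) {f : E d → ℝ}
    {L : NNReal} (hf : LipschitzWith L f) (hf0 : ∀ x, 0 ≤ f x) (hfΩ : ∀ x, x ∉ Ω → f x = 0) :
    Approximable Ω f (gradient f) := by
  have : IsFiniteMeasure (volume.restrict Ω) := ⟨by
    rw [Measure.restrict_apply_univ]; exact hΩb.measure_lt_top⟩
  set ε : ℕ → ℝ := fun n => 1 / ((n : ℝ) + 1) with hε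
  have hε0 : ∀ n, 0 < ε n := fun n => by positivity
  have hε1 : ∀ n, ε n ≤ 1 := fun n => by
    rw [hε]; exact div_le_one_of_le₀ (by linarith [(Nat.cast_nonneg n : (0 : ℝ) ≤ n)])
        (by positivity)
  have hεt : Tendsto ε atTop (𝓝 0) := tendsto_one_div_add_atTop_nhds_zero_nat
  -- f ≥ ε on the support of the truncation, so this support stays inside Ω and is compact.
  let F : ℕ → E d → ℝ := fun n x => max (f x - ε n) 0
  have hFL : ∀ n, LipschitzWith L (F n) := fun n => by
    have : LipschitzWith L fun x => f x - ε n := by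
      simpa using hf.sub (LipschitzWith.const (ε n))
    exact this.max_const 0
  have hts : ∀ n, tsupport (F n) ⊆ {x | ε n ≤ f x} := fun n => by
    apply closure_minimal _ (isClosed_le continuous_const hf.continuous)
    intro x hx
    by_contra h
    rw [Set.mem_ofPred_eq, not_le] at h
    exact hx (max_eq_right (by linarith))
  have htΩ : ∀ n, tsupport (F n) ⊆ Ω := fun n x hx => by
    by_contra h
    have := hts n hx
    rw [Set.mem_ofPred_eq, hfΩ x h] at this
    linarith [hε0 n]
  have hFc : ∀ n, HasCompactSupport (F n) := fun n =>
    hΩb.isCompact_closure.of_isClosed_subset (isClosed_tsupport _) ((htΩ n).trans subset_closure)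
  -- Convergence holds at every point. Where f vanishes, both f and its truncations have a minimum,
  -- here because f ≥ 0, so the gradients are 0 even without differentiability; where f > 0, the
  -- truncation eventually differs from f by a constant nearby.
  have key : ∀ x, Tendsto (fun n => gradient (F n) x - gradient f x) atTop (𝓝 0) := by
    intro x
    rcases (hf0 x).eq_or_lt with h | h
    · have g1 : gradient f x = 0 := by
        have : IsLocalMin f x := .of_forall fun y => by rw [← h]; exact hf0 y
        rw [gradient_eq_toDual_symm]; simp [this.fderiv_eq_zero]
      have g2 : ∀ n, gradient (F n) x = 0 := fun n => by
        have : IsLocalMin (F n) x := .of_forall fun y => by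
          have : F n x = 0 := max_eq_right (by rw [← h]; linarith [hε0 n])
          rw [this]; exact le_max_right _ _
        rw [gradient_eq_toDual_symm]; simp [this.fderiv_eq_zero]
      simp [g1, g2]
    · have : ∀ᶠ n in atTop, gradient (F n) x - gradient f x = 0 := by
        filter_upwards [hεt.eventually_lt_const h] with n hn
        have heq : F n =ᶠ[𝓝 x] fun y => f y - ε n := by
          filter_upwards [(hf.continuous.tendsto x).eventually_const_lt hn] with y hy
          exact max_eq_left (by linarith)
        rw [gradient_eq_toDual_symm, gradient_eq_toDual_symm]
        simp only [heq.fderiv_eq]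
        rw [fderiv_sub_const, sub_self]
      exact tendsto_const_nhds.congr' (this.mono fun n hn => hn.symm)
  refine Approximable.trans (F := F) (G := fun n => gradient (F n))
    (fun n => approximable_of_hasCompactSupport hΩo hΩb (hFL n) (hFc n) (htΩ n))
    (fun n => (hFL n).continuous.aestronglyMeasurable)
    (fun n => (measurable_gradient _).aestronglyMeasurable) hf.continuous.aestronglyMeasurable
    (measurable_gradient _).aestronglyMeasurable ?_ ?_
  · have hd : ∀ n x, ‖F n x - f x‖ ≤ ε n := fun n x => by
      rw [Real.norm_eq_abs, abs_le]
      have := hf0 x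
      have := hε0 n
      constructor
      · have : f x - ε n ≤ F n x := le_max_left _ _
        linarith
      · have : F n x ≤ f x + ε n := max_le (by linarith) (by linarith)
        linarith
    apply tendsto_eLpNorm_zero_of_bounded (K := 1)
    · exact fun n => ((hFL n).continuous.sub hf.continuous).aestronglyMeasurable
    · exact fun n => .of_forall fun x => (hd n x).trans (hε1 n)
    · exact .of_forall fun x => squeeze_zero_norm (hd · x) hεt
  · apply tendsto_eLpNorm_zero_of_bounded (K := L + L)
    · exact fun n => ((measurable_gradient _).sub (measurable_gradient f)).aestronglyMeasurable
    · exact fun n => .of_forall fun x => (norm_sub_le _ _).trans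
        (add_le_add (norm_gradient_le_of_lipschitz (hFL n) x) (norm_gradient_le_of_lipschitz hf x))
    · exact .of_forall key

lemma Approximable.add_smul {f f' : E d → ℝ} {g g' : E d → E d} (h : Approximable Ω f g)
    (h' : Approximable Ω f' g') (hf : AEStronglyMeasurable f (volume.restrict Ω))
    (hg : AEStronglyMeasurable g (volume.restrict Ω))
    (hf' : AEStronglyMeasurable f' (volume.restrict Ω))
    (hg' : AEStronglyMeasurable g' (volume.restrict Ω)) (c : ℝ) :
    Approximable Ω (fun x => f x + c * f' x) (fun x => g x + c • g' x) := by
  intro ε hε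
  have hε2 : 0 < ε / 2 := ENNReal.half_pos hε.ne'
  -- The added 1 covers the case c = 0.
  have hδ : 0 < ε / 2 / (‖c‖ₑ + 1) := ENNReal.div_pos hε2.ne' (by simp)
  obtain ⟨φ, hφ, h1, h2⟩ := h (ε / 2) hε2
  obtain ⟨φ', hφ', h1', h2'⟩ := h' _ hδ
  have hcδ : ‖c‖ₑ * (ε / 2 / (‖c‖ₑ + 1)) ≤ ε / 2 := by
    calc ‖c‖ₑ * (ε / 2 / (‖c‖ₑ + 1)) ≤ (‖c‖ₑ + 1) * (ε / 2 / (‖c‖ₑ + 1)) := by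
          gcongr; exact le_self_add
      _ = ε / 2 := ENNReal.mul_div_cancel (by simp) (by simp)
  refine ⟨fun x => φ x + c * φ' x, ⟨?_, ?_, ?_⟩, ?_, ?_⟩
  · exact hφ.contDiff.add (contDiff_const.mul hφ'.contDiff)
  · exact hφ.hasCompactSupport.add hφ'.hasCompactSupport.mul_left
  · refine (tsupport_add _ _).trans (Set.union_subset hφ.tsupport_subset ?_)
    exact (tsupport_mul_subset_right).trans hφ'.tsupport_subset
  · have : (fun x => φ x + c * φ' x - (f x + c * f' x))
        = (fun x => φ x - f x) + c • fun x => φ' x - f' x := by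
      ext x; simp; ring
    rw [this, ← ENNReal.add_halves ε]
    refine (eLpNorm_add_le (hφ.memLp.1.sub hf) ((hφ'.memLp.1.sub hf').const_smul c)
        (by norm_num)).trans
      (add_le_add h1 ?_)
    rw [eLpNorm_const_smul]
    exact (mul_le_mul_right (by exact h1') _).trans hcδ
  · have : (fun x => gradient (fun x => φ x + c * φ' x) x - (g x + c • g' x))
        = (fun x => gradient φ x - g x) + c • fun x => gradient φ' x - g' x := by
      ext1 x
      have d1 := hφ.contDiff_one.differentiable one_ne_zero x
      have d2 := hφ'.contDiff_one.differentiable one_ne_zero x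
      have : gradient (fun x => φ x + c * φ' x) x = gradient φ x + c • gradient φ' x := by
        simp only [gradient]
        rw [fderiv_fun_add d1 (d2.const_mul c), fderiv_const_mul d2]
        simp
      rw [this]
      simp only [Pi.add_apply, Pi.smul_apply, smul_sub]
      abel
    rw [this, ← ENNReal.add_halves ε]
    refine (eLpNorm_add_le (hφ.memLp_gradient.1.sub hg)
        ((hφ'.memLp_gradient.1.sub hg').const_smul c)
      (by norm_num)).trans (add_le_add h2 ?_)
    rw [eLpNorm_const_smul]
    exact (mul_le_mul_right (by exact h2') _).trans hcδ

lemma Approximable.exists_seq {f : E d → ℝ} {g : E d → E d} (h : Approximable Ω f g) :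
    ∃ φ : ℕ → E d → ℝ, (∀ n, IsTest Ω (φ n)) ∧
      Tendsto (fun n => eLpNorm (fun x => φ n x - f x) 2 (volume.restrict Ω)) atTop (𝓝 0) ∧
      Tendsto (fun n => eLpNorm (fun x => gradient (φ n) x - g x) 2 (volume.restrict Ω)) atTop
          (𝓝 0) := by
  have ht : Tendsto (fun n : ℕ => ((n : ℝ≥0∞) + 1)⁻¹) atTop (𝓝 0) := by
    have := (tendsto_add_atTop_iff_nat 1).2 ENNReal.tendsto_inv_nat_nhds_zero
    simpa using this
  choose φ hφ h1 h2 using fun n : ℕ => h ((n : ℝ≥0∞) + 1)⁻¹ (by simp)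
  exact ⟨φ, hφ, tendsto_of_tendsto_of_tendsto_of_le_of_le tendsto_const_nhds ht
      (fun _ => zero_le) h1,
    tendsto_of_tendsto_of_tendsto_of_le_of_le tendsto_const_nhds ht (fun _ => zero_le) h2⟩

/-- The element of `H₀¹(Ω)` given by an approximable pair. -/
def Approximable.toH01 {f : E d → ℝ} {g : E d → E d} (h : Approximable Ω f g)
    (hf : MemLp f 2 (volume.restrict Ω)) (hg : MemLp g 2 (volume.restrict Ω)) : H01 Ω where
  toFun := f
  grad := g
  memLp := hf
  grad_memLp := hg
  approx := by
    obtain ⟨φ, hφ, h1, h2⟩ := h.exists_seq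
    exact ⟨φ, fun n => ⟨(hφ n).contDiff, (hφ n).hasCompactSupport, (hφ n).tsupport_subset⟩, h1, h2⟩

lemma H01.exists_seq (v : H01 Ω) :
    ∃ φ : ℕ → E d → ℝ, (∀ n, IsTest Ω (φ n)) ∧
      Tendsto (fun n => eLpNorm (fun x => φ n x - v.toFun x) 2 (volume.restrict Ω)) atTop (𝓝 0) ∧
      Tendsto (fun n => eLpNorm (fun x => gradient (φ n) x - v.grad x) 2 (volume.restrict Ω)) atTop
        (𝓝 0) := by
  obtain ⟨φ, hφ, h1, h2⟩ := v.approx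
  exact ⟨φ, fun n => ⟨(hφ n).1, (hφ n).2.1, (hφ n).2.2⟩, h1, h2⟩

lemma H01.approximable (v : H01 Ω) : Approximable Ω v.toFun v.grad := by
  obtain ⟨φ, hφ, t1, t2⟩ := v.exists_seq
  intro ε hε
  obtain ⟨n, h1, h2⟩ := ((t1.eventually_le_const hε).and (t2.eventually_le_const hε)).exists
  exact ⟨φ n, hφ n, h1, h2⟩

/-- `v + c w` in `H₀¹(Ω)`. -/
def H01.addSmul (v w : H01 Ω) (c : ℝ) : H01 Ω :=
  (v.approximable.add_smul w.approximable v.memLp.1 v.grad_memLp.1 w.memLp.1 w.grad_memLp.1 c).toH01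
    (v.memLp.add (w.memLp.const_mul c)) (v.grad_memLp.add (w.grad_memLp.const_smul c))

end

/-! ### Integrals of functions in `H₀¹` and the weak gradient of piecewise affine functions -/

section

open scoped ENNReal
variable {d : ℕ} {Ω : Set (E d)} {T : Finset (E d)}

/-! ### Cauchy–Schwarz and continuity of integral pairings in L². -/

section Hilbert
variable {α F : Type*} [MeasurableSpace α] {μ : Measure α} [NormedAddCommGroup F]
  [InnerProductSpace ℝ F]

lemma integrable_inner_of_memLp {h k : α → F} (hh : MemLp h 2 μ) (hk : MemLp k 2 μ) :
    Integrable (fun x => inner ℝ (h x) (k x)) μ := by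
  refine (L2.integrable_inner (𝕜 := ℝ) (hh.toLp h) (hk.toLp k)).congr ?_
  filter_upwards [hh.coeFn_toLp, hk.coeFn_toLp] with x h1 h2
  rw [h1, h2]

lemma abs_integral_inner_le {h k : α → F} (hh : MemLp h 2 μ) (hk : MemLp k 2 μ) :
    |∫ x, inner ℝ (h x) (k x) ∂μ| ≤ (eLpNorm h 2 μ).toReal * (eLpNorm k 2 μ).toReal := by
  have h1 := abs_real_inner_le_norm (hh.toLp h) (hk.toLp k)
  rw [L2.inner_def, Lp.norm_toLp, Lp.norm_toLp] at h1
  refine le_trans (le_of_eq ?_) h1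
  congr 1
  apply integral_congr_ae
  filter_upwards [hh.coeFn_toLp, hk.coeFn_toLp] with x h1 h2
  rw [h1, h2]

lemma tendsto_integral_inner {h k : α → F} {K : ℕ → α → F} (hh : MemLp h 2 μ) (hk : MemLp k 2 μ)
    (hK : ∀ n, MemLp (K n) 2 μ)
    (ht : Tendsto (fun n => eLpNorm (fun x => K n x - k x) 2 μ) atTop (𝓝 0)) :
    Tendsto (fun n => ∫ x, inner ℝ (h x) (K n x) ∂μ) atTop (𝓝 (∫ x, inner ℝ (h x) (k x) ∂μ)) := by
  rw [tendsto_iff_norm_sub_tendsto_zero]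
  have h1 : ∀ n, ‖(∫ x, inner ℝ (h x) (K n x) ∂μ) - ∫ x, inner ℝ (h x) (k x) ∂μ‖
      ≤ (eLpNorm h 2 μ).toReal * (eLpNorm (fun x => K n x - k x) 2 μ).toReal := by
    intro n
    rw [← integral_sub (integrable_inner_of_memLp hh (hK n)) (integrable_inner_of_memLp hh hk)]
    simp only [← inner_sub_right]
    exact abs_integral_inner_le hh ((hK n).sub hk)
  refine squeeze_zero (fun n => norm_nonneg _) h1 ?_
  have h2 := ((ENNReal.tendsto_toReal ENNReal.zero_ne_top).comp ht).const_mul (eLpNorm h 2 μ).toReal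
  simpa using h2

end Hilbert

lemma tendsto_eLpNorm_toReal {α F : Type*} [MeasurableSpace α] {μ : Measure α}
    [NormedAddCommGroup F] {k : α → F} {K : ℕ → α → F} (hk : MemLp k 2 μ)
    (hK : ∀ n, MemLp (K n) 2 μ)
    (ht : Tendsto (fun n => eLpNorm (fun x => K n x - k x) 2 μ) atTop (𝓝 0)) :
    Tendsto (fun n => (eLpNorm (K n) 2 μ).toReal) atTop (𝓝 (eLpNorm k 2 μ).toReal) := by
  have h1 : Tendsto (fun n => (hK n).toLp (K n)) atTop (𝓝 (hk.toLp k)) :=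
    (Lp.tendsto_Lp_iff_tendsto_eLpNorm'' K hK k hk).2 ht
  have h2 := h1.norm
  simpa only [Lp.norm_toLp] using h2

lemma integrable_mul_of_memLp {α : Type*} [MeasurableSpace α] {μ : Measure α} {h k : α → ℝ}
    (hh : MemLp h 2 μ) (hk : MemLp k 2 μ) : Integrable (fun x => h x * k x) μ :=
  hh.integrable_mul hk

lemma abs_integral_mul_le {α : Type*} [MeasurableSpace α] {μ : Measure α} {h k : α → ℝ}
    (hh : MemLp h 2 μ) (hk : MemLp k 2 μ) :
    |∫ x, h x * k x ∂μ| ≤ (eLpNorm h 2 μ).toReal * (eLpNorm k 2 μ).toReal := by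
  have := abs_integral_inner_le hh hk
  simpa [mul_comm] using this

lemma tendsto_integral_mul {α : Type*} [MeasurableSpace α] {μ : Measure α} {h k : α → ℝ}
    {K : ℕ → α → ℝ} (hh : MemLp h 2 μ) (hk : MemLp k 2 μ) (hK : ∀ n, MemLp (K n) 2 μ)
    (ht : Tendsto (fun n => eLpNorm (fun x => K n x - k x) 2 μ) atTop (𝓝 0)) :
    Tendsto (fun n => ∫ x, h x * K n x ∂μ) atTop (𝓝 (∫ x, h x * k x ∂μ)) := by
  have := tendsto_integral_inner hh hk hK ht
  simpa [mul_comm] using this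

/-- Integration by parts against a test function. -/
lemma H01.integral_grad_mul (v : H01 Ω) {ψ : E d → ℝ} (hψ : IsTest Ω ψ) (e : E d) :
    ∫ x in Ω, ψ x * inner ℝ e (v.grad x) = -∫ x in Ω, fderiv ℝ ψ x e * v.toFun x := by
  obtain ⟨φ, hφ, t1, t2⟩ := v.exists_seq
  have hd : ContDiff ℝ 1 (fun x => fderiv ℝ ψ x e) := by
    have : ContDiff ℝ 1 (fderiv ℝ ψ) := hψ.contDiff.fderiv_right (by
      have : ((2 : ℕ∞) : WithTop ℕ∞) ≤ ((⊤ : ℕ∞) : WithTop ℕ∞) := WithTop.coe_le_coe.2 le_top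
      exact one_add_one_eq_two.trans_le this)
    exact this.clm_apply contDiff_const
  have hdc : HasCompactSupport (fun x => fderiv ℝ ψ x e) :=
    (hψ.hasCompactSupport.fderiv ℝ).comp_left (g := fun l : E d →L[ℝ] ℝ => l e) (by simp)
  have m1 : MemLp (fun x => ψ x • e) 2 (volume.restrict Ω) := by
    refine (Continuous.memLp_of_hasCompactSupport ?_ ?_).restrict _
    · have := hψ.contDiff.continuous; fun_prop
    · exact hψ.hasCompactSupport.smul_right
  have m2 : MemLp (fun x => fderiv ℝ ψ x e) 2 (volume.restrict Ω) :=
    (hd.continuous.memLp_of_hasCompactSupport hdc).restrict _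
  have l1 := tendsto_integral_inner m1 v.grad_memLp (fun n => (hφ n).memLp_gradient) t2
  have l2 := (tendsto_integral_mul m2 v.memLp (fun n => (hφ n).memLp) t1).neg
  have heq : ∀ n, ∫ x in Ω, inner ℝ (ψ x • e) (gradient (φ n) x)
      = -∫ x in Ω, fderiv ℝ ψ x e * φ n x := by
    intro n
    have c1 := (hφ n).contDiff_one.continuous
    have c2 := (hφ n).contDiff_one.continuous_fderiv one_ne_zero
    have c3 := hψ.contDiff_one.continuous
    have e1 : ∀ x, inner ℝ (ψ x • e) (gradient (φ n) x) = ψ x * fderiv ℝ (φ n) x e := fun x => by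
      rw [real_inner_comm, inner_smul_right, inner_gradient]
    simp only [e1]
    rw [setIntegral_eq_integral_of_forall_compl_eq_zero
        (fun x hx => by rw [hψ.eq_zero hx, zero_mul]),
      setIntegral_eq_integral_of_forall_compl_eq_zero
        (fun x hx => by rw [(hφ n).eq_zero hx, mul_zero])]
    apply integral_mul_fderiv_eq_neg_fderiv_mul_of_integrable
    · exact (hd.continuous.mul c1).integrable_of_hasCompactSupport hdc.mul_right
    · exact (by fun_prop : Continuous fun x => ψ x * fderiv ℝ
          (φ n) x e).integrable_of_hasCompactSupport
        hψ.hasCompactSupport.mul_right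
    · exact (c3.mul c1).integrable_of_hasCompactSupport hψ.hasCompactSupport.mul_right
    · exact fun x _ => hψ.contDiff_one.differentiable one_ne_zero x
    · exact fun x _ => (hφ n).contDiff_one.differentiable one_ne_zero x
  simp only [heq] at l1
  have := tendsto_nhds_unique l1 l2
  rw [← this]
  congr 1; ext x
  rw [real_inner_smul_left]

/-- The gradient of an element of `H₀¹(Ω)` on a cell on which it is affine. -/
lemma H01.grad_eq (v : H01 Ω) (hT : interior (simplex T) ⊆ Ω) {l : E d →ᵃ[ℝ] ℝ}
    (hl : Set.EqOn v.toFun l (simplex T)) :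
    ∀ᵐ x ∂(volume.restrict (simplex T)), v.grad x = agrad l := by
  rw [← ae_restrict_interior_simplex, ae_restrict_iff' isOpen_interior.measurableSet]
  have hfin : volume (interior (simplex T)) < ∞ :=
    (measure_mono interior_subset).trans_lt isCompact_simplex.measure_lt_top
  have hint : IntegrableOn (fun x => v.grad x - agrad l) (interior (simplex T)) := by
    have : IsFiniteMeasure (volume.restrict (interior (simplex T))) :=
      ⟨by rwa [Measure.restrict_apply_univ]⟩
    refine MemLp.integrable (q := 2) (by norm_num) ?_
    exact (v.grad_memLp.mono_measure (Measure.restrict_mono hT le_rfl)).sub (memLp_const _)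
  -- The field `grad` is tied to the function only through limits of test functions, so it is
  -- identified by integration by parts and the fundamental lemma of the calculus of variations.
  have key := isOpen_interior.ae_eq_zero_of_integral_contDiff_smul_eq_zero (μ := volume)
    (f := fun x => v.grad x - agrad l) (U := interior (simplex T)) hint.locallyIntegrableOn ?_
  · filter_upwards [key] with x hx hxT using sub_eq_zero.1 (hx hxT)
  · intro ψ hψ hψc hψU
    have htest : IsTest Ω ψ := ⟨hψ, hψc, hψU.trans hT⟩
    have c3 := htest.contDiff_one.continuous
    have c4 := htest.contDiff_one.continuous_fderiv one_ne_zero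
    have i1 : Integrable (fun x => ψ x • agrad l) := by
      refine Continuous.integrable_of_hasCompactSupport (by fun_prop) ?_
      exact hψc.smul_right
    have i2 : Integrable (fun x => ψ x • v.grad x) (volume.restrict Ω) := by
      have m : MemLp ψ 2 (volume.restrict Ω) := htest.memLp
      have := v.grad_memLp.smul m (r := 1)
      exact memLp_one_iff_integrable.1 this
    have e0 : ∫ x, ψ x • (v.grad x - agrad l)
        = (∫ x in Ω, ψ x • v.grad x) - ∫ x in Ω, ψ x • agrad l := by
      rw [← integral_sub i2 i1.restrict, ← setIntegral_eq_integral_of_forall_compl_eq_zero (s := Ω)]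
      · simp only [smul_sub]
      · intro x hx; rw [htest.eq_zero hx, zero_smul]
    rw [e0, sub_eq_zero]
    apply ext_inner_left ℝ
    intro e
    rw [← integral_inner i2, ← integral_inner i1.restrict]
    simp only [inner_smul_right]
    rw [v.integral_grad_mul htest e]
    have hdc : HasCompactSupport (fun x => fderiv ℝ ψ x e) :=
      (hψc.fderiv ℝ).comp_left (g := fun l : E d →L[ℝ] ℝ => l e) (by simp)
    have hd0 : ∀ x, x ∉ interior (simplex T) → fderiv ℝ ψ x e = 0 := fun x hx => by
      have : fderiv ℝ ψ x = 0 := image_eq_zero_of_notMem_tsupport fun hh =>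
        hx (hψU (tsupport_fderiv_subset ℝ hh))
      rw [this]; simp
    have e1 : ∫ x in Ω, fderiv ℝ ψ x e * v.toFun x = ∫ x, fderiv ℝ ψ x e * l x := by
      rw [← setIntegral_eq_integral_of_forall_compl_eq_zero (s := Ω)
          (f := fun x => fderiv ℝ ψ x e * l x)]
      · congr 1; ext x
        by_cases hx : x ∈ interior (simplex T)
        · rw [hl (interior_subset hx)]
        · rw [hd0 x hx, zero_mul, zero_mul]
      · intro x hx; rw [hd0 x (fun h => hx (hT h)), zero_mul]
    have cl := continuous_affine l
    have hl' : ∀ x, fderiv ℝ l x e = inner ℝ e (agrad l) := fun x => by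
      rw [real_inner_comm, ← inner_gradient, (hasGradientAt_affine l x).gradient]
    have e2 : ∫ x, ψ x * fderiv ℝ l x e = -∫ x, fderiv ℝ ψ x e * l x := by
      apply integral_mul_fderiv_eq_neg_fderiv_mul_of_integrable
      · exact (by fun_prop : Continuous fun x => fderiv ℝ ψ x e * l
            x).integrable_of_hasCompactSupport
          hdc.mul_right
      · simp only [hl']
        exact (by fun_prop : Continuous fun x => ψ x * inner ℝ e
            (agrad l)).integrable_of_hasCompactSupport
          hψc.mul_right
      · exact (c3.mul cl).integrable_of_hasCompactSupport hψc.mul_right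
      · exact fun x _ => htest.contDiff_one.differentiable one_ne_zero x
      · exact fun x _ => (contDiff_affine (n := 1) l).differentiable one_ne_zero x
    rw [e1, ← e2]
    simp only [hl']
    rw [setIntegral_eq_integral_of_forall_compl_eq_zero]
    intro x hx; rw [htest.eq_zero hx, zero_mul]

lemma IsCell.gradOn_eq (hT : IsCell T) {v : E d → ℝ} {l : E d →ᵃ[ℝ] ℝ}
    (hl : Set.EqOn v l (simplex T)) : gradOn v T = agrad l := by
  have h : v =ᶠ[𝓝 (barycentre T)] l := by
    filter_upwards [isOpen_interior.mem_nhds hT.barycentre_mem] with x hx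
    exact hl (interior_subset hx)
  rw [gradOn, gradient_eq_toDual_symm]
  simp only
  rw [h.fderiv_eq, ← (hasGradientAt_affine l (barycentre T)).gradient]
  rfl

end

/-! ### Averages over patches -/

section

open scoped ENNReal
variable {d : ℕ} {Ω : Set (E d)} {T : Finset (E d)} {z : E d}

lemma enorm_sub_sq_le (a b c : ℝ) : ‖a - c‖ₑ ^ 2 ≤ 2 * ‖a - b‖ₑ ^ 2 + 2 * ‖b - c‖ₑ ^ 2 := by
  have h : (a - c) ^ 2 ≤ 2 * (a - b) ^ 2 + 2 * (b - c) ^ 2 := by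
    nlinarith [sq_nonneg ((a - b) - (b - c))]
  have key (x : ℝ) : ‖x‖ₑ ^ 2 = ENNReal.ofReal (x ^ 2) := by
    rw [← sq_abs, ENNReal.ofReal_pow (abs_nonneg x), Real.enorm_eq_ofReal_abs]
  rw [key, key, key]
  refine (ENNReal.ofReal_le_ofReal h).trans (le_of_eq ?_)
  rw [ENNReal.ofReal_add (by positivity) (by positivity), ENNReal.ofReal_mul (by positivity),
    ENNReal.ofReal_mul (by positivity), ENNReal.ofReal_ofNat]

/-- Jensen's inequality for the deviation from the average. -/
lemma measure_mul_enorm_sub_average_le {α : Type*} [MeasurableSpace α] {μ : Measure α}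
    [IsFiniteMeasure μ] (hμ : μ ≠ 0) {g : α → ℝ} (hg : Integrable g μ) (c : ℝ) :
    μ Set.univ * ‖c - ⨍ b, g b ∂μ‖ₑ ^ 2 ≤ ∫⁻ b, ‖c - g b‖ₑ ^ 2 ∂μ := by
  have h0 : μ Set.univ ≠ 0 := by simpa using hμ
  have h1 : μ.real Set.univ * (c - ⨍ b, g b ∂μ) = ∫ b, (c - g b) ∂μ := by
    rw [integral_sub (integrable_const c) hg, integral_const, smul_eq_mul, mul_sub,
        ← smul_eq_mul (μ.real _) (⨍ b, g b ∂μ), measure_smul_average]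
  have h2 : μ Set.univ * ‖c - ⨍ b, g b ∂μ‖ₑ ≤ ∫⁻ b, ‖c - g b‖ₑ ∂μ := by
    have := enorm_integral_le_lintegral_enorm (μ := μ) (fun b => c - g b)
    rw [← h1, enorm_mul] at this
    convert this
    rw [Real.enorm_eq_ofReal measureReal_nonneg, ofReal_measureReal]
  have h3 := sq_lintegral_le μ (g := fun b => ‖c - g b‖ₑ)
    (aemeasurable_const.sub hg.aemeasurable).enorm
  have h4 : μ Set.univ * (μ Set.univ * ‖c - ⨍ b, g b ∂μ‖ₑ ^ 2)
      ≤ μ Set.univ * ∫⁻ b, ‖c - g b‖ₑ ^ 2 ∂μ := by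
    refine le_trans (le_of_eq ?_) ((pow_le_pow_left' h2 2).trans h3)
    ring
  exact (ENNReal.mul_le_mul_iff_right h0 (measure_ne_top _ _)).1 h4

/-- The deviation on `D` of a function from its average over a set `A` that is linked to `D` by a
set `A₀` and a convex set `B`. -/
lemma lintegral_sub_average_le {D B A₀ A : Set (E d)} (hD : Convex ℝ D) (hDm : MeasurableSet D)
    (hB : Convex ℝ B) (hBm : MeasurableSet B) (hA₀m : MeasurableSet A₀) (hA₀D : A₀ ⊆ D)
    (hA₀B : A₀ ⊆ B) (hAB : A ⊆ B) {δ δ' : ℝ} (hδ : ∀ x ∈ D, ∀ y ∈ D, ‖x - y‖ ≤ δ)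
    (hδ' : ∀ x ∈ B, ∀ y ∈ B, ‖x - y‖ ≤ δ') {f g : E d → ℝ} (hf : ∀ x ∈ D, ContDiffAt ℝ 1 f x)
    (hg : ∀ x ∈ B, ContDiffAt ℝ 1 g x) (hfg : ∀ x ∈ A₀, f x = g x) (hgA : IntegrableOn g A)
    (hfm : Measurable f) (hD0 : volume D ≠ 0) (hDt : volume D ≠ ⊤) (hAt : volume A ≠ ⊤)
    (hA0 : volume A ≠ 0)
    {α κ : ℝ≥0∞} (hα : α * volume D ≤ volume A₀) (hκ : volume B ≤ κ * volume A) :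
    α * ∫⁻ x in D, ‖f x - ⨍ b in A, g b‖ₑ ^ 2
      ≤ 2 ^ (d + 1) * (ENNReal.ofReal δ ^ 2 * (∫⁻ x in D, ‖fderiv ℝ f x‖ₑ ^ 2)
        + κ * ENNReal.ofReal δ' ^ 2 * ∫⁻ x in B, ‖fderiv ℝ g x‖ₑ ^ 2) := by
  set m := ⨍ b in A, g b
  set X := ∫⁻ x in D, ‖f x - m‖ₑ ^ 2
  set GD := ∫⁻ x in D, ‖fderiv ℝ f x‖ₑ ^ 2
  set GB := ∫⁻ x in B, ‖fderiv ℝ g x‖ₑ ^ 2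
  have : IsFiniteMeasure (volume.restrict A) :=
      ⟨by rwa [Measure.restrict_apply_univ, lt_top_iff_ne_top]⟩
  -- The link through B: on A₀ the functions f and g agree, and g is compared with its average over
  -- A by Jensen and the Poincaré inequality on B.
  have h1 : volume A * ∫⁻ a in A₀, ‖f a - m‖ₑ ^ 2
      ≤ ENNReal.ofReal δ' ^ 2 * (2 ^ d * volume B * GB) := by
    calc volume A * ∫⁻ a in A₀, ‖f a - m‖ₑ ^ 2
        = ∫⁻ a in A₀, volume A * ‖f a - m‖ₑ ^ 2 := by
          rw [lintegral_const_mul' _ _ hAt]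
      _ ≤ ∫⁻ a in A₀, ∫⁻ b in B, ‖g a - g b‖ₑ ^ 2 := by
          refine setLIntegral_mono' hA₀m fun a ha => ?_
          rw [hfg a ha]
          have := measure_mul_enorm_sub_average_le (μ := volume.restrict A)
            (by simpa using hA0) hgA (g a)
          rw [Measure.restrict_apply_univ] at this
          exact this.trans (lintegral_mono_set hAB)
      _ ≤ ∫⁻ a in B, ∫⁻ b in B, ‖g a - g b‖ₑ ^ 2 := lintegral_mono_set hA₀B
      _ ≤ _ := lintegral_pairs_le hB hBm hδ' hg
  have h2 : ∫⁻ a in A₀, ‖f a - m‖ₑ ^ 2 ≤ ENNReal.ofReal δ' ^ 2 * (2 ^ d * κ * GB) := by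
    rw [← ENNReal.mul_le_mul_iff_right hA0 hAt]
    refine h1.trans ?_
    calc ENNReal.ofReal δ' ^ 2 * (2 ^ d * volume B * GB)
        ≤ ENNReal.ofReal δ' ^ 2 * (2 ^ d * (κ * volume A) * GB) := by gcongr
      _ = _ := by ring
  -- The link through D: f on D is compared with its values on A₀ by the Poincaré inequality on D.
  have h3 : volume A₀ * X ≤ 2 * (ENNReal.ofReal δ ^ 2 * (2 ^ d * volume D * GD))
      + 2 * (volume D * ∫⁻ a in A₀, ‖f a - m‖ₑ ^ 2) := by
    calc volume A₀ * X = ∫⁻ x in D, ∫⁻ _a in A₀, ‖f x - m‖ₑ ^ 2 := by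
          simp_rw [setLIntegral_const, mul_comm _ (volume A₀)]
          rw [lintegral_const_mul]
          exact ((hfm.sub_const m).enorm).pow_const 2
      _ ≤ ∫⁻ x in D, ∫⁻ a in A₀, (2 * ‖f x - f a‖ₑ ^ 2 + 2 * ‖f a - m‖ₑ ^ 2) := by
          gcongr with x a
          exact enorm_sub_sq_le _ _ _
      _ = ∫⁻ x in D, (2 * (∫⁻ a in A₀, ‖f x - f a‖ₑ ^ 2) + 2 * ∫⁻ a in A₀, ‖f a - m‖ₑ ^ 2) := by
          congr 1; ext x
          rw [lintegral_add_right _ (by fun_prop), lintegral_const_mul' _ _ (by simp),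
            lintegral_const_mul' _ _ (by simp)]
      _ = 2 * (∫⁻ x in D, ∫⁻ a in A₀, ‖f x - f a‖ₑ ^ 2)
            + 2 * (volume D * ∫⁻ a in A₀, ‖f a - m‖ₑ ^ 2) := by
          rw [lintegral_add_right _ measurable_const, lintegral_const_mul' _ _ (by simp),
            setLIntegral_const]
          ring
      _ ≤ _ := by
          gcongr
          refine le_trans ?_ (lintegral_pairs_le hD hDm hδ hf)
          gcongr
  rw [← ENNReal.mul_le_mul_iff_right hD0 hDt]
  calc volume D * (α * X) = (α * volume D) * X := by ring
    _ ≤ volume A₀ * X := by gcongr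
    _ ≤ _ := h3
    _ ≤ 2 * (ENNReal.ofReal δ ^ 2 * (2 ^ d * volume D * GD))
      + 2 * (volume D * (ENNReal.ofReal δ' ^ 2 * (2 ^ d * κ * GB))) := by gcongr
    _ = _ := by ring

namespace Mesh
variable (𝒯 : Mesh Ω)

/-- A length that is comparable to the sizes of all the cells around a vertex. -/
lemma exists_scale (hd : 2 ≤ d) (hΩ : IsLipschitzDomain Ω) {σ : ℝ} (hσ : 1 ≤ σ)
    (hreg : ∀ T ∈ 𝒯.cells, CellRegular σ T) (hz : z ∈ 𝒯.vertices) :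
    ∃ ρ > 0, ∀ T ∈ 𝒯.star z, ‖agrad (lam T z)‖ * ρ ≤ 1 / 2 ∧ ρ ≤ size T ∧
      size T ≤ 2 * σ * σ ^ ⌈(2 * σ) ^ d⌉₊ * ρ := by
  obtain ⟨T₁, hT₁, hz₁⟩ := 𝒯.mem_vertices.1 hz
  obtain ⟨T₀, hT₀, hmin⟩ := (𝒯.star z).exists_min_image size ⟨T₁, 𝒯.mem_star.2 ⟨hT₁, hz₁⟩⟩
  have h0 := (𝒯.isCell (𝒯.mem_star.1 hT₀).1).size_pos (by omega)
  have hσ0 : 0 < σ := by linarith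
  -- The smallest size around z, reduced by 2σ so that the coordinate of z is at least 1/2
  -- throughout the ball of radius ρ.
  refine ⟨size T₀ / (2 * σ), by positivity, fun T hT => ?_⟩
  have hTm := 𝒯.mem_star.1 hT
  refine ⟨?_, ?_, ?_⟩
  · have := (𝒯.isCell hTm.1).agrad_mul_size_le hTm.2 hσ0 (hreg T hTm.1)
    rw [mul_div_assoc', div_le_iff₀ (by positivity)]
    have h2 : ‖agrad (lam T z)‖ * size T₀ ≤ ‖agrad (lam T z)‖ * size T := by
      gcongr; exact hmin T hT
    linarith
  · rw [div_le_iff₀ (by positivity)]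
    nlinarith [hmin T hT]
  · have h1 := 𝒯.size_le_of_star hd hΩ hσ hreg hT₀ hT
    have h2 : (𝒯.star z).card ≤ ⌈(2 * σ) ^ d⌉₊ := by
      exact_mod_cast (𝒯.card_star_le (by omega) hσ hreg z).trans (Nat.le_ceil _)
    calc size T ≤ σ ^ (𝒯.star z).card * size T₀ := h1
      _ ≤ σ ^ ⌈(2 * σ) ^ d⌉₊ * size T₀ := by gcongr
      _ = _ := by field_simp

/-- The union of the cells around `z`. -/
def patch (z : E d) : Set (E d) := ⋃ T ∈ 𝒯.star z, simplex T

lemma isClosed_patch : IsClosed (𝒯.patch z) :=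
  (𝒯.star z).finite_toSet.isClosed_biUnion fun _ _ => isClosed_simplex

/-- Near `z` the patch of `z` does not touch the other cells. -/
lemma contDiffAt_indicator_patch {ρ : ℝ}
    (hρ : ∀ T ∈ 𝒯.star z, ‖agrad (lam T z)‖ * ρ ≤ 1 / 2) {φ : E d → ℝ} (hφ : ContDiff ℝ 1 φ)
    (h0 : ∀ x ∉ Ω, φ x = 0) {x : E d} (hx : x ∈ Metric.ball z ρ) :
    ContDiffAt ℝ 1 ((𝒯.patch z).indicator φ) x ∧
      ‖fderiv ℝ ((𝒯.patch z).indicator φ) x‖ₑ ^ 2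
        ≤ (𝒯.patch z).indicator (fun y => ‖fderiv ℝ φ y‖ₑ ^ 2) x := by
  by_cases hxp : x ∈ 𝒯.patch z
  · obtain ⟨r, hr, hball⟩ := 𝒯.exists_ball_disjoint x
    have heq : (𝒯.patch z).indicator φ =ᶠ[𝓝 x] φ := by
      filter_upwards [Metric.ball_mem_nhds x hr] with y hy
      by_cases hyp : y ∈ 𝒯.patch z
      · rw [Set.indicator_of_mem hyp]
      -- If y were in Ω, it would lie in a cell without the vertex z that also contains x.
      -- Conformity would make the coordinate of z vanish at x, whereas it is at least 1/2 in this
      -- ball.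
      · rw [Set.indicator_of_notMem hyp, h0]
        intro hyΩ
        obtain ⟨T, hT, hyT⟩ := 𝒯.exists_cell (subset_closure hyΩ)
        have hxT : x ∈ simplex T := by
          by_contra hxT
          exact hball T hT hxT y hy hyT
        have hzT : z ∉ T := fun hzT => hyp (Set.mem_biUnion (𝒯.mem_star.2 ⟨hT, hzT⟩) hyT)
        simp only [patch, Set.mem_iUnion] at hxp
        obtain ⟨T', hT', hxT'⟩ := hxp
        have hm := 𝒯.mem_star.1 hT'
        have h1 := 𝒯.lam_eq_zero hm.1 hT hxT' hxT hm.2 hzT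
        rw [affine_eq _ x z, (𝒯.isCell hm.1).lam_self hm.2] at h1
        have h2 := abs_le.1 (abs_real_inner_le_norm (agrad (lam T' z)) (x - z))
        have h3 : ‖agrad (lam T' z)‖ * ‖x - z‖ ≤ ‖agrad (lam T' z)‖ * ρ := by
          gcongr; exact (mem_ball_iff_norm.1 hx).le
        linarith [hρ T' hT']
    refine ⟨hφ.contDiffAt.congr_of_eventuallyEq heq, ?_⟩
    rw [heq.fderiv_eq, Set.indicator_of_mem hxp]
  · have heq : (𝒯.patch z).indicator φ =ᶠ[𝓝 x] fun _ => 0 := by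
      filter_upwards [𝒯.isClosed_patch.isOpen_compl.mem_nhds hxp] with y hy
      exact Set.indicator_of_notMem hy _
    refine ⟨contDiffAt_const.congr_of_eventuallyEq heq, ?_⟩
    rw [heq.fderiv_eq, Set.indicator_of_notMem hxp, enorm_eq_nnnorm, fderiv_const_apply,
        nnnorm_zero]
    simp

end Mesh

/-- The set over which a function is averaged to obtain its nodal value at a vertex: it lies outside
the patch if the vertex is on the boundary. -/
lemma IsLipschitzDomain.exists_averaging_set (hΩ : IsLipschitzDomain Ω) :
    ∃ κ : ℝ≥0∞, κ ≠ ⊤ ∧ ∀ (𝒯 : Mesh Ω), ∀ z ∈ 𝒯.vertices, ∀ ρ > 0, ∃ A : Set (E d), IsOpen A ∧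
        A.Nonempty ∧
      A ⊆ Metric.ball z ρ ∧ volume (Metric.ball z ρ) ≤ κ * volume A ∧
      (z ∉ Ω → Disjoint A (𝒯.patch z)) := by
  obtain ⟨c, hc, hc1, hcone⟩ := hΩ.exists_exterior_cone
  -- The volume ratio of balls of radii ρ and cρ/2.
  refine ⟨ENNReal.ofReal ((2 / c) ^ d), ENNReal.ofReal_ne_top, fun 𝒯 z hz ρ hρ => ?_⟩
  by_cases hzΩ : z ∈ Ω
  · refine ⟨Metric.ball z ρ, Metric.isOpen_ball, Metric.nonempty_ball.2 hρ, subset_rfl, ?_,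
        fun h => absurd hzΩ h⟩
    refine le_mul_of_one_le_left' ?_
    rw [ENNReal.one_le_ofReal]
    exact one_le_pow₀ (by rw [le_div_iff₀ hc]; linarith)
  · have hzf : z ∈ frontier Ω := by
      rw [hΩ.isOpen.frontier_eq]; exact ⟨𝒯.vertex_mem_closure hz, hzΩ⟩
    obtain ⟨e, he, t₀, ht₀, hout⟩ := hcone z hzf
    -- All its points have the form z − (ρ/2)(e + u) with ‖u‖ < c, that is, they lie in the cone of
    -- exterior directions.
    refine ⟨Metric.ball (z - (ρ / 2) • e) (c * ρ / 2), Metric.isOpen_ball,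
      Metric.nonempty_ball.2 (by positivity), ?_, ?_, fun _ => ?_⟩
    · refine Metric.ball_subset_ball' ?_
      rw [dist_eq_norm, sub_sub_cancel_left, norm_neg, norm_smul, he,
          Real.norm_of_nonneg (by positivity)]
      nlinarith
    · rw [Measure.addHaar_ball_of_pos volume _ hρ,
          Measure.addHaar_ball_of_pos volume _ (by positivity : 0 < c * ρ / 2), ← mul_assoc,
        ← ENNReal.ofReal_mul (by positivity), finrank_euclideanSpace_fin, ← mul_pow]
      apply le_of_eq
      congr 3
      field_simp
    · rw [Set.disjoint_left]
      intro x hx hxp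
      simp only [Mesh.patch, Set.mem_iUnion] at hxp
      obtain ⟨T, hT, hxT⟩ := hxp
      have hm := 𝒯.mem_star.1 hT
      have hC := 𝒯.isCell hm.1
      rw [← hC.closure_interior] at hxT
      obtain ⟨y, hy, hyT⟩ := mem_closure_iff.1 hxT _ Metric.isOpen_ball hx
      -- The cone is known to be exterior only below the length t₀, which is unrelated to ρ. A cell
      -- at z is invariant under shrinking towards z, so y is pulled back below this length while
      -- remaining in the interior of the cell, hence in Ω.
      obtain ⟨s, hs, hs1, hst⟩ : ∃ s : ℝ, 0 < s ∧ s < 1 ∧ s * (ρ / 2) < t₀ := by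
        refine ⟨min (1 / 2) (t₀ / ρ), by positivity, by
          exact (min_le_left _ _).trans_lt (by norm_num), ?_⟩
        calc min (1 / 2) (t₀ / ρ) * (ρ / 2) ≤ t₀ / ρ * (ρ / 2) := by gcongr; exact min_le_right _ _
          _ = t₀ / 2 := by field_simp
          _ < t₀ := by linarith
      refine hout (s * (ρ / 2)) (by positivity) hst (-((2 / ρ) • (y - z)) - e) ?_
        (𝒯.interior_subset hΩ hm.1 (?_ : _ ∈ interior (simplex T)))
      · rw [mem_ball_iff_norm] at hy
        have : -((2 / ρ) • (y - z)) - e = (-(2 / ρ)) • (y - (z - (ρ / 2) • e)) := by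
          rw [← sub_add, smul_add, smul_smul, neg_smul, neg_mul, div_mul_div_cancel₀ hρ.ne',
            div_self two_ne_zero, neg_one_smul, sub_eq_add_neg]
        rw [this, norm_smul, norm_neg, Real.norm_of_nonneg (by positivity)]
        calc 2 / ρ * ‖y - (z - (ρ / 2) • e)‖ ≤ 2 / ρ * (c * ρ / 2) := by gcongr
          _ = c := by field_simp
      · have : z - (s * (ρ / 2)) • (e + (-((2 / ρ) • (y - z)) - e)) = z + s • (y - z) := by
          rw [add_sub_cancel, smul_neg, sub_neg_eq_add, smul_smul]
          congr 2
          field_simp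
        rw [this, hC.mem_interior]
        intro v hv
        have hpos := hC.mem_interior.1 hyT v hv
        by_cases hvz : v = z
        · subst hvz
          rw [hC.lam_dilate_self hv]
          nlinarith
        · rw [hC.lam_dilate hm.2 hv hvz]
          positivity

end

/-! ### Nodal values -/

section

open scoped ENNReal
variable {d : ℕ} {Ω : Set (E d)} {T : Finset (E d)} {z : E d}

/-- Nodal values of Scott–Zhang type, which vanish at the boundary vertices. -/
theorem IsLipschitzDomain.exists_nodal_values (hΩ : IsLipschitzDomain Ω) (hd : 2 ≤ d) {σ : ℝ}
    (hσ : 1 ≤ σ) :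
    ∃ C : ℝ≥0∞, C ≠ ⊤ ∧ ∀ 𝒯 : Mesh Ω, (∀ T ∈ 𝒯.cells, CellRegular σ T) → ∀ φ : E d → ℝ, IsTest Ω φ →
      ∃ m : E d → ℝ, (∀ z ∈ 𝒯.vertices, z ∉ Ω → m z = 0) ∧ ∀ z ∈ 𝒯.vertices, ∀ T ∈ 𝒯.star z,
        ∫⁻ x in simplex T, ‖φ x - m z‖ₑ ^ 2
          ≤ C * ENNReal.ofReal (size T) ^ 2 *
            ∑ T' ∈ 𝒯.star z, ∫⁻ x in simplex T', ‖fderiv ℝ φ x‖ₑ ^ 2 := by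
  obtain ⟨κ, hκ, hA⟩ := hΩ.exists_averaging_set
  set K : ℝ := 2 * σ * σ ^ ⌈(2 * σ) ^ d⌉₊ with hK
  have hK0 : 0 < K := by positivity
  -- A lower bound for the volume ratio of the scaled copy of T at z, used below as A₀, to T; it
  -- comes from `size T ≤ K * ρ z`.
  set α : ℝ≥0∞ := ENNReal.ofReal ((1 / (2 * K)) ^ d) with hα
  have hα0 : α ≠ 0 := by rw [hα, Ne, ENNReal.ofReal_eq_zero, not_le]; positivity
  refine ⟨α⁻¹ * (2 ^ (d + 1) * (1 + κ * 4)), ENNReal.mul_ne_top (ENNReal.inv_ne_top.2 hα0)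
    (ENNReal.mul_ne_top (by simp)
        (ENNReal.add_ne_top.2 ⟨by simp, ENNReal.mul_ne_top hκ (by simp)⟩)),
    fun 𝒯 hreg φ hφ => ?_⟩
  have hex (z : E d) (hz : z ∈ 𝒯.vertices) := 𝒯.exists_scale hd hΩ hσ hreg hz
  choose! ρ hρ0 hρ using hex
  have hexA (z : E d) (hz : z ∈ 𝒯.vertices) := hA 𝒯 z hz (ρ z) (hρ0 z hz)
  choose! A hAo hAn hAb hAv hAd using hexA
  -- Cutting φ off to the patch removes the parts of Ω that come close to z without belonging to its
  -- cells. At a boundary vertex the averaging set misses the patch, so the nodal value is 0.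
  refine ⟨fun z => ⨍ b in A z, (𝒯.patch z).indicator φ b, fun z hz hzΩ => ?_, fun z hz T hT => ?_⟩
  · have : ∫ b in A z, (𝒯.patch z).indicator φ b = 0 := by
      rw [setIntegral_congr_fun (hAo z hz).measurableSet (g := fun _ => 0), integral_zero]
      intro b hb
      exact Set.indicator_of_notMem (Set.disjoint_left.1 (hAd z hz hzΩ) hb) _
    simp only
    rw [setAverage_eq, this, smul_zero]
  have hm := 𝒯.mem_star.1 hT
  have hC := 𝒯.isCell hm.1
  have hh := hC.size_pos (by omega)
  have hρz := hρ0 z hz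
  obtain ⟨-, hρh, hhK⟩ := hρ z hz T hT
  -- Chosen so that the copy of T shrunk by s towards z lies both in T and in the ball of radius ρ.
  set s : ℝ := ρ z / (2 * size T) with hs
  have hs0 : 0 < s := by positivity
  have hs1 : s ≤ 1 := by rw [hs, div_le_one (by positivity)]; linarith
  have hsub := IsCell.homothety_subset hm.2 hs0.le hs1
  have hpatch : simplex T ⊆ 𝒯.patch z := Set.subset_biUnion_of_mem (u := simplex) hT
  have hvolA : volume (A z) ≠ ⊤ := ((measure_mono (hAb z hz)).trans_lt measure_ball_lt_top).ne
  have key := lintegral_sub_average_le (D := simplex T) (B := Metric.ball z (ρ z))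
    (A₀ := AffineMap.homothety z s '' simplex T) (A := A z) convex_simplex measurableSet_simplex
    (convex_ball _ _) measurableSet_ball
    (isCompact_simplex.image
        (AffineMap.homothety z s).continuous_of_finiteDimensional).measurableSet
    hsub ?_ (hAb z hz) (δ := size T) (fun x hx y hy => norm_sub_le_size hx hy)
    (δ' := 2 * size T) ?_ (f := φ) (g := (𝒯.patch z).indicator φ)
    (fun x _ => hφ.contDiff_one.contDiffAt)
    (fun x hx => (𝒯.contDiffAt_indicator_patch (fun S hS => (hρ z hz S hS).1) hφ.contDiff_one
      (fun x hx => hφ.eq_zero hx) hx).1)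
    (fun x hx => (Set.indicator_of_mem (hpatch (hsub hx)) _).symm) ?_
    hφ.contDiff.continuous.measurable ?_ isCompact_simplex.measure_lt_top.ne hvolA
    ((hAo z hz).measure_pos volume (hAn z hz)).ne' (α := α) ?_ (hAv z hz)
  rotate_left
  · rintro _ ⟨x, hx, rfl⟩
    rw [homothety_eq, mem_ball_iff_norm, add_sub_cancel_left, norm_smul, Real.norm_of_nonneg hs0.le]
    calc s * ‖x - z‖ ≤ s * size T := by
          gcongr; exact norm_sub_le_size hx (mem_simplex_of_mem hm.2)
      _ = ρ z / 2 := by rw [hs]; field_simp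
      _ < ρ z := by linarith
  · intro x hx y hy
    have := dist_triangle_right x y z
    rw [← dist_eq_norm]
    rw [Metric.mem_ball] at hx hy
    linarith
  · refine Integrable.integrableOn (Integrable.indicator ?_ 𝒯.isClosed_patch.measurableSet)
    exact hφ.contDiff.continuous.integrable_of_hasCompactSupport hφ.hasCompactSupport
  · have := isOpen_interior.measure_pos volume ⟨_, hC.barycentre_mem⟩
    exact (this.trans_le (measure_mono interior_subset)).ne'
  · rw [Measure.addHaar_image_homothety, finrank_euclideanSpace_fin, abs_of_pos (by positivity)]
    refine mul_le_mul_left (ENNReal.ofReal_le_ofReal (pow_le_pow_left₀ (by positivity) ?_ d)) _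
    rw [hs, div_le_div_iff₀ (by positivity) (by positivity)]
    linarith
  rw [← ENNReal.mul_le_mul_iff_right hα0 ENNReal.ofReal_ne_top]
  refine key.trans ?_
  set P := ∑ T' ∈ 𝒯.star z, ∫⁻ x in simplex T', ‖fderiv ℝ φ x‖ₑ ^ 2
  have h1 : ∫⁻ x in simplex T, ‖fderiv ℝ φ x‖ₑ ^ 2 ≤ P :=
    Finset.single_le_sum (f := fun T' => ∫⁻ x in simplex T', ‖fderiv ℝ φ x‖ₑ ^ 2)
      (fun _ _ => zero_le) hT
  have h2 : ∫⁻ x in Metric.ball z (ρ z), ‖fderiv ℝ ((𝒯.patch z).indicator φ) x‖ₑ ^ 2 ≤ P := by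
    calc ∫⁻ x in Metric.ball z (ρ z), ‖fderiv ℝ ((𝒯.patch z).indicator φ) x‖ₑ ^ 2
        ≤ ∫⁻ x in Metric.ball z (ρ z), (𝒯.patch z).indicator (fun y => ‖fderiv ℝ φ y‖ₑ ^ 2) x :=
          setLIntegral_mono' measurableSet_ball fun x hx =>
            (𝒯.contDiffAt_indicator_patch (fun S hS => (hρ z hz S hS).1) hφ.contDiff_one
              (fun x hx => hφ.eq_zero hx) hx).2
      _ ≤ ∫⁻ x, (𝒯.patch z).indicator (fun y => ‖fderiv ℝ φ y‖ₑ ^ 2) x :=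
          setLIntegral_le_lintegral _ _
      _ = ∫⁻ x in 𝒯.patch z, ‖fderiv ℝ φ x‖ₑ ^ 2 :=
          lintegral_indicator 𝒯.isClosed_patch.measurableSet _
      _ ≤ P := by
          rw [Mesh.patch, lintegral_biUnion_finset₀
            (𝒯.aedisjoint.mono fun S hS => (𝒯.mem_star.1 hS).1)
            fun S _ => measurableSet_simplex.nullMeasurableSet]
  calc _ ≤ 2 ^ (d + 1) * (ENNReal.ofReal (size T) ^ 2 * P
        + κ * ENNReal.ofReal (2 * size T) ^ 2 * P) := by gcongr
    _ = α * α⁻¹ * (2 ^ (d + 1) * (1 + κ * 4)) * ENNReal.ofReal (size T) ^ 2 * P := by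
        rw [ENNReal.mul_inv_cancel hα0 ENNReal.ofReal_ne_top, ENNReal.ofReal_mul two_pos.le,
          ENNReal.ofReal_ofNat]
        ring
    _ = _ := by ring

end

/-! ### Piecewise affine interpolation -/

section

open scoped ENNReal
variable {d : ℕ} {Ω : Set (E d)} {T : Finset (E d)} {z : E d} {m : E d → ℝ}

/-- The affine function with the values `m` at the vertices of `T`. -/
def interp (m : E d → ℝ) (T : Finset (E d)) : E d →ᵃ[ℝ] ℝ := ∑ z ∈ T, m z • lam T z

lemma interp_apply (m : E d → ℝ) (T : Finset (E d)) (x : E d) :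
    interp m T x = ∑ z ∈ T, lam T z x * m z := by
  have main (s : Finset (E d)) :
      (∑ z ∈ s, m z • lam T z : E d →ᵃ[ℝ] ℝ) x = ∑ z ∈ s, lam T z x * m z := by
    induction s using Finset.cons_induction with
    | empty => simp
    | cons z s hz ih =>
      rw [Finset.sum_cons, Finset.sum_cons, ← ih]
      simp [mul_comm]
  exact main T

lemma IsCell.interp_self (hT : IsCell T) (hz : z ∈ T) : interp m T z = m z := by
  rw [interp_apply, Finset.sum_eq_single z, hT.lam_self hz, one_mul]
  · intro v hv hvz
    rw [hT.lam_ne hv hz hvz.symm, zero_mul]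
  · exact fun h => absurd hz h

lemma agrad_interp (m : E d → ℝ) (T : Finset (E d)) :
    agrad (interp m T) = ∑ z ∈ T, m z • agrad (lam T z) := by
  refine agrad_eq_of_forall fun x y => ?_
  rw [interp_apply, interp_apply, ← Finset.sum_sub_distrib, sum_inner]
  refine Finset.sum_congr rfl fun z _ => ?_
  rw [affine_eq _ x y, inner_smul_left]
  simp
  ring

/-! ### Finite element functions with prescribed nodal values. -/

section Fe
variable (𝒯 : Mesh Ω)

lemma Mesh.exists_hat_H01 (hΩ : IsLipschitzDomain Ω) (hz : z ∈ 𝒯.vertices) (hzΩ : z ∈ Ω) :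
    ∃ v : H01 Ω, v.toFun = 𝒯.hat z := by
  obtain ⟨L, hL⟩ := 𝒯.exists_lipschitz_hat hΩ hz hzΩ
  have h0 (x : E d) (hx : x ∉ Ω) : 𝒯.hat z x = 0 := 𝒯.hat_eq_zero_of_notMem hΩ hz hzΩ hx
  have hfin : IsFiniteMeasure (volume.restrict Ω) :=
    ⟨by rw [Measure.restrict_apply_univ]; exact hΩ.isBounded.measure_lt_top⟩
  have hc : HasCompactSupport (𝒯.hat z) :=
    HasCompactSupport.intro hΩ.isBounded.isCompact_closure fun x hx => h0 x fun h =>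
        hx (subset_closure h)
  exact ⟨(approximable_of_nonneg hΩ.isOpen hΩ.isBounded hL (𝒯.hat_nonneg z) h0).toH01
    (hL.continuous.memLp_of_hasCompactSupport hc)
    (MemLp.of_bound (measurable_gradient _).aestronglyMeasurable L
      (.of_forall fun x => norm_gradient_le_of_lipschitz hL x)), rfl⟩

lemma exists_zero_H01 : ∃ v : H01 Ω, v.toFun = fun _ => 0 := by
  refine ⟨⟨fun _ => 0, fun _ => 0, MemLp.zero, MemLp.zero, fun _ _ => 0,
      fun _ => ⟨contDiff_const, HasCompactSupport.zero, ?_⟩, ?_, ?_⟩, rfl⟩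
  · simp [tsupport]
  · simp
  · simp

/-- Piecewise affine functions with prescribed nodal values. -/
theorem Mesh.exists_feSpace (hΩ : IsLipschitzDomain Ω) (hm : ∀ z ∈ 𝒯.vertices, z ∉ Ω → m z = 0) :
    ∃ v ∈ feSpace 𝒯, ∀ T ∈ 𝒯.cells, Set.EqOn v.toFun (interp m T) (simplex T) := by
  classical
  have main (s : Finset (E d)) (hs : ∀ z ∈ s, z ∈ 𝒯.vertices ∧ z ∈ Ω) :
      ∃ v : H01 Ω, v.toFun = fun x => ∑ z ∈ s, m z * 𝒯.hat z x := by
    induction s using Finset.induction_on with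
    | empty => simpa using exists_zero_H01
    | insert z s hz ih =>
      obtain ⟨v, hv⟩ := ih fun w hw => hs w (Finset.mem_insert_of_mem hw)
      obtain ⟨hz1, hz2⟩ := hs z (Finset.mem_insert_self _ _)
      obtain ⟨w, hw⟩ := 𝒯.exists_hat_H01 hΩ hz1 hz2
      refine ⟨v.addSmul w (m z), ?_⟩
      ext x
      rw [Finset.sum_insert hz, add_comm, ← hw, ← congrFun hv x]
      rfl
  -- Only interior vertices contribute, since the nodal values at boundary vertices are zero.
  obtain ⟨v, hv⟩ := main {z ∈ 𝒯.vertices | z ∈ Ω} (by simp)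
  have heq (T) (hT : T ∈ 𝒯.cells) : Set.EqOn v.toFun (interp m T) (simplex T) := by
    intro x hx
    rw [hv, interp_apply]
    symm
    refine Eq.trans (Finset.sum_congr rfl (g := fun z => if z ∈ Ω then m z * 𝒯.hat z x else 0) ?_)
        ?_
    · intro z hz
      rw [𝒯.hat_eq (𝒯.mem_star.2 ⟨hT, hz⟩) hx, mul_comm]
      split_ifs with h
      · rfl
      · rw [hm z (𝒯.mem_vertices.2 ⟨T, hT, hz⟩) h, zero_mul]
    · rw [← Finset.sum_filter]
      refine Finset.sum_subset ?_ ?_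
      · intro z hz
        rw [Finset.mem_filter] at hz ⊢
        exact ⟨𝒯.mem_vertices.2 ⟨T, hT, hz.1⟩, hz.2⟩
      · intro z hz hz'
        rw [Finset.mem_filter] at hz hz'
        rw [𝒯.hat_eq_zero hΩ hz.1 hz.2 hT (fun h => hz' ⟨h, hz.2⟩) hx, mul_zero]
  refine ⟨v, ⟨?_, fun T hT => ⟨_, heq T hT⟩⟩, heq⟩
  refine Continuous.continuousOn ?_
  rw [hv]
  refine continuous_finsetSum _ fun z hz => continuous_const.mul ?_
  rw [Finset.mem_filter] at hz
  exact (𝒯.exists_lipschitz_hat hΩ hz.1 hz.2).choose_spec.continuous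

end Fe

/-! ### Interpolation error on a cell. -/

section Estimates

lemma enorm_sum_sq_le {ι F : Type*} [SeminormedAddCommGroup F] (s : Finset ι) (f : ι → F) :
    ‖∑ i ∈ s, f i‖ₑ ^ 2 ≤ s.card * ∑ i ∈ s, ‖f i‖ₑ ^ 2 := by
  have h : ‖∑ i ∈ s, f i‖₊ ^ 2 ≤ s.card * ∑ i ∈ s, ‖f i‖₊ ^ 2 :=
    (pow_le_pow_left' (nnnorm_sum_le s f) 2).trans sq_sum_le_card_mul_sum_sq
  simp only [enorm_eq_nnnorm]
  exact_mod_cast h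

/-- By the partition of unity, the error on the cell is a convex combination of the deviations from
the nodal values. -/
lemma IsCell.sub_interp_eq (hT : IsCell T) (φ : E d → ℝ) (x : E d) :
    φ x - interp m T x = ∑ z ∈ T, lam T z x * (φ x - m z) := by
  simp_rw [mul_sub, Finset.sum_sub_distrib, interp_apply, ← Finset.sum_mul, hT.sum_lam, one_mul]

/-- The gradients of the coordinates sum to zero, so any constant may be subtracted from the nodal
values. It is used with the value of φ at the point under consideration. -/
lemma IsCell.agrad_interp_eq (hT : IsCell T) (c : ℝ) :
    agrad (interp m T) = -∑ z ∈ T, (c - m z) • agrad (lam T z) := by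
  simp_rw [sub_smul, Finset.sum_sub_distrib, ← Finset.smul_sum, hT.sum_agrad, agrad_interp]
  simp

/-- The error of the interpolation on a cell, in terms of the distances to the nodal values. -/
lemma IsCell.lintegral_sub_interp_le (hT : IsCell T) {φ : E d → ℝ} (hφ : Continuous φ) :
    ∫⁻ x in simplex T, ‖φ x - interp m T x‖ₑ ^ 2
      ≤ (d + 1) * ∑ z ∈ T, ∫⁻ x in simplex T, ‖φ x - m z‖ₑ ^ 2 := by
  rw [← lintegral_finsetSum _ (fun z _ => by fun_prop), ← lintegral_const_mul' _ _ (by finiteness)]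
  refine setLIntegral_mono' measurableSet_simplex fun x hx => ?_
  rw [hT.sub_interp_eq]
  refine (enorm_sum_sq_le _ _).trans ?_
  rw [hT.card_eq]
  push_cast
  gcongr with z hz
  rw [enorm_mul]
  refine mul_le_of_le_one_left' ?_
  rw [Real.enorm_eq_ofReal (hT.mem_simplex.1 hx z hz), ENNReal.ofReal_le_one]
  exact hT.lam_le_one hz hx

/-- Multiplied by the squared size, each ∇λ_z costs only σ, and the gradient error reduces to the
deviations φ − m z already estimated in L². -/
lemma IsCell.lintegral_fderiv_sub_interp_le (hT : IsCell T) {φ : E d → ℝ} (hφ : ContDiff ℝ 1 φ)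
    {σ : ℝ} (hσ : 0 < σ) (hr : CellRegular σ T) :
    ENNReal.ofReal (size T) ^ 2 * ∫⁻ x in simplex T, ‖fderiv ℝ (fun y => φ y - interp m T y) x‖ₑ ^ 2
      ≤ 2 * ENNReal.ofReal (size T) ^ 2 * (∫⁻ x in simplex T, ‖fderiv ℝ φ x‖ₑ ^ 2)
       + 2 * (d + 1) * ENNReal.ofReal σ ^ 2 * ∑ z ∈ T, ∫⁻ x in simplex T, ‖φ x - m z‖ₑ ^ 2 := by
  have hc := hφ.continuous
  have hm : Measurable fun x => ‖fderiv ℝ φ x‖ₑ ^ 2 :=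
    (hφ.continuous_fderiv one_ne_zero).measurable.enorm.pow_const 2
  rw [← lintegral_finsetSum _ (fun z _ => by fun_prop), ← lintegral_const_mul' _ _ (by finiteness),
    ← lintegral_const_mul' _ _ (by finiteness), ← lintegral_const_mul' _ _ (by finiteness),
    ← lintegral_add_left (by fun_prop)]
  refine lintegral_mono fun x => ?_
  have h1 : ‖fderiv ℝ (fun y => φ y - interp m T y) x‖ₑ
      = ‖gradient φ x + ∑ z ∈ T, (φ x - m z) • agrad (lam T z)‖ₑ := by
    rw [← ofReal_norm, ← norm_gradient, ofReal_norm]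
    have hd : DifferentiableAt ℝ φ x := hφ.differentiable one_ne_zero x
    have := hd.hasGradientAt.hasFDerivAt.sub (hasGradientAt_affine (interp m T) x).hasFDerivAt
    rw [← map_sub] at this
    rw [(show HasGradientAt (fun y => φ y - interp m T y) _ x from this).gradient,
      hT.agrad_interp_eq (φ x), sub_neg_eq_add]
  have h2 (z : E d) (hz : z ∈ T) :
      ENNReal.ofReal (size T) ^ 2 * ‖agrad (lam T z)‖ₑ ^ 2 ≤ ENNReal.ofReal σ ^ 2 := by
    rw [← mul_pow, ← ofReal_norm, ← ENNReal.ofReal_mul size_nonneg, mul_comm]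
    gcongr
    exact hT.agrad_mul_size_le hz hσ hr
  have h3 (a b : E d) : ‖a + b‖ₑ ^ 2 ≤ 2 * (‖a‖ₑ ^ 2 + ‖b‖ₑ ^ 2) := by
    have := enorm_sum_sq_le Finset.univ ![a, b]
    simpa using this
  have h4 : ‖gradient φ x‖ₑ = ‖fderiv ℝ φ x‖ₑ := by
    rw [← ofReal_norm, norm_gradient, ofReal_norm]
  rw [h1]
  calc ENNReal.ofReal (size T) ^ 2 * ‖gradient φ x + ∑ z ∈ T, (φ x - m z) • agrad (lam T z)‖ₑ ^ 2
      ≤ ENNReal.ofReal (size T) ^ 2 * (2 * (‖fderiv ℝ φ x‖ₑ ^ 2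
          + T.card * ∑ z ∈ T, ‖(φ x - m z) • agrad (lam T z)‖ₑ ^ 2)) := by
        gcongr
        refine (h3 _ _).trans ?_
        rw [h4]
        gcongr
        exact enorm_sum_sq_le _ _
    _ = 2 * ENNReal.ofReal (size T) ^ 2 * ‖fderiv ℝ φ x‖ₑ ^ 2 + 2 * (d + 1) *
          ∑ z ∈ T, (ENNReal.ofReal (size T) ^ 2 * ‖agrad (lam T z)‖ₑ ^ 2) * ‖φ x - m z‖ₑ ^ 2 := by
        rw [hT.card_eq, Finset.mul_sum, Finset.mul_sum, mul_add, mul_add]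
        congr 1
        · ring
        · rw [Finset.mul_sum, Finset.mul_sum]
          refine Finset.sum_congr rfl fun z _ => ?_
          rw [enorm_smul]
          push_cast
          ring
    _ ≤ 2 * ENNReal.ofReal (size T) ^ 2 * ‖fderiv ℝ φ x‖ₑ ^ 2 + 2 * (d + 1) *
          ∑ z ∈ T, ENNReal.ofReal σ ^ 2 * ‖φ x - m z‖ₑ ^ 2 := by
        gcongr with z hz
        exact h2 z hz
    _ = _ := by
        rw [← Finset.mul_sum]
        ring

end Estimates

end

/-! ### Quasi-interpolation -/

section

open scoped ENNReal
variable {d : ℕ} {Ω : Set (E d)} {T : Finset (E d)} {z : E d} {m : E d → ℝ}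

lemma toReal_rpow_half_sq (q : ℝ≥0∞) : ((q ^ (1 / 2 : ℝ)).toReal) ^ 2 = q.toReal := by
  rw [← ENNReal.toReal_pow, ← ENNReal.rpow_natCast, ← ENNReal.rpow_mul]
  norm_num

lemma l2norm_le_of_lintegral_le {F : Type*} [NormedAddCommGroup F] {A : Set (E d)} {f : E d → F}
    {c q : ℝ≥0∞} (hc : c ≠ ⊤) (hq : q ≠ ⊤) (h : ∫⁻ x in A, ‖f x‖ₑ ^ 2 ≤ c * q) :
    l2norm A f ≤ √c.toReal * (q ^ (1 / 2 : ℝ)).toReal := by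
  have h0 : (0 : ℝ) ≤ √c.toReal * (q ^ (1 / 2 : ℝ)).toReal := by positivity
  refine abs_le_of_sq_le_sq' ?_ h0 |>.2
  rw [l2norm, eLpNorm_two_eq, toReal_rpow_half_sq, mul_pow, toReal_rpow_half_sq,
    Real.sq_sqrt ENNReal.toReal_nonneg, ← ENNReal.toReal_mul]
  exact ENNReal.toReal_mono (ENNReal.mul_ne_top hc hq) h

/-- Sums over pairs of cells with a common vertex. -/
lemma Mesh.sum_star_le (𝒯 : Mesh Ω) {N : ℕ} (hN : ∀ z, (𝒯.star z).card ≤ N)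
    (G : Finset (E d) → ℝ≥0∞) :
    ∑ T ∈ 𝒯.cells, ∑ z ∈ T, ∑ T' ∈ 𝒯.star z, G T' ≤ N * (d + 1) * ∑ T ∈ 𝒯.cells, G T := by
  have hcomm (F : E d → Finset (E d) → ℝ≥0∞) :
      ∑ T ∈ 𝒯.cells, ∑ z ∈ T, F z T = ∑ z ∈ 𝒯.vertices, ∑ T ∈ 𝒯.star z, F z T := by
    refine Finset.sum_comm' fun T z => ?_
    rw [𝒯.mem_star, 𝒯.mem_vertices]
    exact ⟨fun h => ⟨h, T, h⟩, fun h => h.1⟩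
  rw [hcomm fun z _ => ∑ T' ∈ 𝒯.star z, G T']
  calc ∑ z ∈ 𝒯.vertices, ∑ _T ∈ 𝒯.star z, ∑ T' ∈ 𝒯.star z, G T'
      ≤ ∑ z ∈ 𝒯.vertices, N * ∑ T' ∈ 𝒯.star z, G T' := by
        gcongr with z hz
        rw [Finset.sum_const, nsmul_eq_mul]
        gcongr
        exact hN z
    _ = N * ∑ T ∈ 𝒯.cells, ∑ _z ∈ T, G T := by rw [← Finset.mul_sum, hcomm fun _ T => G T]
    _ = _ := by
        rw [mul_assoc, Finset.mul_sum (a := (d + 1 : ℝ≥0∞))]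
        congr 1
        refine Finset.sum_congr rfl fun T hT => ?_
        rw [Finset.sum_const, 𝒯.card_eq T hT, nsmul_eq_mul]
        push_cast
        ring

/-- Local estimates for a quasi-interpolation operator of Scott–Zhang type. -/
theorem IsLipschitzDomain.exists_quasi_interpolant (hΩ : IsLipschitzDomain Ω) (hd : 2 ≤ d) {σ : ℝ}
    (hσ : 1 ≤ σ) :
    ∃ C : ℝ, 0 ≤ C ∧ ∀ 𝒯 : Mesh Ω, (∀ T ∈ 𝒯.cells, CellRegular σ T) → ∀ φ : E d → ℝ, IsTest Ω φ →
      ∃ m : E d → ℝ, (∀ z ∈ 𝒯.vertices, z ∉ Ω → m z = 0) ∧ ∃ P : Finset (E d) → ℝ,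
        (∀ T ∈ 𝒯.cells, 0 ≤ P T ∧
          l2norm (simplex T) (fun x => φ x - interp m T x) ≤ C * size T * P T ∧
          l2norm (simplex T) (fderiv ℝ fun x => φ x - interp m T x) ≤ C * P T) ∧
        ∑ T ∈ 𝒯.cells, P T ^ 2 ≤ C * l2norm Ω (gradient φ) ^ 2 := by
  obtain ⟨C, hC, hval⟩ := hΩ.exists_nodal_values hd hσ
  set N : ℕ := ⌈(2 * σ) ^ d⌉₊
  set C₁ : ℝ≥0∞ := (d + 1) * C
  set C₂ : ℝ≥0∞ := 2 + 2 * (d + 1) * ENNReal.ofReal σ ^ 2 * C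
  have hC₁ : C₁ ≠ ⊤ := ENNReal.mul_ne_top (by finiteness) hC
  have hC₂ : C₂ ≠ ⊤ := ENNReal.add_ne_top.2 ⟨by simp, ENNReal.mul_ne_top (by finiteness) hC⟩
  refine ⟨√C₁.toReal + √C₂.toReal + N * (d + 1), by positivity, fun 𝒯 hreg φ hφ => ?_⟩
  obtain ⟨m, hm, hest⟩ := hval 𝒯 hreg φ hφ
  set G : Finset (E d) → ℝ≥0∞ := fun T => ∫⁻ x in simplex T, ‖fderiv ℝ φ x‖ₑ ^ 2 with hG
  -- The energy of φ on the cells that touch T, with multiplicity. Its square root is P, and summed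
  -- over T each cell is counted at most N(d + 1) times.
  set Q : Finset (E d) → ℝ≥0∞ := fun T => ∑ z ∈ T, ∑ T' ∈ 𝒯.star z, G T' with hQ
  have hN (z : E d) : (𝒯.star z).card ≤ N := by
    exact_mod_cast (𝒯.card_star_le (by omega) hσ hreg z).trans (Nat.le_ceil _)
  have hsum : ∑ T ∈ 𝒯.cells, G T = ∫⁻ x in Ω, ‖gradient φ x‖ₑ ^ 2 := by
    rw [𝒯.restrict_eq_sum hΩ, lintegral_finsetSum_measure]
    simp_rw [hG, ← ofReal_norm, norm_gradient]
  have hfin : ∑ T ∈ 𝒯.cells, G T ≠ ⊤ := by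
    have := hφ.memLp_gradient.eLpNorm_ne_top
    rw [eLpNorm_two_eq] at this
    rw [hsum]
    exact fun h => this (by rw [h]; norm_num)
  have htot := 𝒯.sum_star_le hN G
  have htot' : (N * (d + 1) * ∑ T ∈ 𝒯.cells, G T : ℝ≥0∞) ≠ ⊤ :=
    ENNReal.mul_ne_top (by finiteness) hfin
  have hQfin (T) (hT : T ∈ 𝒯.cells) : Q T ≠ ⊤ :=
    ((Finset.single_le_sum (f := Q) (fun _ _ => zero_le) hT).trans_lt
        (htot.trans_lt htot'.lt_top)).ne
  refine ⟨m, hm, fun T => (Q T ^ (1 / 2 : ℝ)).toReal, fun T hT => ⟨by positivity, ?_, ?_⟩, ?_⟩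
  · have hc := 𝒯.isCell hT
    have h1 : ∑ z ∈ T, ∫⁻ x in simplex T, ‖φ x - m z‖ₑ ^ 2
        ≤ C * ENNReal.ofReal (size T) ^ 2 * Q T := by
      rw [hQ, Finset.mul_sum]
      exact Finset.sum_le_sum fun z hz =>
        hest z (𝒯.mem_vertices.2 ⟨T, hT, hz⟩) T (𝒯.mem_star.2 ⟨hT, hz⟩)
    have h2 : ∫⁻ x in simplex T, ‖φ x - interp m T x‖ₑ ^ 2
        ≤ (C₁ * ENNReal.ofReal (size T) ^ 2) * Q T := by
      refine (hc.lintegral_sub_interp_le hφ.contDiff.continuous).trans ?_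
      calc _ ≤ (d + 1) * (C * ENNReal.ofReal (size T) ^ 2 * Q T) := by gcongr
        _ = _ := by ring
    refine (l2norm_le_of_lintegral_le (by finiteness) (hQfin T hT) h2).trans ?_
    rw [ENNReal.toReal_mul, ENNReal.toReal_pow, ENNReal.toReal_ofReal size_nonneg,
      Real.sqrt_mul ENNReal.toReal_nonneg, Real.sqrt_sq size_nonneg]
    have h0 : (0 : ℝ) ≤ size T := size_nonneg
    gcongr
    linarith [Real.sqrt_nonneg C₂.toReal, show (0 : ℝ) ≤ N * (d + 1) by positivity]
  · have hc := 𝒯.isCell hT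
    have hs := hc.size_pos (by omega)
    have h1 : ∑ z ∈ T, ∫⁻ x in simplex T, ‖φ x - m z‖ₑ ^ 2
        ≤ C * ENNReal.ofReal (size T) ^ 2 * Q T := by
      rw [hQ, Finset.mul_sum]
      exact Finset.sum_le_sum fun z hz =>
        hest z (𝒯.mem_vertices.2 ⟨T, hT, hz⟩) T (𝒯.mem_star.2 ⟨hT, hz⟩)
    have h3 : G T ≤ Q T := by
      obtain ⟨z, hz⟩ : T.Nonempty := Finset.card_pos.1 (by rw [hc.card_eq]; omega)
      exact (Finset.single_le_sum (f := G) (fun _ _ => zero_le) (𝒯.mem_star.2 ⟨hT, hz⟩)).trans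
        (Finset.single_le_sum (f := fun z => ∑ T' ∈ 𝒯.star z, G T') (fun _ _ => zero_le) hz)
    have h2 : ∫⁻ x in simplex T, ‖fderiv ℝ (fun x => φ x - interp m T x) x‖ₑ ^ 2 ≤ C₂ * Q T := by
      have hs' : ENNReal.ofReal (size T) ^ 2 ≠ 0 := by simpa using hs
      rw [← ENNReal.mul_le_mul_iff_right hs' (by finiteness)]
      refine (hc.lintegral_fderiv_sub_interp_le hφ.contDiff_one (by linarith) (hreg T hT)).trans ?_
      calc _ ≤ 2 * ENNReal.ofReal (size T) ^ 2 * Q T + 2 * (d + 1) * ENNReal.ofReal σ ^ 2 *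
            (C * ENNReal.ofReal (size T) ^ 2 * Q T) := by gcongr
        _ = _ := by ring
    refine (l2norm_le_of_lintegral_le hC₂ (hQfin T hT) h2).trans ?_
    gcongr
    linarith [Real.sqrt_nonneg C₁.toReal, show (0 : ℝ) ≤ N * (d + 1) by positivity]
  · simp_rw [toReal_rpow_half_sq]
    rw [l2norm, eLpNorm_two_eq, toReal_rpow_half_sq, ← hsum, ← ENNReal.toReal_sum hQfin]
    refine (ENNReal.toReal_mono htot' htot).trans ?_
    rw [ENNReal.toReal_mul, ENNReal.toReal_mul]
    have : ((N : ℝ≥0∞)).toReal * ((d : ℝ≥0∞) + 1).toReal = N * (d + 1) := by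
      rw [ENNReal.toReal_add (by simp) (by simp)]; simp
    rw [this]
    gcongr
    linarith [Real.sqrt_nonneg C₁.toReal, Real.sqrt_nonneg C₂.toReal]

end

/-! ### Sides of simplices and their surface measure -/

section

variable {d : ℕ} {Ω : Set (E d)} {T F : Finset (E d)} {z : E d}

lemma card_face (hF : ∀ v, v ∈ F ↔ v ∈ T ∧ v ≠ z) (hz : z ∈ T) : F.card + 1 = T.card := by
  classical
  have : F = T.erase z := by ext v; rw [hF, Finset.mem_erase, and_comm]
  rw [this, Finset.card_erase_add_one hz]

/-- The direction of a side is the kernel of the opposite barycentric coordinate. -/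
lemma IsCell.mem_vectorSpan_face (hT : IsCell T) (hd : 1 ≤ d) (hF : ∀ v, v ∈ F ↔ v ∈ T ∧ v ≠ z)
    (hz : z ∈ T) {u : E d} :
    u ∈ vectorSpan ℝ (F : Set (E d)) ↔ inner ℝ (agrad (lam T z)) u = 0 := by
  classical
  constructor
  · intro hu
    rw [vectorSpan_def] at hu
    induction hu using Submodule.span_induction with
    | mem x hx =>
      obtain ⟨a, ha, b, hb, rfl⟩ := hx
      have ha' := (hF a).1 ha
      have hb' := (hF b).1 hb
      have := affine_eq (lam T z) a b
      rw [hT.lam_ne hz ha'.1 ha'.2, hT.lam_ne hz hb'.1 hb'.2] at this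
      simp only [vsub_eq_sub]
      linarith
    | zero => simp
    | add x y _ _ hx hy => rw [inner_add_right, hx, hy, add_zero]
    | smul a x _ hx => rw [inner_smul_right, hx, mul_zero]
  · intro hu
    obtain ⟨w, hw⟩ : F.Nonempty := by
      have := card_face hF hz
      rw [hT.card_eq] at this
      exact Finset.card_pos.1 (by omega)
    have h0 : ∑ v ∈ T, inner ℝ (agrad (lam T v)) u = 0 := by
      rw [← sum_inner, hT.sum_agrad, inner_zero_left]
    have h1 : u = ∑ v ∈ T, inner ℝ (agrad (lam T v)) u • (v - w) := by
      simp_rw [smul_sub, Finset.sum_sub_distrib, ← Finset.sum_smul, h0, zero_smul, sub_zero]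
      exact (hT.sum_inner_agrad_smul u).symm
    rw [h1]
    refine Submodule.sum_mem _ fun v hv => ?_
    by_cases hvz : v = z
    · rw [hvz, hu, zero_smul]; exact Submodule.zero_mem _
    · exact Submodule.smul_mem _ _ (vsub_mem_vectorSpan ℝ ((hF v).2 ⟨hv, hvz⟩) hw)

/-- The side lies in the zero set of the opposite coordinate, so ∇λ_z is normal to it. It points
towards T because the coordinate rises from 0 at the barycentre of the side to 1/(d + 1) at that of
T. -/
lemma IsCell.unitNormal_eq (hT : IsCell T) (hd : 1 ≤ d) (hF : ∀ v, v ∈ F ↔ v ∈ T ∧ v ≠ z)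
    (hz : z ∈ T) :
    unitNormal F T = ‖agrad (lam T z)‖⁻¹ • agrad (lam T z) := by
  set g := agrad (lam T z) with hg
  have hg0 : 0 < ‖g‖ := hT.agrad_pos hd hz
  set w := barycentre T - barycentre F with hw
  have hcard := card_face hF hz
  rw [hT.card_eq] at hcard
  have hpos : 0 < inner ℝ g w := by
    have h1 := hT.barycentre_lam hz
    have h2 : lam T z (barycentre F) = 0 := by
      rw [affine_eq _ _ z, hT.lam_self hz, barycentre]
      have : (F.card : ℝ)⁻¹ • ∑ v ∈ F, v - z = (F.card : ℝ)⁻¹ • ∑ v ∈ F, (v - z) := by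
        rw [Finset.sum_sub_distrib, smul_sub, Finset.sum_const, ← Nat.cast_smul_eq_nsmul ℝ,
            smul_smul,
          inv_mul_cancel₀ (by norm_cast; omega), one_smul]
      rw [this, inner_smul_right, inner_sum, Finset.sum_congr rfl (g := fun _ => (-1 : ℝ))]
      · rw [Finset.sum_const, nsmul_eq_mul, ← mul_assoc, inv_mul_cancel₀ (by norm_cast; omega)]
        ring
      · intro v hv
        have hv' := (hF v).1 hv
        have := affine_eq (lam T z) v z
        rw [hT.lam_ne hz hv'.1 hv'.2, hT.lam_self hz] at this
        linarith
    have h3 := affine_eq (lam T z) (barycentre T) (barycentre F)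
    rw [h1, h2, hT.card_eq] at h3
    have : (0 : ℝ) < ((d + 1 : ℕ) : ℝ)⁻¹ := by positivity
    linarith
  have hn : (vectorSpan ℝ (F : Set (E d)))ᗮ.starProjection w = (inner ℝ g w / ‖g‖ ^ 2) • g := by
    refine Submodule.eq_starProjection_of_mem_orthogonal
      (K := (vectorSpan ℝ (F : Set (E d)))ᗮ) ?_ ?_
    · refine Submodule.smul_mem _ _ ((Submodule.mem_orthogonal' _ _).2 fun u hu => ?_)
      exact (hT.mem_vectorSpan_face hd hF hz).1 hu
    · refine Submodule.le_orthogonal_orthogonal _ ((hT.mem_vectorSpan_face hd hF hz).2 ?_)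
      rw [← hg, inner_sub_right, inner_smul_right, real_inner_self_eq_norm_sq]
      field_simp
      ring
  rw [unitNormal]
  simp only [← hw, hn]
  rw [norm_smul, Real.norm_of_nonneg (by positivity), smul_smul]
  congr 1
  field_simp

/-- The inscribed ball is projected from z onto the opposite side. The factor 1/s of this projection
is at least 1, so the image of its section parallel to the side contains a disc of the same radius.
-/
lemma IsCell.exists_ball_face (hT : IsCell T) (hd : 1 ≤ d) (hF : ∀ v, v ∈ F ↔ v ∈ T ∧ v ≠ z)
    (hz : z ∈ T) {c : E d} {r : ℝ} (hr : 0 < r) (hc : Metric.closedBall c r ⊆ simplex T) :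
    ∃ c' ∈ simplex F, ∀ u, inner ℝ (agrad (lam T z)) u = 0 → ‖u‖ ≤ r → c' + u ∈ simplex F := by
  set s := 1 - lam T z c with hs
  have hcint : c ∈ interior (simplex T) :=
    mem_interior_iff_mem_nhds.2 (Filter.mem_of_superset (Metric.closedBall_mem_nhds c hr) hc)
  have hs1 : s < 1 := by linarith [hT.mem_interior.1 hcint z hz]
  have hs0 : 0 < s := by
    obtain ⟨w, hw⟩ : F.Nonempty := by
      have := card_face hF hz
      rw [hT.card_eq] at this
      exact Finset.card_pos.1 (by omega)
    have hw' := (hF w).1 hw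
    have h1 := Finset.sum_lt_sum_of_subset (f := fun v => lam T v c)
        (Finset.singleton_subset_iff.2 hz)
      hw'.1 (by simpa using hw'.2) (hT.mem_interior.1 hcint w hw'.1)
      (fun v hv _ => (hT.mem_interior.1 hcint v hv).le)
    rw [hT.sum_lam, Finset.sum_singleton] at h1
    linarith
  have main (u : E d) (hu : inner ℝ (agrad (lam T z)) u = 0) (hur : ‖u‖ ≤ r) :
      z + s⁻¹ • (c - z) + u ∈ simplex F := by
    have heq : z + s⁻¹ • (c - z) + u = z + s⁻¹ • ((c + s • u) - z) := by
      rw [add_sub_right_comm, smul_add, smul_smul, inv_mul_cancel₀ hs0.ne', one_smul, add_assoc]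
    have hy : c + s • u ∈ simplex T := by
      refine hc ?_
      rw [mem_closedBall_iff_norm, add_sub_cancel_left, norm_smul, Real.norm_of_nonneg hs0.le]
      nlinarith [norm_nonneg u]
    have hFT : (F : Set (E d)) ⊆ T := fun v hv => ((hF v).1 hv).1
    have hz0 : lam T z (z + s⁻¹ • (c - z) + u) = 0 := by
      rw [heq, hT.lam_dilate_self hz, affine_eq _ (c + s • u) c, add_sub_cancel_left,
          inner_smul_right,
        hu, mul_zero, add_zero]
      field_simp
      linarith
    refine (hT.mem_convexHull_face hFT).2 ⟨hT.mem_simplex.2 fun v hv => ?_, fun v hv hvF => ?_⟩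
    · by_cases hvz : v = z
      · rw [hvz, hz0]
      · rw [heq, hT.lam_dilate hz hv hvz]
        exact mul_nonneg (by positivity) (hT.mem_simplex.1 hy v hv)
    · have hvz : v = z := by
        by_contra hvz
        exact hvF ((hF v).2 ⟨hv, hvz⟩)
      rw [hvz, hz0]
  refine ⟨z + s⁻¹ • (c - z), ?_, main⟩
  simpa using main 0 (by simp) (by simpa using hr.le)

lemma IsCell.finrank_vectorSpan_face (hT : IsCell T) (hd : 1 ≤ d) (hF : ∀ v, v ∈ F ↔ v ∈ T ∧ v ≠ z)
    (hz : z ∈ T) : Module.finrank ℝ (vectorSpan ℝ (F : Set (E d))) = d - 1 := by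
  have hFT : (F : Set (E d)) ⊆ T := fun v hv => ((hF v).1 hv).1
  have hind : AffineIndependent ℝ ((↑) : F → E d) :=
    AffineIndependent.mono (s := (F : Set (E d))) (t := (T : Set (E d))) hT.indep hFT
  have hcard := card_face hF hz
  rw [hT.card_eq] at hcard
  have := hind.finrank_vectorSpan (n := d - 1) (by rw [Fintype.card_coe]; omega)
  rwa [Subtype.range_coe_subtype, Finset.setOfPred_mem] at this

/-- The surface measure of a side of a shape regular cell. -/
lemma IsCell.exists_isometry_face (hT : IsCell T) (hd : 1 ≤ d) (hF : ∀ v, v ∈ F ↔ v ∈ T ∧ v ≠ z)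
    (hz : z ∈ T) {c : E d} {r : ℝ} (hr : 0 < r) (hc : Metric.closedBall c r ⊆ simplex T) :
    μHE[d - 1] (simplex F) ≠ ⊤ ∧
      r ^ (d - 1) * volume.real (Metric.ball (0 : E (d - 1)) 1)
          ≤ (μHE[d - 1]).real (simplex F) := by
  obtain ⟨c', hc', hball⟩ := hT.exists_ball_face hd hF hz hr hc
  have hrank := hT.finrank_vectorSpan_face hd hF hz
  set K := vectorSpan ℝ (F : Set (E d))
  let L : E (d - 1) ≃ₗᵢ[ℝ] K :=
    ((stdOrthonormalBasis ℝ K).reindex (finCongr hrank)).repr.symm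
  -- An isometric parametrization of the hyperplane of the side; it turns the surface measure of
  -- discs into Lebesgue measure in dimension d − 1.
  set f : E (d - 1) → E d := fun y => c' + (L y : E d) with hf
  have hiso : Isometry f := by
    refine Isometry.of_dist_eq fun x y => ?_
    rw [hf, dist_add_left, ← Subtype.dist_eq, L.dist_map]
  have hsubT : simplex F ⊆ simplex T := convexHull_mono fun v hv => ((hF v).1 hv).1
  have h1 : f '' Metric.closedBall 0 r ⊆ simplex F := by
    rintro _ ⟨y, hy, rfl⟩
    refine hball _ ((hT.mem_vectorSpan_face hd hF hz).1 (L y).2) ?_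
    rw [← Submodule.coe_norm, L.norm_map]
    simpa using hy
  have h2 : simplex F ⊆ f '' Metric.closedBall 0 (size T) := by
    intro x hx
    have hxK : x - c' ∈ K := by
      have := vsub_mem_vectorSpan_of_mem_affineSpan_of_mem_affineSpan (k := ℝ)
          (convexHull_subset_affineSpan _ hx) (convexHull_subset_affineSpan _ hc')
      exact this
    refine ⟨L.symm ⟨x - c', hxK⟩, ?_, ?_⟩
    · rw [mem_closedBall_zero_iff, L.symm.norm_map]
      exact norm_sub_le_size (hsubT hx) (hsubT hc')
    · simp [hf]
  have hvol (R : ℝ) : μHE[d - 1] (f '' Metric.closedBall 0 R)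
      = volume (Metric.closedBall (0 : E (d - 1)) R) := by
    rw [hiso.euclideanHausdorffMeasure_image, EuclideanSpace.euclideanHausdorffMeasure_eq_volume]
  have hfin : μHE[d - 1] (simplex F) ≠ ⊤ := by
    refine ((measure_mono h2).trans_lt ?_).ne
    rw [hvol]
    exact measure_closedBall_lt_top
  refine ⟨hfin, ?_⟩
  rw [← volume_real_closedBall 0 hr.le, measureReal_def, ← hvol r]
  exact ENNReal.toReal_mono hfin (measure_mono h1)

/-- The volume of a shape regular cell is bounded by its size times the area of each side. -/
lemma exists_volume_le_side (hd : 1 ≤ d) {σ : ℝ} (hσ : 0 < σ) :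
    ∃ C : ℝ, 0 ≤ C ∧ ∀ T : Finset (E d), IsCell T → CellRegular σ T → ∀ z ∈ T, ∀ F : Finset (E d),
      (∀ v, v ∈ F ↔ v ∈ T ∧ v ≠ z) → μHE[d - 1] (simplex F) ≠ ⊤ ∧
        volume.real (simplex T) ≤ C * size T * (μHE[d - 1]).real (simplex F) := by
  set V := volume.real (Metric.ball (0 : E d) 1)
  set V' := volume.real (Metric.ball (0 : E (d - 1)) 1)
  have hV : 0 < V := volume_real_unitBall_pos
  have hV' : 0 < V' := volume_real_unitBall_pos
  -- The cell has volume at most hᵈ V, its size satisfies h ≤ 2σr, and each side has area at least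
  -- rᵈ⁻¹ V'.
  refine ⟨V * (2 * σ) ^ (d - 1) / V', by positivity, fun T hT ⟨c, r, hr, hc, hsz⟩ z hz F hF => ?_⟩
  obtain ⟨hfin, hle⟩ := hT.exists_isometry_face hd hF hz hr hc
  refine ⟨hfin, ?_⟩
  have h0 : 0 ≤ size T := size_nonneg
  have h1 : volume.real (simplex T) ≤ size T ^ d * V := by
    rw [← volume_real_closedBall z h0]
    refine measureReal_mono (fun x hx => ?_) measure_closedBall_lt_top.ne
    rw [mem_closedBall_iff_norm]
    exact norm_sub_le_size hx (mem_simplex_of_mem hz)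
  calc volume.real (simplex T) ≤ size T ^ d * V := h1
    _ = size T ^ (d - 1) * size T * V := by rw [← pow_succ, Nat.sub_add_cancel hd]
    _ ≤ (σ * (2 * r)) ^ (d - 1) * size T * V := by gcongr
    _ = V * (2 * σ) ^ (d - 1) / V' * size T * (r ^ (d - 1) * V') := by
        rw [← mul_assoc, mul_pow, mul_pow, mul_pow]
        field_simp
    _ ≤ _ := by gcongr

end

/-! ### Fluxes through the sides -/

section

variable {d : ℕ} {Ω : Set (E d)} {T T' F : Finset (E d)} {z : E d} {m : E d → ℝ}

lemma l2norm_nonneg {F : Type*} [NormedAddCommGroup F] {A : Set (E d)} {f : E d → F} :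
    0 ≤ l2norm A f := ENNReal.toReal_nonneg

lemma memLp_simplex_of_continuous {G : Type*} [NormedAddCommGroup G] {f : E d → G}
    (hf : Continuous f) : MemLp f 2 (volume.restrict (simplex T)) := by
  have : IsFiniteMeasure (volume.restrict (simplex T)) :=
    ⟨by rw [Measure.restrict_apply_univ]; exact isCompact_simplex.measure_lt_top⟩
  obtain ⟨K, hK⟩ := (isCompact_simplex (T := T)).exists_bound_of_continuousOn hf.continuousOn
  exact MemLp.of_bound (hf.continuousOn.aestronglyMeasurable_of_isCompact isCompact_simplex
    measurableSet_simplex) K (ae_restrict_of_forall_mem measurableSet_simplex hK)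

lemma integral_simplex_le_l2norm {f : E d → ℝ} (hf : Continuous f) :
    |∫ x in simplex T, f x| ≤ √(volume.real (simplex T)) * l2norm (simplex T) f := by
  have h := abs_integral_mul_le
      (memLp_simplex_of_continuous (T := T) (continuous_const (y := (1 : ℝ))))
    (memLp_simplex_of_continuous hf)
  simp only [one_mul] at h
  refine h.trans (le_of_eq ?_)
  congr 1
  rw [eLpNorm_two_eq, Real.sqrt_eq_rpow, ← ENNReal.toReal_rpow]
  simp [measureReal_def]

/-- This takes the place of the trace inequality. -/
lemma IsCell.abs_vertexFlux_le (hz : z ∈ T) {w : E d → ℝ} (hw : ContDiff ℝ 1 w) :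
    |vertexFlux T z w| ≤ √(volume.real (simplex T)) *
      (d * l2norm (simplex T) w + size T * l2norm (simplex T) (fderiv ℝ w)) := by
  have hc := hw.continuous
  have hc' := hw.continuous_fderiv one_ne_zero
  have h1 := integral_simplex_le_l2norm (T := T) hc.norm
  have h2 := integral_simplex_le_l2norm (T := T) hc'.norm
  have e1 : l2norm (simplex T) (fun x => ‖w x‖) = l2norm (simplex T) w := by
    rw [l2norm, eLpNorm_norm, l2norm]
  have e2 : l2norm (simplex T) (fun x => ‖fderiv ℝ w x‖) = l2norm (simplex T) (fderiv ℝ w) := by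
    rw [l2norm, eLpNorm_norm, l2norm]
  rw [e1] at h1
  rw [e2] at h2
  have hi1 := integrableOn_simplex_of_continuous (T := T) hc.norm
  have hi2 := integrableOn_simplex_of_continuous (T := T) hc'.norm
  have h0 : 0 ≤ size T := size_nonneg
  calc |vertexFlux T z w| ≤ ∫ x in simplex T, ‖d * w x + fderiv ℝ w x (x - z)‖ := by
        rw [vertexFlux, ← Real.norm_eq_abs]
        exact norm_integral_le_integral_norm _
    _ ≤ ∫ x in simplex T, (d * ‖w x‖ + size T * ‖fderiv ℝ w x‖) := by
        refine setIntegral_mono_on ?_ ?_ measurableSet_simplex fun x hx => ?_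
        · exact (integrableOn_simplex_of_continuous (continuous_vertexFlux_integrand hw)).norm
        · exact (hi1.const_mul _).add (hi2.const_mul _)
        · refine (norm_add_le _ _).trans ?_
          rw [norm_mul, Real.norm_natCast]
          gcongr
          refine ((fderiv ℝ w x).le_opNorm _).trans ?_
          rw [mul_comm]
          gcongr
          exact norm_sub_le_size hx (mem_simplex_of_mem hz)
    _ = d * (∫ x in simplex T, ‖w x‖) + size T * ∫ x in simplex T, ‖fderiv ℝ w x‖ := by
        rw [integral_add (hi1.const_mul _) (hi2.const_mul _), integral_const_mul,
            integral_const_mul]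
    _ ≤ d * (√(volume.real (simplex T)) * l2norm (simplex T) w)
          + size T * (√(volume.real (simplex T)) * l2norm (simplex T) (fderiv ℝ w)) := by
        gcongr
        · exact (le_abs_self _).trans h1
        · exact (le_abs_self _).trans h2
    _ = _ := by ring

lemma contDiff_sub_interp {φ : E d → ℝ} (hφ : ContDiff ℝ 1 φ) (m : E d → ℝ) (T : Finset (E d)) :
    ContDiff ℝ 1 fun x => φ x - interp m T x :=
  hφ.sub (contDiff_affine _)

namespace Mesh
variable (𝒯 : Mesh Ω)

/-- The flux of `w` through the common side of two neighbours. -/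
def sideFlux (T T' : Finset (E d)) (w : E d → ℝ) : ℝ :=
  open Classical in ∑ z ∈ T \ T', ‖agrad (lam T z)‖ * vertexFlux T z w

lemma sideNeighbours_symm (hT : T ∈ 𝒯.cells) (h : T' ∈ sideNeighbours 𝒯 T) :
    T ∈ sideNeighbours 𝒯 T' := by
  classical
  rw [mem_sideNeighbours] at h ⊢
  refine ⟨hT, ?_⟩
  rw [Finset.inter_comm]
  convert h.2

lemma exists_opposite_vertex (hT : T ∈ 𝒯.cells) (h : T' ∈ sideNeighbours 𝒯 T) :
    ∃ z ∈ T, ∃ z' ∈ T', z ∉ T' ∧ z' ∉ T ∧ (∀ v, v ∈ T ∧ v ∈ T' ↔ v ∈ T ∧ v ≠ z) ∧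
      (∀ v, v ∈ T ∧ v ∈ T' ↔ v ∈ T' ∧ v ≠ z') := by
  classical
  rw [mem_sideNeighbours] at h
  obtain ⟨z, hz, z', hz', h1, h2, h3, h4⟩ := 𝒯.exists_opposite hT h.1 h.2
  refine ⟨z, hz, z', hz', h1, h2, fun v => ?_, fun v => ?_⟩
  · rw [and_comm (b := v ≠ z), ← Finset.mem_inter, ← Finset.mem_erase]
    convert Finset.ext_iff.1 h3.symm v
  · rw [and_comm (b := v ≠ z'), ← Finset.mem_inter, ← Finset.mem_erase]
    convert Finset.ext_iff.1 h4.symm v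

-- The sum in `sideFlux` avoids choosing the opposite vertex; for neighbours it has this single
-- term.
open Classical in
lemma sdiff_eq_singleton (hz : z ∈ T) (h : ∀ v, v ∈ T ∧ v ∈ T' ↔ v ∈ T ∧ v ≠ z) : T \ T' = {z} := by
  ext v
  rw [Finset.mem_sdiff, Finset.mem_singleton]
  have := h v
  constructor
  · rintro ⟨h1, h2⟩
    by_contra h3
    exact h2 (this.2 ⟨h1, h3⟩).2
  · rintro rfl
    exact ⟨hz, fun h2 => (this.1 ⟨hz, h2⟩).2 rfl⟩

/-- The two interpolants share their nodal values on the common side, so the two errors agree there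
and have the same flux. -/
lemma sideFlux_symm (hT : T ∈ 𝒯.cells) (h : T' ∈ sideNeighbours 𝒯 T) {φ : E d → ℝ}
    (hφ : ContDiff ℝ 1 φ) :
    sideFlux T T' (fun x => φ x - interp m T x) = sideFlux T' T (fun x => φ x - interp m T' x) := by
  classical
  have hT' := (𝒯.mem_sideNeighbours.1 h).1
  obtain ⟨z, hz, z', hz', -, -, h3, h4⟩ := 𝒯.exists_opposite_vertex hT h
  have e1 := sdiff_eq_singleton hz h3
  have e2 := sdiff_eq_singleton (T := T') (T' := T) hz' (fun v => by rw [and_comm, h4])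
  rw [sideFlux, sideFlux, show T \ T' = {z} by convert e1, show T' \ T = {z'} by convert e2,
    Finset.sum_singleton, Finset.sum_singleton]
  have hc := 𝒯.isCell hT
  have hc' := 𝒯.isCell hT'
  refine hc.vertexFlux_mul_eq hc' hz hz' ?_ (contDiff_sub_interp hφ m T)
      (contDiff_sub_interp hφ m T') ?_
  · ext v
    rw [Finset.mem_erase, Finset.mem_erase, and_comm, ← h3, h4, and_comm]
  · intro x hx hx0
    have hx' : x ∈ simplex T' := by
      have : x ∈ convexHull ℝ ((T : Set (E d)) ∩ T') := by
        refine (hc.mem_convexHull_face Set.inter_subset_left).2 ⟨hx, fun v hv hvF => ?_⟩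
        have : v = z := by
          by_contra hne
          exact hvF ((h3 v).2 ⟨hv, hne⟩)
        rw [this, hx0]
      exact convexHull_mono Set.inter_subset_right this
    rw [𝒯.affine_eq_of_common hT hT' hx hx' (l := interp m T) (m := interp m T')]
    intro v hv hv'
    rw [hc.interp_self hv, hc'.interp_self hv']

/-- There is no flux through the sides on the boundary. -/
lemma vertexFlux_eq_zero_of_no_neighbour (hd : 1 ≤ d) (hΩ : IsLipschitzDomain Ω) (hT : T ∈ 𝒯.cells)
    (hz : z ∈ T) (hno : ∀ T' ∈ sideNeighbours 𝒯 T, z ∈ T') {φ : E d → ℝ} (hφ : IsTest Ω φ)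
    (hm : ∀ z ∈ 𝒯.vertices, z ∉ Ω → m z = 0) :
    vertexFlux T z (fun x => φ x - interp m T x) = 0 := by
  have hc := 𝒯.isCell hT
  refine hc.vertexFlux_eq_zero hz (contDiff_sub_interp hφ.contDiff_one m T) fun x hx hx0 => ?_
  -- The face contains no point of Ω, so both φ and the nodal values at its vertices vanish.
  rw [hφ.eq_zero (𝒯.notMem_of_no_neighbour hd hΩ hT hz hno hx hx0), interp_apply,
    Finset.sum_eq_zero, sub_zero]
  intro v hv
  by_cases hvz : v = z
  · rw [hvz, hx0, zero_mul]
  · rw [hm v (𝒯.mem_vertices.2 ⟨T, hT, hv⟩) (𝒯.notMem_of_no_neighbour hd hΩ hT hz hno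
      (mem_simplex_of_mem hv) (hc.lam_ne hz hv hvz)), mul_zero]

-- A vertex stands for its opposite face. At most one neighbour lies across that face, and if there
-- is none the term vanishes by assumption.
open Classical in
lemma sum_eq_sum_sideNeighbours (hd : 1 ≤ d) (hT : T ∈ 𝒯.cells) {f : E d → ℝ}
    (hf : ∀ z ∈ T, (∀ T' ∈ sideNeighbours 𝒯 T, z ∈ T') → f z = 0) :
    ∑ z ∈ T, f z = ∑ T' ∈ sideNeighbours 𝒯 T, ∑ z ∈ T \ T', f z := by
  rw [Finset.sum_comm' (s' := fun z => {T' ∈ sideNeighbours 𝒯 T | z ∉ T'}) (t' := T)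
    (by intro x y; simp only [Finset.mem_sdiff, Finset.mem_filter]; tauto)]
  refine Finset.sum_congr rfl fun z hz => ?_
  by_cases h : ∀ T' ∈ sideNeighbours 𝒯 T, z ∈ T'
  · rw [hf z hz h, Finset.sum_const_zero]
  · push Not at h
    obtain ⟨T', hT', hzT'⟩ := h
    rw [Finset.sum_eq_single T' (fun S hS hne => ?_) (fun hn => ?_)]
    · rw [Finset.mem_filter] at hS
      exact absurd (𝒯.neighbour_unique hd hT hz hS.1 hT' hS.2 hzT') hne
    · exact absurd (Finset.mem_filter.2 ⟨hT', hzT'⟩) hn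

/-- A neighbour is determined by the vertex of T that it misses. -/
lemma card_sideNeighbours_le (hd : 1 ≤ d) (hT : T ∈ 𝒯.cells) :
    (sideNeighbours 𝒯 T).card ≤ d + 1 := by
  have hex (T' : Finset (E d)) (h : T' ∈ sideNeighbours 𝒯 T) : ∃ z ∈ T, z ∉ T' := by
    obtain ⟨z, hz, -, -, hz', -⟩ := 𝒯.exists_opposite_vertex hT h
    exact ⟨z, hz, hz'⟩
  choose! o ho ho' using hex
  rw [← 𝒯.card_eq T hT]
  refine Finset.card_le_card_of_injOn o ho fun S hS S' hS' h => ?_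
  exact 𝒯.neighbour_unique hd hT (ho S hS) hS hS' (ho' S hS) (h ▸ ho' S' hS')

open Classical in
/-- Rearrangement of the boundary terms of the cells by sides. -/
theorem sum_flux_eq (hd : 1 ≤ d) (hΩ : IsLipschitzDomain Ω) {φ : E d → ℝ} (hφ : IsTest Ω φ)
    (hm : ∀ z ∈ 𝒯.vertices, z ∉ Ω → m z = 0) (q : E d → ℝ) :
    ∑ T ∈ 𝒯.cells, ∑ z ∈ T, inner ℝ (gradOn q T) (agrad (lam T z)) *
        vertexFlux T z (fun x => φ x - interp m T x)
      = 1 / 2 * ∑ T ∈ 𝒯.cells, ∑ T' ∈ sideNeighbours 𝒯 T,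
        jump q T T' * sideFlux T T' (fun x => φ x - interp m T x) := by
  set w : Finset (E d) → E d → ℝ := fun T x => φ x - interp m T x
  -- The contribution of T to the jump term on the side shared with T'. The factor ‖∇λ_z‖ inside
  -- `sideFlux` compensates the normalization of the normal.
  set I : Finset (E d) → Finset (E d) → ℝ := fun T T' =>
    inner ℝ (unitNormal (T ∩ T') T) (gradOn q T) * sideFlux T T' (w T)
  have h1 (T) (hT : T ∈ 𝒯.cells) : ∑ z ∈ T, inner ℝ (gradOn q T) (agrad (lam T z)) *
      vertexFlux T z (w T) = ∑ T' ∈ sideNeighbours 𝒯 T, I T T' := by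
    rw [𝒯.sum_eq_sum_sideNeighbours hd hT fun z hz hno => by
      rw [𝒯.vertexFlux_eq_zero_of_no_neighbour hd hΩ hT hz hno hφ hm, mul_zero]]
    refine Finset.sum_congr rfl fun T' hT' => ?_
    obtain ⟨z, hz, -, -, -, -, h3, -⟩ := 𝒯.exists_opposite_vertex hT hT'
    have hg := (𝒯.isCell hT).agrad_pos hd hz
    simp only [I, sideFlux]
    rw [sdiff_eq_singleton hz h3, Finset.sum_singleton, Finset.sum_singleton,
      (𝒯.isCell hT).unitNormal_eq hd (F := T ∩ T') (fun v => by rw [Finset.mem_inter, h3]) hz,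
      inner_smul_left, real_inner_comm]
    simp only [conj_trivial]
    field_simp
  -- Each interior side is visited from both of its cells; averaging the two orders of summation
  -- produces the jump and the factor 1/2.
  have h2 : ∑ T ∈ 𝒯.cells, ∑ T' ∈ sideNeighbours 𝒯 T, I T T'
      = ∑ T ∈ 𝒯.cells, ∑ T' ∈ sideNeighbours 𝒯 T, I T' T := by
    refine Finset.sum_comm' fun T T' => ?_
    constructor
    · rintro ⟨a, b⟩
      exact ⟨𝒯.sideNeighbours_symm a b, (𝒯.mem_sideNeighbours.1 b).1⟩
    · rintro ⟨a, b⟩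
      exact ⟨(𝒯.mem_sideNeighbours.1 a).1, 𝒯.sideNeighbours_symm b a⟩
  rw [Finset.sum_congr rfl h1]
  have h3 : ∑ T ∈ 𝒯.cells, ∑ T' ∈ sideNeighbours 𝒯 T, jump q T T' * sideFlux T T' (w T)
      = ∑ T ∈ 𝒯.cells, ∑ T' ∈ sideNeighbours 𝒯 T, (I T T' + I T' T) := by
    refine Finset.sum_congr rfl fun T hT => Finset.sum_congr rfl fun T' hT' => ?_
    simp only [I, jump]
    rw [← 𝒯.sideFlux_symm hT hT' hφ.contDiff_one, add_mul, Finset.inter_comm T' T]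
  rw [h3]
  simp_rw [Finset.sum_add_distrib]
  rw [← h2]
  ring

end Mesh

end

/-! ### The residual estimator -/

section

variable {d : ℕ} {Ω : Set (E d)} {T T' : Finset (E d)} {z : E d} {m : E d → ℝ}

/-- The square of the residual indicator of a cell for the equation `-Δq = g`. -/
def residualSq (𝒯 : Mesh Ω) (g q : E d → ℝ) (T : Finset (E d)) : ℝ :=
  size T ^ 2 * l2norm (simplex T) g ^ 2 + size T * jumpNormSq 𝒯 q T

lemma jumpNormSq_nonneg (𝒯 : Mesh Ω) (q : E d → ℝ) (T : Finset (E d)) : 0 ≤ jumpNormSq 𝒯 q T :=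
  Finset.sum_nonneg fun _ _ => integral_nonneg fun _ => sq_nonneg _

lemma residualSq_nonneg (𝒯 : Mesh Ω) (g q : E d → ℝ) (T : Finset (E d)) :
    0 ≤ residualSq 𝒯 g q T := by
  have := jumpNormSq_nonneg 𝒯 q T
  have : 0 ≤ size T := size_nonneg
  unfold residualSq
  positivity

lemma Mesh.memLp_simplex {G : Type*} [NormedAddCommGroup G] (𝒯 : Mesh Ω) (hΩ : IsLipschitzDomain Ω)
    (hT : T ∈ 𝒯.cells) {f : E d → G} (hf : MemLp f 2 (volume.restrict Ω)) :
    MemLp f 2 (volume.restrict (simplex T)) :=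
  hf.mono_measure (𝒯.restrict_le hΩ hT)

/-- The residual, tested with the interpolation error, cell by cell. -/
lemma Mesh.residual_eq (𝒯 : Mesh Ω) (hΩ : IsLipschitzDomain Ω) {g : E d → ℝ}
    (hg : MemLp g 2 (volume.restrict Ω)) {q : H01 Ω} (hq : q ∈ feSpace 𝒯)
    (heq : ∀ v ∈ feSpace 𝒯, ∫ x in Ω, inner ℝ (v.grad x) (q.grad x) = ∫ x in Ω, g x * v.toFun x)
    {φ : E d → ℝ} (hφ : IsTest Ω φ) (hm : ∀ z ∈ 𝒯.vertices, z ∉ Ω → m z = 0) :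
    (∫ x in Ω, g x * φ x) - ∫ x in Ω, inner ℝ (gradient φ x) (q.grad x)
      = ∑ T ∈ 𝒯.cells, ((∫ x in simplex T, g x * (φ x - interp m T x)) +
        ∑ z ∈ T, inner ℝ (gradOn q.toFun T) (agrad (lam T z)) *
          vertexFlux T z (fun x => φ x - interp m T x)) := by
  -- Galerkin orthogonality: the residual vanishes at v, so φ may be replaced by φ − v.
  obtain ⟨v, hv, hvT⟩ := 𝒯.exists_feSpace hΩ hm
  have i1 : Integrable (fun x => g x * φ x) (volume.restrict Ω) :=
      integrable_mul_of_memLp hg hφ.memLp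
  have i2 : Integrable (fun x => g x * v.toFun x) (volume.restrict Ω) :=
      integrable_mul_of_memLp hg v.memLp
  have i3 := integrable_inner_of_memLp hφ.memLp_gradient q.grad_memLp
  have i4 := integrable_inner_of_memLp v.grad_memLp q.grad_memLp
  have e1 : (∫ x in Ω, g x * φ x) - ∫ x in Ω, inner ℝ (gradient φ x) (q.grad x)
      = ∫ x in Ω, (g x * (φ x - v.toFun x) - inner ℝ (gradient φ x - v.grad x) (q.grad x)) := by
    have : (fun x => g x * (φ x - v.toFun x) - inner ℝ (gradient φ x - v.grad x) (q.grad x))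
        = fun x => (g x * φ x - g x * v.toFun x)
          - (inner ℝ (gradient φ x) (q.grad x) - inner ℝ (v.grad x) (q.grad x)) := by
      ext x; rw [mul_sub, inner_sub_left]
    have i12 : Integrable (fun x => g x * φ x - g x * v.toFun x) (volume.restrict Ω) := i1.sub i2
    have i34 : Integrable (fun x => inner ℝ (gradient φ x) (q.grad x)
      - inner ℝ (v.grad x) (q.grad x)) (volume.restrict Ω) := i3.sub i4
    rw [this, integral_sub i12 i34, integral_sub i1 i2, integral_sub i3 i4, heq v hv]
    ring
  have j1 : Integrable (fun x => g x * (φ x - v.toFun x)) (volume.restrict Ω) :=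
    integrable_mul_of_memLp hg (hφ.memLp.sub v.memLp)
  have j2 : Integrable (fun x => inner ℝ (gradient φ x - v.grad x) (q.grad x))
      (volume.restrict Ω) :=
    integrable_inner_of_memLp (hφ.memLp_gradient.sub v.grad_memLp) q.grad_memLp
  have j12 : IntegrableOn (fun x => g x * (φ x - v.toFun x)
      - inner ℝ (gradient φ x - v.grad x) (q.grad x)) Ω := j1.sub j2
  rw [e1, 𝒯.setIntegral_eq_sum hΩ j12]
  refine Finset.sum_congr rfl fun T hT => ?_
  have hc := 𝒯.isCell hT
  have hle := 𝒯.restrict_le hΩ hT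
  obtain ⟨ℓ, hℓ⟩ := hq.2 T hT
  have hw := contDiff_sub_interp hφ.contDiff_one m T
  rw [integral_sub (j1.mono_measure hle) (j2.mono_measure hle), sub_eq_add_neg]
  congr 1
  · exact setIntegral_congr_fun measurableSet_simplex fun x hx => by simp only [hvT T hT hx]
  -- Since q is affine on the cell, its gradient is a constant vector there and only face terms
  -- arise.
  · rw [neg_eq_iff_eq_neg, ← hc.integral_fderiv_eq hw, hc.gradOn_eq hℓ]
    apply integral_congr_ae
    filter_upwards [q.grad_eq (𝒯.interior_subset hΩ hT) hℓ,
      v.grad_eq (𝒯.interior_subset hΩ hT) (hvT T hT)] with x h1 h2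
    rw [h1, h2, ← inner_gradient]
    have hd : DifferentiableAt ℝ φ x := hφ.contDiff_one.differentiable one_ne_zero x
    have := hd.hasGradientAt.hasFDerivAt.sub (hasGradientAt_affine (interp m T) x).hasFDerivAt
    rw [← map_sub] at this
    rw [(show HasGradientAt (fun y => φ y - interp m T y) _ x from this).gradient]

/-- Bound of the jump terms of a cell. -/
lemma Mesh.sum_jump_le (𝒯 : Mesh Ω) (hd : 1 ≤ d) {σ : ℝ} (hσ : 0 < σ) {C K : ℝ}
    (hC : 0 ≤ C) (hK : 0 ≤ K)
    (hvol : ∀ T : Finset (E d), IsCell T → CellRegular σ T → ∀ z ∈ T, ∀ F : Finset (E d),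
      (∀ v, v ∈ F ↔ v ∈ T ∧ v ≠ z) → μHE[d - 1] (simplex F) ≠ ⊤ ∧
        volume.real (simplex T) ≤ C * size T * (μHE[d - 1]).real (simplex F))
    (hT : T ∈ 𝒯.cells) (hreg : CellRegular σ T) (q : E d → ℝ) {w : E d → ℝ}
    (hw : ContDiff ℝ 1 w) {P : ℝ}
    (hP : 0 ≤ P) (h1 : l2norm (simplex T) w ≤ K * size T * P)
    (h2 : l2norm (simplex T) (fderiv ℝ w) ≤ K * P) :
    ∑ T' ∈ sideNeighbours 𝒯 T, |jump q T T' * sideFlux T T' w|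
      ≤ σ * (d + 1) ^ 2 * K * √C * √(size T * jumpNormSq 𝒯 q T) * P := by
  classical
  have hc := 𝒯.isCell hT
  have hs := hc.size_pos hd
  have hterm (T') (hT' : T' ∈ sideNeighbours 𝒯 T) : |jump q T T' * sideFlux T T' w|
      ≤ σ * (d + 1) * K * √C * √(size T * jumpNormSq 𝒯 q T) * P := by
    obtain ⟨z, hz, -, -, -, -, h3, -⟩ := 𝒯.exists_opposite_vertex hT hT'
    obtain ⟨hfin, hv⟩ := hvol T hc hreg z hz (T ∩ T') (fun v => by rw [Finset.mem_inter, h3])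
    set μ := (μHE[d - 1]).real (simplex (T ∩ T')) with hμ
    have hflux : |sideFlux T T' w| ≤ σ * (d + 1) * K * √(volume.real (simplex T)) * P := by
      rw [sideFlux, sdiff_eq_singleton hz h3, Finset.sum_singleton, abs_mul, abs_norm]
      have hb : d * l2norm (simplex T) w + size T * l2norm (simplex T) (fderiv ℝ w)
          ≤ size T * ((d + 1) * K * P) := by
        have a1 : (d : ℝ) * l2norm (simplex T) w ≤ d * (K * size T * P) := by gcongr
        have a2 : size T * l2norm (simplex T) (fderiv ℝ w) ≤ size T * (K * P) := by gcongr
        linarith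
      calc ‖agrad (lam T z)‖ * |vertexFlux T z w|
          ≤ ‖agrad (lam T z)‖ * (√(volume.real (simplex T)) * (size T * ((d + 1) * K * P))) := by
            gcongr
            exact (IsCell.abs_vertexFlux_le hz hw).trans (by gcongr)
        _ = (‖agrad (lam T z)‖ * size T) * (√(volume.real (simplex T)) * ((d + 1) * K * P)) := by
            ring
        _ ≤ σ * (√(volume.real (simplex T)) * ((d + 1) * K * P)) := by
            gcongr
            exact hc.agrad_mul_size_le hz hσ hreg
        _ = _ := by ring
    have hj : jump q T T' ^ 2 * μ ≤ jumpNormSq 𝒯 q T := by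
      have : ∫ _x in simplex (T ∩ T'), jump q T T' ^ 2 ∂(μHE[d - 1]) = jump q T T' ^ 2 * μ := by
        rw [setIntegral_const, smul_eq_mul, mul_comm]
      rw [← this, jumpNormSq]
      convert Finset.single_le_sum
          (f := fun S => ∫ _x in simplex (T ∩ S), jump q T S ^ 2 ∂(μHE[d - 1]))
        (fun S _ => integral_nonneg fun _ => sq_nonneg _) hT'
    -- The volume of the cell is at most C h times the area of the side, which turns the jump times
    -- √|T| into the weighted L² norm of the jump on the side.
    have hjv : |jump q T T'| * √(volume.real (simplex T)) ≤ √C * √(size T * jumpNormSq 𝒯 q T) := by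
      rw [← Real.sqrt_mul hC, ← Real.sqrt_sq_eq_abs, ← Real.sqrt_mul (sq_nonneg _)]
      apply Real.sqrt_le_sqrt
      calc jump q T T' ^ 2 * volume.real (simplex T)
          ≤ jump q T T' ^ 2 * (C * size T * μ) := by gcongr
        _ = C * (size T * (jump q T T' ^ 2 * μ)) := by ring
        _ ≤ _ := by gcongr
    calc |jump q T T' * sideFlux T T' w|
        ≤ |jump q T T'| * (σ * (d + 1) * K * √(volume.real (simplex T)) * P) := by
          rw [abs_mul]; gcongr
      _ = σ * (d + 1) * K * (|jump q T T'| * √(volume.real (simplex T))) * P := by ring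
      _ ≤ σ * (d + 1) * K * (√C * √(size T * jumpNormSq 𝒯 q T)) * P := by gcongr
      _ = _ := by ring
  refine (Finset.sum_le_card_nsmul _ _ _ hterm).trans ?_
  rw [nsmul_eq_mul]
  have hcard : ((sideNeighbours 𝒯 T).card : ℝ) ≤ d + 1 := by
    exact_mod_cast 𝒯.card_sideNeighbours_le hd hT
  calc _ ≤ (d + 1) * (σ * (d + 1) * K * √C * √(size T * jumpNormSq 𝒯 q T) * P) := by gcongr
    _ = _ := by ring

/-- Reliability of the residual estimator, in dual form. -/
theorem IsLipschitzDomain.exists_residual_bound (hΩ : IsLipschitzDomain Ω) (hd : 2 ≤ d) {σ : ℝ}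
    (hσ : 1 ≤ σ) :
    ∃ C : ℝ, 0 < C ∧ ∀ 𝒯 : Mesh Ω, (∀ T ∈ 𝒯.cells, CellRegular σ T) →
      ∀ (g : E d → ℝ), MemLp g 2 (volume.restrict Ω) → ∀ q ∈ feSpace 𝒯,
      (∀ v ∈ feSpace 𝒯, ∫ x in Ω, inner ℝ (v.grad x) (q.grad x) = ∫ x in Ω, g x * v.toFun x) →
      ∀ e : H01 Ω, (∫ x in Ω, g x * e.toFun x) - ∫ x in Ω, inner ℝ (e.grad x) (q.grad x)
        ≤ C * √(∑ T ∈ 𝒯.cells, residualSq 𝒯 g q.toFun T) * l2norm Ω e.grad := by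
  obtain ⟨K, hK, hqi⟩ := hΩ.exists_quasi_interpolant hd hσ
  obtain ⟨C, hC, hvol⟩ := exists_volume_le_side (d := d) (by omega) (show 0 < σ by linarith)
  have hσ0 : 0 < σ := by linarith
  set B : ℝ := K + σ * (d + 1) ^ 2 * K * √C with hB
  have hB0 : 0 ≤ B := by positivity
  -- The added 1 only secures positivity.
  refine ⟨B * √K + 1, by positivity, fun 𝒯 hreg g hg q hq heq e => ?_⟩
  set S := √(∑ T ∈ 𝒯.cells, residualSq 𝒯 g q.toFun T) with hS
  have hS0 : 0 ≤ S := Real.sqrt_nonneg _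
  have htest (φ : E d → ℝ) (hφ : IsTest Ω φ) :
      (∫ x in Ω, g x * φ x) - ∫ x in Ω, inner ℝ (gradient φ x) (q.grad x)
        ≤ (B * √K + 1) * S * l2norm Ω (gradient φ) := by
    obtain ⟨m, hm, P, hP, hPsum⟩ := hqi 𝒯 hreg φ hφ
    rw [𝒯.residual_eq hΩ hg hq heq hφ hm, Finset.sum_add_distrib, 𝒯.sum_flux_eq (by omega) hΩ hφ hm]
    have hcell (T) (hT : T ∈ 𝒯.cells) : (∫ x in simplex T, g x * (φ x - interp m T x)) +
        ∑ T' ∈ sideNeighbours 𝒯 T,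
            |jump q.toFun T T' * Mesh.sideFlux T T' (fun x => φ x - interp m T x)|
          ≤ B * (√(residualSq 𝒯 g q.toFun T) * P T) := by
      obtain ⟨hP0, hP1, hP2⟩ := hP T hT
      have hs := (𝒯.isCell hT).size_pos (by omega)
      have hw := contDiff_sub_interp hφ.contDiff_one m T
      have b1 : (∫ x in simplex T, g x * (φ x - interp m T x))
          ≤ K * (√(residualSq 𝒯 g q.toFun T) * P T) := by
        have c1 := abs_integral_mul_le (𝒯.memLp_simplex hΩ hT hg)
          (memLp_simplex_of_continuous (T := T) hw.continuous)
        have c2 : size T * l2norm (simplex T) g ≤ √(residualSq 𝒯 g q.toFun T) := by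
          apply Real.le_sqrt_of_sq_le
          rw [mul_pow, residualSq]
          linarith [mul_nonneg hs.le (jumpNormSq_nonneg 𝒯 q.toFun T)]
        calc _ ≤ l2norm (simplex T) g * l2norm (simplex T) (fun x => φ x - interp m T x) :=
              (le_abs_self _).trans c1
          _ ≤ l2norm (simplex T) g * (K * size T * P T) := by
              gcongr
              exact l2norm_nonneg
          _ = K * ((size T * l2norm (simplex T) g) * P T) := by ring
          _ ≤ _ := by gcongr
      have b2 := 𝒯.sum_jump_le (by omega) hσ0 hC hK hvol hT (hreg T hT) q.toFun hw hP0 hP1 hP2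
      have b3 : √(size T * jumpNormSq 𝒯 q.toFun T) ≤ √(residualSq 𝒯 g q.toFun T) := by
        apply Real.sqrt_le_sqrt
        rw [residualSq]
        linarith [mul_nonneg (sq_nonneg (size T)) (sq_nonneg (l2norm (simplex T) g))]
      have b4 : σ * (d + 1) ^ 2 * K * √C * √(size T * jumpNormSq 𝒯 q.toFun T) * P T
          ≤ σ * (d + 1) ^ 2 * K * √C * √(residualSq 𝒯 g q.toFun T) * P T := by gcongr
      rw [hB]
      linarith
    have hcs : ∑ T ∈ 𝒯.cells, √(residualSq 𝒯 g q.toFun T) * P T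
        ≤ S * (√K * l2norm Ω (gradient φ)) := by
      have h1 := Real.sum_mul_le_sqrt_mul_sqrt 𝒯.cells (fun T => √(residualSq 𝒯 g q.toFun T)) P
      simp_rw [Real.sq_sqrt (residualSq_nonneg 𝒯 g q.toFun _)] at h1
      refine h1.trans ?_
      gcongr
      refine (Real.sqrt_le_sqrt hPsum).trans (le_of_eq ?_)
      rw [Real.sqrt_mul hK, Real.sqrt_sq l2norm_nonneg]
    have hl : 0 ≤ l2norm Ω (gradient φ) := l2norm_nonneg
    calc _ ≤ (∑ T ∈ 𝒯.cells, ∫ x in simplex T, g x * (φ x - interp m T x)) +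
          ∑ T ∈ 𝒯.cells, ∑ T' ∈ sideNeighbours 𝒯 T,
            |jump q.toFun T T' * Mesh.sideFlux T T' (fun x => φ x - interp m T x)| := by
          have a1 : ∑ T ∈ 𝒯.cells, ∑ T' ∈ sideNeighbours 𝒯 T,
              jump q.toFun T T' * Mesh.sideFlux T T' (fun x => φ x - interp m T x)
              ≤ ∑ T ∈ 𝒯.cells, ∑ T' ∈ sideNeighbours 𝒯 T,
            |jump q.toFun T T' * Mesh.sideFlux T T' (fun x => φ x - interp m T x)| := by
            gcongr; exact le_abs_self _
          have a2 : 0 ≤ ∑ T ∈ 𝒯.cells, ∑ T' ∈ sideNeighbours 𝒯 T,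
            |jump q.toFun T T' * Mesh.sideFlux T T' (fun x => φ x - interp m T x)| := by positivity
          linarith
      _ ≤ ∑ T ∈ 𝒯.cells, B * (√(residualSq 𝒯 g q.toFun T) * P T) := by
          rw [← Finset.sum_add_distrib]
          exact Finset.sum_le_sum hcell
      _ ≤ B * (S * (√K * l2norm Ω (gradient φ))) := by
          rw [← Finset.mul_sum]; gcongr
      _ ≤ _ := by linarith [mul_nonneg hS0 hl]
  -- Both sides are continuous in the H¹ norm, so the bound passes from test functions to e.
  obtain ⟨φ, hφ, t1, t2⟩ := e.exists_seq
  have l1 := tendsto_integral_mul hg e.memLp (fun n => (hφ n).memLp) t1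
  have l2 := tendsto_integral_inner q.grad_memLp e.grad_memLp (fun n => (hφ n).memLp_gradient) t2
  have l3 := tendsto_eLpNorm_toReal e.grad_memLp (fun n => (hφ n).memLp_gradient) t2
  have comm (f : E d → E d) : ∫ x in Ω, inner ℝ (q.grad x) (f x)
      = ∫ x in Ω, inner ℝ (f x) (q.grad x) := by
    simp_rw [fun x => real_inner_comm (f x) (q.grad x)]
  rw [comm] at l2
  replace l2 := l2.congr fun n => comm _
  exact le_of_tendsto_of_tendsto' (l1.sub l2) (l3.const_mul _) fun n => htest (φ n) (hφ n)

end

/-! ### The linearized coefficient -/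

section

variable {d : ℕ} {Ω : Set (E d)}

/-- Superposition with a Carathéodory function preserves measurability. -/
lemma aestronglyMeasurable_superposition {α : Type*} [MeasurableSpace α] {μ : Measure α}
    {b : α → ℝ → ℝ} (hb : ∀ c, AEStronglyMeasurable (fun x => b x c) μ)
    (hc : ∀ᵐ x ∂μ, Continuous (b x)) {y : α → ℝ} (hy : AEStronglyMeasurable y μ) :
    AEStronglyMeasurable (fun x => b x (y x)) μ := by
  obtain ⟨y', hy', hyy⟩ := hy
  have hs (s : SimpleFunc α ℝ) : AEStronglyMeasurable (fun x => b x (s x)) μ := by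
    have : (fun x => b x (s x)) = fun x => ∑ c ∈ s.range,
        (s ⁻¹' {c}).indicator (fun x => b x c) x := by
      ext x
      rw [Finset.sum_eq_single (s x)]
      · exact (Set.indicator_of_mem (show x ∈ s ⁻¹' {s x} from rfl) (fun x' => b x' (s x))).symm
      · intro c _ hcx
        exact Set.indicator_of_notMem
            (fun h : x ∈ s ⁻¹' {c} => hcx (Set.mem_singleton_iff.1 h).symm) _
      · exact fun h => absurd (s.mem_range_self x) h
    rw [this]
    exact Finset.aestronglyMeasurable_fun_sum _ fun c _ =>
        (hb c).indicator (s.measurableSet_fiber c)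
  have h := aestronglyMeasurable_of_tendsto_ae atTop (fun n => hs (hy'.approx n))
    (g := fun x => b x (y' x)) (hc.mono fun x hx => (hx.tendsto _).comp (hy'.tendsto_approx x))
  exact h.congr (hyy.mono fun x hx => by simp only [hx])

/-- For a fixed second argument the derivative is a pointwise limit of measurable difference
quotients; being continuous in that argument, it is again a Carathéodory function. -/
lemma IsAdmissibleNonlinearity.aestronglyMeasurable_deriv {a : E d → ℝ → ℝ}
    (ha : IsAdmissibleNonlinearity Ω a) {y : E d → ℝ}
    (hy : AEStronglyMeasurable y (volume.restrict Ω)) :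
    AEStronglyMeasurable (fun x => deriv (a x) (y x)) (volume.restrict Ω) := by
  refine aestronglyMeasurable_superposition (fun c => ?_) ?_ hy
  · refine aestronglyMeasurable_of_tendsto_ae atTop
      (f := fun (n : ℕ) x => ((n : ℝ) + 1) * (a x (c + ((n : ℝ) + 1)⁻¹) - a x c))
      (fun n => ((ha.measurable _).sub (ha.measurable _)).const_mul _) ?_
    filter_upwards [ha.contDiff] with x hx
    have h1 := (hx.differentiable two_ne_zero c).hasDerivAt.tendsto_slope_zero
    have h2 : Tendsto (fun n : ℕ => ((n : ℝ) + 1)⁻¹) atTop (𝓝[≠] 0) := by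
      refine tendsto_nhdsWithin_iff.2 ⟨?_, .of_forall fun n => ?_⟩
      · simpa only [one_div] using tendsto_one_div_add_atTop_nhds_zero_nat (𝕜 := ℝ)
      · have : (0 : ℝ) < ((n : ℝ) + 1)⁻¹ := by positivity
        exact this.ne'
    refine (h1.comp h2).congr fun n => ?_
    simp
  · exact ha.contDiff.mono fun x hx => hx.continuous_deriv one_le_two

/-- A discrete state is continuous on a compact set, hence bounded, and the local bound on the
derivatives applies. This bound serves integrability only and does not enter the final constant. -/
lemma exists_bound_of_feSpace (hΩ : IsLipschitzDomain Ω) {𝒯 : Mesh Ω} {y : H01 Ω}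
    (hy : y ∈ feSpace 𝒯)
    {a : E d → ℝ → ℝ} (ha : IsAdmissibleNonlinearity Ω a) :
    ∃ C, ∀ᵐ x ∂(volume.restrict Ω), ‖deriv (a x) (y.toFun x)‖ ≤ C := by
  obtain ⟨M, hM⟩ := hΩ.isBounded.isCompact_closure.exists_bound_of_continuousOn hy.1
  obtain ⟨C, -, hC⟩ := ha.deriv_bound (max M 1) (by positivity)
  refine ⟨C, ?_⟩
  filter_upwards [hC, ae_restrict_mem hΩ.isOpen.measurableSet] with x hx hxΩ
  have h1 := hx (y.toFun x) ((hM x (subset_closure hxΩ)).trans (le_max_left _ _))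
  rw [Real.norm_eq_abs]
  linarith [abs_nonneg (iteratedDeriv 2 (a x) (y.toFun x))]

end

end SemilinearOCP

end

/-! ### The a posteriori bound for the adjoint state. -/

open SemilinearOCP
theorem lemma5p1 (d : ℕ) (hd : d = 2 ∨ d = 3) (Ω : Set (E d)) (hΩ : IsLipschitzDomain Ω)
    (𝒯₀ : Mesh Ω) (σ : ℝ) :
    ∃ C : ℝ, 0 < C ∧
      ∀ (a : E d → ℝ → ℝ) (yΩ : E d → ℝ) (ν lo hi : ℝ),
        IsAdmissibleNonlinearity Ω a → MemLp yΩ 2 (volume.restrict Ω) → 0 < ν → lo < hi →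
      ∀ (u : E d → ℝ) (y : H01 Ω), IsLocalSolution Ω a yΩ ν lo hi u y →
      ∀ 𝒯 ∈ meshFamily 𝒯₀ σ, ∀ (uT : E d → ℝ) (yT pT : H01 Ω),
        IsDiscreteLocalMin 𝒯 a yΩ ν lo hi uT yT → IsDiscreteAdjoint 𝒯 a yΩ yT pT →
      ∀ pHat : H01 Ω, IsAdjoint a yΩ yT pHat →
        l2norm Ω (fun x => pHat.grad x - pT.grad x) ≤ C * estimator 𝒯 a yΩ yT pT := by
  -- The auxiliary results assume a regularity constant of at least 1; enlarging σ preserves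
  -- regularity.
  obtain ⟨C, hC, hbound⟩ := hΩ.exists_residual_bound (show 2 ≤ d by omega) (le_max_right σ 1)
  refine ⟨C, hC, fun a yΩ ν lo hi ha hyΩ _ _ _ _ _ 𝒯 h𝒯 uT yT pT huT hpT pHat hpHat => ?_⟩
  have hreg : ∀ T ∈ 𝒯.cells, CellRegular (max σ 1) T := fun T hT => by
    obtain ⟨c, r, hr, hc, hsz⟩ := h𝒯.2 T hT
    exact ⟨c, r, hr, hc, hsz.trans (by gcongr; exact le_max_left _ _)⟩
  set b : E d → ℝ := fun x => deriv (a x) (yT.toFun x) with hb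
  obtain ⟨B, hB⟩ := exists_bound_of_feSpace hΩ huT.2.1.1 ha
  have hbm := ha.aestronglyMeasurable_deriv yT.memLp.aestronglyMeasurable
  have hmul {p : E d → ℝ} (hp : MemLp p 2 (volume.restrict Ω)) :
      MemLp (fun x => b x * p x) 2 (volume.restrict Ω) :=
    hp.mul (memLp_top_of_bound hbm B hB)
  -- The zero-order term is moved to the data, so that the discrete adjoint state is the Galerkin
  -- solution of a Poisson problem.
  set g : E d → ℝ := fun x => yT.toFun x - yΩ x - b x * pT.toFun x with hg
  have hY : MemLp (fun x => yT.toFun x - yΩ x) 2 (volume.restrict Ω) := yT.memLp.sub hyΩ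
  have hgm : MemLp g 2 (volume.restrict Ω) := hY.sub (hmul pT.memLp)
  have hgint (v : H01 Ω) : ∫ x in Ω, g x * v.toFun x = (∫ x in Ω, (yT.toFun x - yΩ x) * v.toFun x)
      - ∫ x in Ω, b x * pT.toFun x * v.toFun x := by
    rw [← integral_sub (integrable_mul_of_memLp hY v.memLp)
      (integrable_mul_of_memLp (hmul pT.memLp) v.memLp)]
    simp only [hg, sub_mul]
  have hres := hbound 𝒯 hreg g hgm pT hpT.1 (fun v hv => by
    have := hpT.2 v hv
    rw [AdjointEq] at this
    rw [hgint]
    linarith) (pHat.addSmul pT (-1))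
  set e := pHat.addSmul pT (-1) with he
  have hef (x : E d) : e.toFun x = pHat.toFun x - pT.toFun x := by
    rw [he]
    change pHat.toFun x + -1 * pT.toFun x = _
    ring
  have heg : (fun x => pHat.grad x - pT.grad x) = e.grad := by
    ext1 x
    change _ = pHat.grad x + (-1 : ℝ) • pT.grad x
    rw [neg_one_smul, sub_eq_add_neg]
  have hest : √(∑ T ∈ 𝒯.cells, residualSq 𝒯 g pT.toFun T) = estimator 𝒯 a yΩ yT pT := rfl
  rw [hest] at hres
  -- Monotonicity of the nonlinearity: this term has the right sign and is dropped.
  have hpos : 0 ≤ ∫ x in Ω, b x * e.toFun x * e.toFun x := by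
    refine integral_nonneg_of_ae ?_
    filter_upwards [ha.deriv_nonneg] with x hx
    have : 0 ≤ b x * (e.toFun x * e.toFun x) := mul_nonneg (hx _) (mul_self_nonneg _)
    simpa only [Pi.zero_apply, mul_assoc] using this
  have hbe : ∫ x in Ω, b x * e.toFun x * e.toFun x = (∫ x in Ω, b x * pHat.toFun x * e.toFun x)
      - ∫ x in Ω, b x * pT.toFun x * e.toFun x := by
    rw [← integral_sub (integrable_mul_of_memLp (hmul pHat.memLp) e.memLp)
      (integrable_mul_of_memLp (hmul pT.memLp) e.memLp)]
    congr 1; ext x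
    rw [hef]; ring
  have hsq : l2norm Ω e.grad ^ 2 = (∫ x in Ω, inner ℝ (e.grad x) (pHat.grad x))
      - ∫ x in Ω, inner ℝ (e.grad x) (pT.grad x) := by
    rw [← integral_sub (integrable_inner_of_memLp e.grad_memLp pHat.grad_memLp)
      (integrable_inner_of_memLp e.grad_memLp pT.grad_memLp)]
    simp_rw [← inner_sub_right, fun x => congrFun heg x, real_inner_self_eq_norm_sq]
    rw [l2norm, eLpNorm_two_eq, toReal_rpow_half_sq, integral_eq_lintegral_of_nonneg_ae]
    · simp_rw [ENNReal.ofReal_pow (norm_nonneg _), ofReal_norm]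
    · exact .of_forall fun x => sq_nonneg _
    · exact e.grad_memLp.aestronglyMeasurable.norm.pow 2
  have hadj := hpHat e
  rw [AdjointEq] at hadj
  have hfinal : l2norm Ω e.grad ^ 2 ≤ C * estimator 𝒯 a yΩ yT pT * l2norm Ω e.grad := by
    rw [hgint] at hres
    linarith
  rw [heg]
  -- One factor of the norm is cancelled, which requires that it be nonzero.
  rcases (l2norm_nonneg : 0 ≤ l2norm Ω e.grad).eq_or_lt with h0 | h0
  · rw [← h0]
    exact mul_nonneg hC.le (Real.sqrt_nonneg _)
  · exact le_of_mul_le_mul_right (by rw [← sq]; exact hfinal) h0
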